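/- Let $d\ge 2$, $\alpha\in\mathbb R^d$, $\omega\in\mathbb R$, and suppose that for some $\nu,\tau>0$ $$|\omega\,\alpha\cdot k-n|\ \ge\ \nu\,|k|^{-\tau}\qquad\text{for all }k\in\mathbb Z^d\setminus\{0\},\ n\in\mathbb Z,\qquad |k|=|k_1|+\dots+|k_d| .$$ For $\rho>0$ let $D_\rho=\{\eta\in\mathbb C^d: |\mathrm{Im}\,\eta_i|<\rho \text{ for all } i\}$ and let $\mathscr A_\rho$ be the space of $\mathbb Z^d$-periodic functions that are holomorphic on $D_\rho$ and continuous on $\overline{D_\rho}$, with $\|f\|_\rho=\sup_{\overline{D_\rho}}|f|$. Write $\langle f\rangle=\int_{\mathbb T^d}f$ and $\partial_\alpha=\alpha\cdot\nabla$. Let $\rho_0>0$ and let $\widehat U\in\mathscr A_{\rho_0}$ be real on $\mathbb R^d$. For $\varepsilon\in\mathbb C$ consider the hull equation with interaction $\varepsilon\widehat U$ and the normalization $$\hat h(\sigma+\omega\alpha)+\hat h(\sigma-\omega\alpha)-2\hat h(\sigma)+\varepsilon\,\widehat U(\sigma+\alpha\,\hat h(\sigma))+\lambda=0,\qquad \langle\hat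 h\rangle=0. \qquad(*)$$ 1. (Formal series to all orders.) There are functions $\hat h^n$ ($n\ge0$), real on $\mathbb R^d$ and belonging to $\mathscr A_\rho$ for every $0<\rho<\rho_0$, and numbers $\lambda^n\in\mathbb R$, such that $\hat h_\varepsilon=\sum_n\varepsilon^n\hat h^n$ and $\lambda_\varepsilon=\sum_n\varepsilon^n\lambda^n$ satisfy $(*)$ at every $\sigma\in\mathbb T^d$ as an identity of formal power series in $\varepsilon$. They are unique: any complex formal series solving $(*)$, whose coefficient functions each belong to $\mathscr A_\rho$ for some $\rho>0$, has the same coefficients. Here $\hat h^0=0$ and $\lambda^0=0$, and for each $n\ge1$ the pair $(\hat h^n,\lambda^n)$ is the unique solution with $\langle\hat h^n\rangle=0$ of the cohomological equation $$\hat h^n(\sigma+\omega\alpha)+\hat h^n(\sigma-\omega\alpha)-2\hat h^n(\sigma)+R_n(\sigma)+\lambda^n=0,$$ $$R_n=\sum_{j=0}^{n-1}\frac1{j!}\,\partial_\alpha^j\widehat U\sum_{\substack{m_1+\dots+m_j=n-1\\ m_i\ge1}}\hat h^{m_1}\cdots\hat h^{m_j},$$ whose term $R_n$ involves only $\hat h^1,\dots,\hat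 h^{n-1}$ and derivatives of $\widehat U$; in particular $R_1=\widehat U$, and $\lambda^n=-\langle R_n\rangle$. 2. (Convergence.) For every $0<\rho<\rho_0$ there are $r>0$ and $\delta>0$ such that $\sum_n r^n\|\hat h^n\|_\rho<\infty$ and $\sum_n r^n|\lambda^n|<\infty$, and for every complex $\varepsilon$ with $|\varepsilon|\le r$ the sums $\hat h_\varepsilon\in\mathscr A_\rho$, $\lambda_\varepsilon\in\mathbb C$ (which depend analytically on $\varepsilon$) satisfy $\sigma+\alpha\hat h_\varepsilon(\sigma)\in D_{\rho_0}$ for $\sigma\in\overline{D_\rho}$ and solve $(*)$ on $\overline{D_\rho}$. This solution is locally unique: if $\hat g\in\mathscr A_\rho$ and $c\in\mathbb C$ solve $(*)$ on $\overline{D_\rho}$, with $\sigma+\alpha\hat g(\sigma)\in D_{\rho_0}$ there, and $\|\hat g-\hat h_\varepsilon\|_\rho\le\delta$, then $\hat g=\hat h_\varepsilon$ on $\overline{D_\rho}$ and $c=\lambda_\varepsilon$. -/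

import Mathlib

open scoped BigOperators

noncomputable section

namespace QPLindstedt

variable {d : ℕ}

/-- The inclusion of real points `σ ∈ ℝ^d` into `ℂ^d`. -/
def toC (σ : Fin d → ℝ) : Fin d → ℂ := fun i => (σ i : ℂ)

/-- The open complex strip `D_ρ = {η | |Im η_i| < ρ for all i}`. -/
def strip (d : ℕ) (ρ : ℝ) : Set (Fin d → ℂ) := {η | ∀ i, |(η i).im| < ρ}

/-- The closed complex strip `{η | |Im η_i| ≤ ρ for all i}`. -/
def closedStrip (d : ℕ) (ρ : ℝ) : Set (Fin d → ℂ) := {η | ∀ i, |(η i).im| ≤ ρ}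

/-- The space `𝒜_ρ`: `ℤ^d`-periodic functions, holomorphic on the open strip `D_ρ` and
continuous on the closed strip.  Only the values on the closed strip matter. -/
structure MemA (ρ : ℝ) (f : (Fin d → ℂ) → ℂ) : Prop where
  periodic : ∀ η ∈ closedStrip d ρ, ∀ k : Fin d → ℤ, f (η + fun i => (k i : ℂ)) = f η
  holomorphic : DifferentiableOn ℂ f (strip d ρ)
  continuousOn : ContinuousOn f (closedStrip d ρ)

/-- The norm `‖f‖_ρ = sup |f|` over the closed strip (a finite supremum for `f ∈ 𝒜_ρ`). -/
def stripNorm (ρ : ℝ) (f : (Fin d → ℂ) → ℂ) : ℝ := ⨆ η : closedStrip d ρ, ‖f η‖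

/-- `f` takes real values at real points. -/
def RealOnReal (f : (Fin d → ℂ) → ℂ) : Prop := ∀ σ : Fin d → ℝ, (f (toC σ)).im = 0

/-- The average `⟨f⟩` of `f` over the torus `ℝ^d / ℤ^d`. -/
def average (f : (Fin d → ℂ) → ℂ) : ℂ :=
  ∫ σ in Set.Icc (0 : Fin d → ℝ) 1, f (toC σ)

/-- `|ω α·k - n| ≥ ν |k|^{-τ}` for all `k ∈ ℤ^d \ {0}`, `n ∈ ℤ`, with `|k| = |k_1| + ⋯ + |k_d|`. -/
def IsDiophantine (ω : ℝ) (α : Fin d → ℝ) (ν τ : ℝ) : Prop :=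
  ∀ k : Fin d → ℤ, k ≠ 0 → ∀ n : ℤ,
    ν * (∑ i, |(k i : ℝ)|) ^ (-τ) ≤ |ω * (∑ i, α i * (k i : ℝ)) - (n : ℝ)|

/-- `f(η + ωα) + f(η - ωα) - 2 f(η)`. -/
def secondDiff (ω : ℝ) (α : Fin d → ℝ) (f : (Fin d → ℂ) → ℂ) (η : Fin d → ℂ) : ℂ :=
  f (η + (ω : ℂ) • toC α) + f (η - (ω : ℂ) • toC α) - 2 * f η

/-- The hull operator `ℰ[h, l](η) = h(η + ωα) + h(η - ωα) - 2 h(η) + U(η + α h(η)) + l`. -/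
def hullOperator (ω : ℝ) (α : Fin d → ℝ) (U h : (Fin d → ℂ) → ℂ) (l : ℂ)
    (η : Fin d → ℂ) : ℂ :=
  secondDiff ω α h η + U (η + h η • toC α) + l

/-- The directional derivative `∂_α^j U = (α·∇)^j U`. -/
def dirDeriv (α : Fin d → ℝ) (j : ℕ) (U : (Fin d → ℂ) → ℂ) (η : Fin d → ℂ) : ℂ :=
  iteratedDeriv j (fun t : ℂ => U (η + t • toC α)) 0

/-- The formal power series `∑ εⁿ hⁿ(η)` in `ε` at a point `η`. -/
def seriesAt (h : ℕ → (Fin d → ℂ) → ℂ) (η : Fin d → ℂ) : PowerSeries ℂ :=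
  PowerSeries.mk fun n => h n η

/-- The Taylor series `∑_j (1/j!) ∂_α^j U(η) T^j` of `t ↦ U(η + t α)` at `t = 0`. -/
def taylorAlong (α : Fin d → ℝ) (U : (Fin d → ℂ) → ℂ) (η : Fin d → ℂ) : PowerSeries ℂ :=
  PowerSeries.mk fun j => ((j.factorial : ℂ))⁻¹ * dirDeriv α j U η

/-- The formal power series in `ε` of `U(η + α ∑ εⁿ hⁿ(η))`: the Taylor series of `U` in the
direction `α` at the point `η + α h⁰(η)`, with `∑_{n ≥ 1} εⁿ hⁿ(η)` substituted into it. -/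
def formalComp (α : Fin d → ℝ) (U : (Fin d → ℂ) → ℂ) (h : ℕ → (Fin d → ℂ) → ℂ)
    (η : Fin d → ℂ) : PowerSeries ℂ :=
  PowerSeries.subst (seriesAt h η - PowerSeries.C (h 0 η))
    (taylorAlong α U (η + h 0 η • toC α))

/-- The formal series `∑ εⁿ hⁿ`, `∑ εⁿ lⁿ` solve the hull equation with interaction `ε U`,
`h(σ + ωα) + h(σ - ωα) - 2 h(σ) + ε U(σ + α h(σ)) + l = 0`, as an identity of formal power
series in `ε` at every point `σ` of the torus. -/
def FormalHullSolution (ω : ℝ) (α : Fin d → ℝ) (U : (Fin d → ℂ) → ℂ)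
    (h : ℕ → (Fin d → ℂ) → ℂ) (l : ℕ → ℂ) : Prop :=
  ∀ σ : Fin d → ℝ,
    seriesAt h (toC σ + (ω : ℂ) • toC α) + seriesAt h (toC σ - (ω : ℂ) • toC α)
      - 2 * seriesAt h (toC σ)
      + PowerSeries.X * formalComp α U h (toC σ) + PowerSeries.mk l = 0

/-- The normalization `⟨∑ εⁿ hⁿ⟩ = 0` in the sense of formal power series. -/
def FormalNormalized (h : ℕ → (Fin d → ℂ) → ℂ) : Prop := ∀ n, average (h n) = 0

/-- The known term of the cohomological equation at order `n ≥ 1`,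
`R_n = ∑_{j < n} (1/j!) ∂_α^j U ∑_{m_1 + ⋯ + m_j = n - 1, m_i ≥ 1} h^{m_1} ⋯ h^{m_j}`:
a polynomial in `h¹, …, h^{n-1}` whose coefficients are derivatives of `U`. -/
def knownTerm (α : Fin d → ℝ) (U : (Fin d → ℂ) → ℂ) (h : ℕ → (Fin d → ℂ) → ℂ) (n : ℕ)
    (η : Fin d → ℂ) : ℂ :=
  ∑ j ∈ Finset.range n, ((j.factorial : ℂ))⁻¹ * dirDeriv α j U η *
    ∑ m ∈ ((Finset.univ : Finset (Fin j)).piAntidiag (n - 1)).filter (fun m => ∀ i, 1 ≤ m i),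
      ∏ i, h (m i) η

/-- `φ(σ + ωα) + φ(σ - ωα) - 2 φ(σ) + R(σ) + l = 0` at every point `σ` of the torus. -/
def SolvesCohomological (ω : ℝ) (α : Fin d → ℝ) (R φ : (Fin d → ℂ) → ℂ) (l : ℂ) : Prop :=
  ∀ σ : Fin d → ℝ, secondDiff ω α φ (toC σ) + R (toC σ) + l = 0

/-- For `|ε| ≤ r` the pair `H ε`, `L ε` is the sum of the series `∑ εⁿ hⁿ`, `∑ εⁿ lⁿ`, which
converge (absolutely, uniformly for `|ε| ≤ r`) in `𝒜_ρ` and in `ℂ`. -/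
structure ConvergesTo (ρ r : ℝ) (h : ℕ → (Fin d → ℂ) → ℂ) (l : ℕ → ℂ)
    (H : ℂ → (Fin d → ℂ) → ℂ) (L : ℂ → ℂ) : Prop where
  memA : ∀ n, MemA ρ (h n)
  summable_h : Summable fun n => r ^ n * stripNorm ρ (h n)
  summable_l : Summable fun n => r ^ n * ‖l n‖
  hasSum_h : ∀ ε : ℂ, ‖ε‖ ≤ r → ∀ η ∈ closedStrip d ρ, HasSum (fun n => ε ^ n * h n η) (H ε η)
  hasSum_l : ∀ ε : ℂ, ‖ε‖ ≤ r → HasSum (fun n => ε ^ n * l n) (L ε)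

/-- `h ∈ 𝒜_ρ` has zero average and, with `l`, solves `ℰ[h, l] = 0` on the closed strip, where
`U` is a function on the open strip `D_ρ₀` and the composition `U(η + α h(η))` makes sense. -/
structure NormalizedHullSolution (ω : ℝ) (α : Fin d → ℝ) (ρ₀ : ℝ) (U : (Fin d → ℂ) → ℂ)
    (ρ : ℝ) (h : (Fin d → ℂ) → ℂ) (l : ℂ) : Prop where
  memA : MemA ρ h
  normalized : average h = 0
  mapsTo : ∀ η ∈ closedStrip d ρ, η + h η • toC α ∈ strip d ρ₀
  equation : ∀ η ∈ closedStrip d ρ, hullOperator ω α U h l η = 0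

end QPLindstedt

end

open scoped BigOperators

noncomputable section

namespace QPLindstedt

variable {d : ℕ}

/-! ### Weighted Wiener algebras -/

/-- The length `|k| = |k_1| + ⋯ + |k_d|`. -/
def absZ (k : Fin d → ℤ) : ℝ := ∑ i, |(k i : ℝ)|

/-- The character `exp (2πi k·η)`. -/
def character (k : Fin d → ℤ) (η : Fin d → ℂ) : ℂ :=
  Complex.exp (2 * Real.pi * Complex.I * ∑ i, (k i : ℂ) * η i)

/-- The monomial `exp (2πi k·η) εⁿ`, for `m = (k, n)`. -/
def monom (m : (Fin d → ℤ) × ℕ) (η : Fin d → ℂ) (ε : ℂ) : ℂ := character m.1 η * ε ^ m.2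

/-- The weight `exp (2πρ |k|) rⁿ`, for `m = (k, n)`. -/
def weight (ρ r : ℝ) (m : (Fin d → ℤ) × ℕ) : ℝ := Real.exp (2 * Real.pi * ρ * absZ m.1) * r ^ m.2

/-- On the closed strip of width `ρ` and the closed disc of radius `r`, the function `f` is the sum
of the series with coefficients `c`, which converges absolutely for the corresponding weight. -/
structure HasCoeff (ρ r : ℝ) (f : (Fin d → ℂ) → ℂ → ℂ) (c : (Fin d → ℤ) × ℕ → ℂ) : Prop where
  summable : Summable fun m => ‖c m‖ * weight ρ r m
  hasSum : ∀ η ∈ closedStrip d ρ, ∀ ε : ℂ, ‖ε‖ ≤ r → HasSum (fun m => c m * monom m η ε) (f η ε)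

/-- The weighted `ℓ¹` norm of `f` is at most `M`. -/
def Wiener (ρ r : ℝ) (f : (Fin d → ℂ) → ℂ → ℂ) (M : ℝ) : Prop :=
  ∃ c, HasCoeff ρ r f c ∧ ∑' m, ‖c m‖ * weight ρ r m ≤ M

lemma absZ_nonneg (k : Fin d → ℤ) : 0 ≤ absZ k := Finset.sum_nonneg fun _ _ => abs_nonneg _

lemma absZ_add_le (k l : Fin d → ℤ) : absZ (k + l) ≤ absZ k + absZ l := by
  unfold absZ
  rw [← Finset.sum_add_distrib]
  exact Finset.sum_le_sum fun i _ => by simpa using abs_add_le (k i : ℝ) (l i)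

lemma absZ_zero : absZ (0 : Fin d → ℤ) = 0 := by simp [absZ]

lemma one_le_absZ {k : Fin d → ℤ} (hk : k ≠ 0) : 1 ≤ absZ k := by
  obtain ⟨i, hi⟩ := Function.ne_iff.1 hk
  have h1 : (1 : ℝ) ≤ |(k i : ℝ)| := by exact_mod_cast Int.one_le_abs hi
  exact h1.trans (Finset.single_le_sum (f := fun i => |(k i : ℝ)|) (fun _ _ => abs_nonneg _)
    (Finset.mem_univ i))

lemma closedStrip_mono {ρ ρ' : ℝ} (h : ρ' ≤ ρ) : closedStrip d ρ' ⊆ closedStrip d ρ :=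
  fun _ hη i => (hη i).trans h

lemma strip_subset_closedStrip {ρ ρ' : ℝ} (h : ρ' ≤ ρ) : strip d ρ' ⊆ closedStrip d ρ :=
  fun _ hη i => (hη i).le.trans h

lemma closedStrip_subset_strip {ρ ρ' : ℝ} (h : ρ' < ρ) : closedStrip d ρ' ⊆ strip d ρ :=
  fun _ hη i => (hη i).trans_lt h

lemma toC_mem_closedStrip {ρ : ℝ} (hρ : 0 ≤ ρ) (σ : Fin d → ℝ) : toC σ ∈ closedStrip d ρ :=
  fun i => by simpa [toC] using hρ

lemma add_toC_mem_closedStrip {ρ : ℝ} {η : Fin d → ℂ} (hη : η ∈ closedStrip d ρ) (s : Fin d → ℝ) :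
    η + toC s ∈ closedStrip d ρ := fun i => by simpa [toC] using hη i

lemma toC_add (s t : Fin d → ℝ) : toC (s + t) = toC s + toC t := by ext; simp [toC]

lemma toC_neg (s : Fin d → ℝ) : toC (-s) = -toC s := by ext; simp [toC]

lemma toC_zero : toC (0 : Fin d → ℝ) = 0 := by ext; simp [toC]

lemma toC_smul (t : ℝ) (s : Fin d → ℝ) : toC (t • s) = (t : ℂ) • toC s := by ext; simp [toC]

lemma character_add (k : Fin d → ℤ) (η ζ : Fin d → ℂ) :
    character k (η + ζ) = character k η * character k ζ := by
  unfold character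
  rw [← Complex.exp_add, ← mul_add, ← Finset.sum_add_distrib]
  simp [mul_add]

lemma character_add_index (k l : Fin d → ℤ) (η : Fin d → ℂ) :
    character (k + l) η = character k η * character l η := by
  unfold character
  rw [← Complex.exp_add, ← mul_add, ← Finset.sum_add_distrib]
  simp [add_mul]

lemma character_zero (η : Fin d → ℂ) : character 0 η = 1 := by simp [character]

lemma character_zero_right (k : Fin d → ℤ) : character k 0 = 1 := by simp [character]

lemma norm_character (k : Fin d → ℤ) (η : Fin d → ℂ) :
    ‖character k η‖ = Real.exp (-(2 * Real.pi) * ∑ i, (k i : ℝ) * (η i).im) := by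
  unfold character
  rw [Complex.norm_exp]
  congr 1
  have : (2 * Real.pi * Complex.I * ∑ i, (k i : ℂ) * η i : ℂ)
      = ((2 * Real.pi : ℝ) : ℂ) * (Complex.I * ∑ i, (k i : ℂ) * η i) := by push_cast; ring
  rw [this, Complex.re_ofReal_mul, Complex.I_mul_re, Complex.im_sum]
  have h2 : ∀ i, ((k i : ℂ) * η i).im = (k i : ℝ) * (η i).im := fun i => by
    simp [Complex.mul_im]
  simp only [h2]; ring

lemma norm_character_le {ρ : ℝ} (k : Fin d → ℤ) {η : Fin d → ℂ} (hη : η ∈ closedStrip d ρ) :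
    ‖character k η‖ ≤ Real.exp (2 * Real.pi * ρ * absZ k) := by
  rw [norm_character]
  apply Real.exp_le_exp.2
  have : -(∑ i, (k i : ℝ) * (η i).im) ≤ ρ * absZ k := by
    rw [← Finset.sum_neg_distrib, absZ, Finset.mul_sum]
    refine Finset.sum_le_sum fun i _ => ?_
    calc -((k i : ℝ) * (η i).im) ≤ |(k i : ℝ) * (η i).im| := neg_le_abs _
      _ = |(k i : ℝ)| * |(η i).im| := abs_mul _ _
      _ ≤ ρ * |(k i : ℝ)| := by
        rw [mul_comm]; exact mul_le_mul_of_nonneg_right (hη i) (abs_nonneg _)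
  nlinarith [Real.pi_pos]

lemma norm_character_toC (k : Fin d → ℤ) (s : Fin d → ℝ) : ‖character k (toC s)‖ = 1 := by
  rw [norm_character]; simp [toC]

lemma weight_nonneg {ρ r : ℝ} (hr : 0 ≤ r) (m : (Fin d → ℤ) × ℕ) : 0 ≤ weight ρ r m :=
  mul_nonneg (Real.exp_nonneg _) (pow_nonneg hr _)

lemma weight_pos {ρ r : ℝ} (hr : 0 < r) (m : (Fin d → ℤ) × ℕ) : 0 < weight ρ r m :=
  mul_pos (Real.exp_pos _) (pow_pos hr _)

lemma norm_monom_le {ρ r : ℝ} (m : (Fin d → ℤ) × ℕ) {η : Fin d → ℂ}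
    (hη : η ∈ closedStrip d ρ) {ε : ℂ} (hε : ‖ε‖ ≤ r) : ‖monom m η ε‖ ≤ weight ρ r m := by
  unfold monom weight
  rw [norm_mul, norm_pow]
  exact mul_le_mul (norm_character_le _ hη) (pow_le_pow_left₀ (norm_nonneg _) hε _)
    (by positivity) (by positivity)

lemma monom_add (m m' : (Fin d → ℤ) × ℕ) (η : Fin d → ℂ) (ε : ℂ) :
    monom (m + m') η ε = monom m η ε * monom m' η ε := by
  simp only [monom, Prod.fst_add, Prod.snd_add, character_add_index, pow_add]; ring

lemma weight_add_le {ρ r : ℝ} (hρ : 0 ≤ ρ) (hr : 0 ≤ r) (m m' : (Fin d → ℤ) × ℕ) :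
    weight ρ r (m + m') ≤ weight ρ r m * weight ρ r m' := by
  unfold weight
  rw [mul_mul_mul_comm, ← Real.exp_add, ← pow_add]
  refine mul_le_mul_of_nonneg_right (Real.exp_le_exp.2 ?_) (pow_nonneg hr _)
  have := absZ_add_le m.1 m'.1
  have h2 : 0 ≤ 2 * Real.pi * ρ := by positivity
  calc 2 * Real.pi * ρ * absZ (m.1 + m'.1) ≤ 2 * Real.pi * ρ * (absZ m.1 + absZ m'.1) :=
        mul_le_mul_of_nonneg_left this h2
    _ = _ := by ring

lemma weight_mono {ρ ρ' r r' : ℝ} (hρ : ρ' ≤ ρ) (hr0 : 0 ≤ r') (hr : r' ≤ r)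
    (m : (Fin d → ℤ) × ℕ) : weight ρ' r' m ≤ weight ρ r m := by
  unfold weight
  refine mul_le_mul (Real.exp_le_exp.2 ?_) (pow_le_pow_left₀ hr0 hr _) (pow_nonneg hr0 _)
    (Real.exp_nonneg _)
  exact mul_le_mul_of_nonneg_right (mul_le_mul_of_nonneg_left hρ (by positivity)) (absZ_nonneg _)

section Basic

variable {ρ r : ℝ} {f g : (Fin d → ℂ) → ℂ → ℂ} {M N : ℝ}

lemma norm_term_le (c : (Fin d → ℤ) × ℕ → ℂ) (m : (Fin d → ℤ) × ℕ) {η : Fin d → ℂ}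
    (hη : η ∈ closedStrip d ρ) {ε : ℂ} (hε : ‖ε‖ ≤ r) :
    ‖c m * monom m η ε‖ ≤ ‖c m‖ * weight ρ r m := by
  rw [norm_mul]; exact mul_le_mul_of_nonneg_left (norm_monom_le m hη hε) (norm_nonneg _)

lemma HasCoeff.of_summable {c : (Fin d → ℤ) × ℕ → ℂ}
    (h : Summable fun m => ‖c m‖ * weight ρ r m) :
    HasCoeff ρ r (fun η ε => ∑' m, c m * monom m η ε) c where
  summable := h
  hasSum _ hη _ hε := (Summable.of_norm_bounded h fun m => norm_term_le c m hη hε).hasSum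

lemma HasCoeff.norm_le {c : (Fin d → ℤ) × ℕ → ℂ} (h : HasCoeff ρ r f c) {η : Fin d → ℂ}
    (hη : η ∈ closedStrip d ρ) {ε : ℂ} (hε : ‖ε‖ ≤ r) :
    ‖f η ε‖ ≤ ∑' m, ‖c m‖ * weight ρ r m := by
  rw [← (h.hasSum η hη ε hε).tsum_eq]
  exact tsum_of_norm_bounded h.summable.hasSum fun m => norm_term_le c m hη hε

lemma Wiener.norm_le (h : Wiener ρ r f M) {η : Fin d → ℂ}
    (hη : η ∈ closedStrip d ρ) {ε : ℂ} (hε : ‖ε‖ ≤ r) : ‖f η ε‖ ≤ M := by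
  obtain ⟨c, hc, hM⟩ := h
  exact (hc.norm_le hη hε).trans hM

lemma Wiener.nonneg (hr : 0 ≤ r) (h : Wiener ρ r f M) : 0 ≤ M := by
  obtain ⟨c, _, hM⟩ := h
  exact (tsum_nonneg fun m => mul_nonneg (norm_nonneg _) (weight_nonneg hr m)).trans hM

lemma Wiener.mono_right (h : Wiener ρ r f M) (hMN : M ≤ N) : Wiener ρ r f N := by
  obtain ⟨c, hc, hM⟩ := h
  exact ⟨c, hc, hM.trans hMN⟩

lemma HasCoeff.mono {ρ' r' : ℝ} {c : (Fin d → ℤ) × ℕ → ℂ} (h : HasCoeff ρ r f c) (hρ : ρ' ≤ ρ)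
    (hr0 : 0 ≤ r') (hr : r' ≤ r) : HasCoeff ρ' r' f c where
  summable := h.summable.of_nonneg_of_le
    (fun m => mul_nonneg (norm_nonneg _) (weight_nonneg hr0 m))
    (fun m => mul_le_mul_of_nonneg_left (weight_mono hρ hr0 hr m) (norm_nonneg _))
  hasSum η hη ε hε := h.hasSum η (closedStrip_mono hρ hη) ε (hε.trans hr)

lemma Wiener.mono {ρ' r' : ℝ} (h : Wiener ρ r f M) (hρ : ρ' ≤ ρ) (hr0 : 0 ≤ r') (hr : r' ≤ r) :
    Wiener ρ' r' f M := by
  obtain ⟨c, hc, hM⟩ := h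
  refine ⟨c, hc.mono hρ hr0 hr, le_trans ?_ hM⟩
  exact (hc.mono hρ hr0 hr).summable.tsum_le_tsum
    (fun m => mul_le_mul_of_nonneg_left (weight_mono hρ hr0 hr m) (norm_nonneg _)) hc.summable

lemma Wiener.congr (h : Wiener ρ r f M)
    (hfg : ∀ η ∈ closedStrip d ρ, ∀ ε : ℂ, ‖ε‖ ≤ r → g η ε = f η ε) : Wiener ρ r g M := by
  obtain ⟨c, hc, hM⟩ := h
  exact ⟨c, ⟨hc.summable, fun η hη ε hε => by rw [hfg η hη ε hε]; exact hc.hasSum η hη ε hε⟩, hM⟩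

lemma hasSum_fiber {ι κ : Type*} (m : ι → κ) {a : ι → ℂ} {w : κ → ℂ} {s : ℂ}
    (h : HasSum (fun i => a i * w (m i)) s) (ha : ∀ n, Summable fun i : {i // m i = n} => a i) :
    HasSum (fun n => (∑' i : {i // m i = n}, a i) * w n) s := by
  have h1 := ((Equiv.sigmaFiberEquiv m).hasSum_iff).2 h
  refine HasSum.sigma h1 fun n => ?_
  have h2 := (ha n).hasSum.mul_right (w n)
  refine h2.congr_fun fun i => ?_
  simp [i.2]

lemma tsum_norm_fiber_le {ι κ : Type*} (m : ι → κ) {a : ι → ℂ} {w : κ → ℝ} (hw : ∀ n, 0 < w n)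
    (h : Summable fun i => ‖a i‖ * w (m i)) :
    (∀ n, Summable fun i : {i // m i = n} => ‖a i‖) ∧
    (Summable fun n => ‖∑' i : {i // m i = n}, a i‖ * w n) ∧
    ∑' n, ‖∑' i : {i // m i = n}, a i‖ * w n ≤ ∑' i, ‖a i‖ * w (m i) := by
  have h1 := ((Equiv.sigmaFiberEquiv m).summable_iff).2 h
  have hts := (Equiv.sigmaFiberEquiv m).tsum_eq fun i => ‖a i‖ * w (m i)
  have hfw : ∀ n, Summable fun i : {i // m i = n} => ‖a i‖ * w n := fun n => by
    refine (h1.sigma_factor n).congr fun i => ?_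
    simp [i.2]
  have hfib : ∀ n, Summable fun i : {i // m i = n} => ‖a i‖ := fun n =>
    (summable_mul_right_iff (hw n).ne').1 (hfw n)
  have hle : ∀ n, ‖∑' i : {i // m i = n}, a i‖ * w n
      ≤ ∑' i : {i // m i = n}, ‖a i‖ * w (m i) := fun n => by
    have : ∑' i : {i // m i = n}, ‖a i‖ * w (m i) = (∑' i : {i // m i = n}, ‖a i‖) * w n := by
      rw [← tsum_mul_right]
      exact tsum_congr fun i => by rw [i.2]
    rw [this]
    exact mul_le_mul_of_nonneg_right (norm_tsum_le_tsum_norm (hfib n)) (hw n).le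
  have hs : Summable fun n => ∑' i : {i // m i = n}, ‖a i‖ * w (m i) := h1.sigma
  have hs2 := hs.of_nonneg_of_le (fun n => mul_nonneg (norm_nonneg _) (hw n).le) hle
  refine ⟨hfib, hs2, ?_⟩
  rw [← hts]
  refine (hs2.tsum_le_tsum hle hs).trans (le_of_eq ?_)
  exact (Summable.tsum_sigma h1).symm

/-- A function given by an absolutely convergent family of monomials, possibly with repetitions. -/
lemma Wiener.of_family {ι : Type*} (hr : 0 < r) (a : ι → ℂ) (m : ι → (Fin d → ℤ) × ℕ)
    (hs : Summable fun i => ‖a i‖ * weight ρ r (m i))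
    (hf : ∀ η ∈ closedStrip d ρ, ∀ ε : ℂ, ‖ε‖ ≤ r →
      HasSum (fun i => a i * monom (m i) η ε) (f η ε)) :
    Wiener ρ r f (∑' i, ‖a i‖ * weight ρ r (m i)) := by
  obtain ⟨h1, h2, h3⟩ := tsum_norm_fiber_le m (weight_pos hr) hs
  exact ⟨fun n => ∑' i : {i // m i = n}, a i,
    ⟨h2, fun η hη ε hε => hasSum_fiber m (w := fun m => monom m η ε) (hf η hη ε hε)
      fun n => (h1 n).of_norm⟩, h3⟩

lemma Wiener.of_monom (m : (Fin d → ℤ) × ℕ) (hr : 0 < r) :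
    Wiener ρ r (monom m) (weight ρ r m) := by
  have := Wiener.of_family (ρ := ρ) (f := monom m) hr (fun _ : Unit => 1) (fun _ => m)
    (hasSum_fintype _).summable (fun η _ ε _ => by
      simpa using hasSum_fintype (fun _ : Unit => monom m η ε))
  simpa using this

lemma Wiener.const (a : ℂ) (hr : 0 < r) : Wiener (d := d) ρ r (fun _ _ => a) ‖a‖ := by
  have := Wiener.of_family (ρ := ρ) (f := fun (_ : Fin d → ℂ) _ => a) hr (fun _ : Unit => a)
    (fun _ => 0) (hasSum_fintype _).summable
    (fun η _ ε _ => by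
      simpa [monom, character_zero] using hasSum_fintype (fun _ : Unit => a))
  simpa [weight, absZ_zero] using this

lemma HasCoeff.add {c c' : (Fin d → ℤ) × ℕ → ℂ} (hr : 0 ≤ r) (hf : HasCoeff ρ r f c)
    (hg : HasCoeff ρ r g c') : HasCoeff ρ r (fun η ε => f η ε + g η ε) (c + c') where
  summable := (hf.summable.add hg.summable).of_nonneg_of_le
    (fun m => mul_nonneg (norm_nonneg _) (weight_nonneg hr m))
    (fun m => by
      rw [← add_mul]
      exact mul_le_mul_of_nonneg_right (norm_add_le _ _) (weight_nonneg hr m))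
  hasSum η hη ε hε := by
    simpa [add_mul] using (hf.hasSum η hη ε hε).add (hg.hasSum η hη ε hε)

lemma Wiener.add (hr : 0 ≤ r) (hf : Wiener ρ r f M) (hg : Wiener ρ r g N) :
    Wiener ρ r (fun η ε => f η ε + g η ε) (M + N) := by
  obtain ⟨c, hc, hM⟩ := hf
  obtain ⟨c', hc', hN⟩ := hg
  refine ⟨c + c', hc.add hr hc', le_trans ?_ (add_le_add hM hN)⟩
  rw [← hc.summable.tsum_add hc'.summable]
  refine (hc.add hr hc').summable.tsum_le_tsum (fun m => ?_) (hc.summable.add hc'.summable)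
  rw [← add_mul]
  exact mul_le_mul_of_nonneg_right (norm_add_le _ _) (weight_nonneg hr m)

/-- Products. -/
lemma Wiener.mul (hρ : 0 ≤ ρ) (hr : 0 < r) (hf : Wiener ρ r f M) (hg : Wiener ρ r g N) :
    Wiener ρ r (fun η ε => f η ε * g η ε) (M * N) := by
  have hN0 := hg.nonneg hr.le
  obtain ⟨c, hc, hM⟩ := hf
  obtain ⟨c', hc', hN⟩ := hg
  have hs := hc.summable.mul_of_nonneg hc'.summable
    (fun m => mul_nonneg (norm_nonneg _) (weight_nonneg hr.le m))
    (fun m => mul_nonneg (norm_nonneg _) (weight_nonneg hr.le m))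
  have hle : ∀ x : ((Fin d → ℤ) × ℕ) × ((Fin d → ℤ) × ℕ),
      ‖c x.1 * c' x.2‖ * weight ρ r (x.1 + x.2)
        ≤ (‖c x.1‖ * weight ρ r x.1) * (‖c' x.2‖ * weight ρ r x.2) := fun x => by
    rw [norm_mul, mul_mul_mul_comm]
    exact mul_le_mul_of_nonneg_left (weight_add_le hρ hr.le _ _) (by positivity)
  have hs2 := hs.of_nonneg_of_le
    (fun x => mul_nonneg (norm_nonneg _) (weight_nonneg hr.le _)) hle
  refine (Wiener.of_family hr (fun x : ((Fin d → ℤ) × ℕ) × ((Fin d → ℤ) × ℕ) => c x.1 * c' x.2)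
    (fun x => x.1 + x.2) hs2 fun η hη ε hε => ?_).mono_right ?_
  · have h1 := hc.hasSum η hη ε hε
    have h2 := hc'.hasSum η hη ε hε
    have h3 : Summable fun x : ((Fin d → ℤ) × ℕ) × ((Fin d → ℤ) × ℕ) =>
        (c x.1 * monom x.1 η ε) * (c' x.2 * monom x.2 η ε) := by
      refine Summable.of_norm_bounded hs fun x => ?_
      rw [norm_mul]
      exact mul_le_mul (norm_term_le c _ hη hε) (norm_term_le c' _ hη hε) (norm_nonneg _)
        (mul_nonneg (norm_nonneg _) (weight_nonneg hr.le _))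
    refine (h1.mul h2 h3).congr_fun fun x => ?_
    rw [monom_add]; ring
  · calc _ ≤ ∑' x : ((Fin d → ℤ) × ℕ) × ((Fin d → ℤ) × ℕ),
          (‖c x.1‖ * weight ρ r x.1) * (‖c' x.2‖ * weight ρ r x.2) := hs2.tsum_le_tsum hle hs
      _ = (∑' m, ‖c m‖ * weight ρ r m) * ∑' m, ‖c' m‖ * weight ρ r m :=
        (hc.summable.tsum_mul_tsum hc'.summable hs).symm
      _ ≤ M * N := mul_le_mul hM hN
        (tsum_nonneg fun m => mul_nonneg (norm_nonneg _) (weight_nonneg hr.le m))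
        (le_trans (tsum_nonneg fun m => mul_nonneg (norm_nonneg _) (weight_nonneg hr.le m)) hM)

lemma Wiener.const_mul (a : ℂ) (hρ : 0 ≤ ρ) (hr : 0 < r) (hf : Wiener ρ r f M) :
    Wiener ρ r (fun η ε => a * f η ε) (‖a‖ * M) := (Wiener.const a hr).mul hρ hr hf

lemma Wiener.neg (hρ : 0 ≤ ρ) (hr : 0 < r) (hf : Wiener ρ r f M) :
    Wiener ρ r (fun η ε => -f η ε) M := by
  simpa using hf.const_mul (-1) hρ hr

lemma Wiener.sub (hρ : 0 ≤ ρ) (hr : 0 < r) (hf : Wiener ρ r f M) (hg : Wiener ρ r g N) :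
    Wiener ρ r (fun η ε => f η ε - g η ε) (M + N) := by
  simpa [sub_eq_add_neg] using hf.add hr.le (hg.neg hρ hr)

lemma Wiener.pow (hρ : 0 ≤ ρ) (hr : 0 < r) (hf : Wiener ρ r f M) (n : ℕ) :
    Wiener ρ r (fun η ε => f η ε ^ n) (M ^ n) := by
  induction n with
  | zero => simpa using Wiener.const (d := d) (ρ := ρ) 1 hr
  | succ n ih => simpa [pow_succ] using ih.mul hρ hr hf

/-- Sums of countable families. -/
lemma Wiener.hasSum {ι : Type*} (hr : 0 < r) {F : ι → (Fin d → ℂ) → ℂ → ℂ} {B : ι → ℝ} {S : ℝ}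
    (hF : ∀ i, Wiener ρ r (F i) (B i)) (hB : HasSum B S)
    (hf : ∀ η ∈ closedStrip d ρ, ∀ ε : ℂ, ‖ε‖ ≤ r → HasSum (fun i => F i η ε) (f η ε)) :
    Wiener ρ r f S := by
  choose c hc hM using hF
  have hnn : ∀ x : ι × ((Fin d → ℤ) × ℕ), 0 ≤ ‖c x.1 x.2‖ * weight ρ r x.2 :=
    fun x => mul_nonneg (norm_nonneg _) (weight_nonneg hr.le _)
  have hs : Summable fun x : ι × ((Fin d → ℤ) × ℕ) => ‖c x.1 x.2‖ * weight ρ r x.2 := by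
    refine (summable_prod_of_nonneg hnn).2 ⟨fun i => (hc i).summable, ?_⟩
    exact hB.summable.of_nonneg_of_le (fun i => tsum_nonneg fun m => hnn (i, m)) hM
  refine (Wiener.of_family hr (fun x : ι × ((Fin d → ℤ) × ℕ) => c x.1 x.2) (fun x => x.2) hs
    fun η hη ε hε => ?_).mono_right ?_
  · have h1 : Summable fun x : ι × ((Fin d → ℤ) × ℕ) =>
        c x.1 x.2 * monom x.2 η ε :=
      Summable.of_norm_bounded hs fun x => norm_term_le (c x.1) x.2 hη hε
    have h2 := h1.hasSum.prod_fiberwise fun i => (hc i).hasSum η hη ε hε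
    rw [(hf η hη ε hε).unique h2]
    exact h1.hasSum
  · rw [hs.tsum_prod, ← hB.tsum_eq]
    exact hs.prod.tsum_le_tsum hM hB.summable

/-- Composition with a power series. -/
lemma Wiener.powerSeries (hρ : 0 ≤ ρ) (hr : 0 < r) (hf : Wiener ρ r f M) {a : ℕ → ℂ} {S : ℝ}
    (ha : HasSum (fun n => ‖a n‖ * M ^ n) S)
    (hg : ∀ η ∈ closedStrip d ρ, ∀ ε : ℂ, ‖ε‖ ≤ r → HasSum (fun n => a n * f η ε ^ n) (g η ε)) :
    Wiener ρ r g S :=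
  Wiener.hasSum hr (fun n => (hf.pow hρ hr n).const_mul (a n) hρ hr) ha hg

end Basic

/-! ### Averages and Fourier series -/

section Torus

open MeasureTheory

local instance : MeasureSpace UnitAddCircle := ⟨AddCircle.haarAddCircle⟩

local instance : Measure.IsAddHaarMeasure (volume : Measure UnitAddCircle) :=
  inferInstanceAs (Measure.IsAddHaarMeasure AddCircle.haarAddCircle)

lemma integral_torus_eq (f : UnitAddTorus (Fin d) → ℂ) :
    ∫ x, f x = ∫ x in Set.Icc (0 : Fin d → ℝ) 1, f (fun i => (x i : UnitAddCircle)) := by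
  rw [UnitAddTorus.integral_preimage f 0]
  refine setIntegral_congr_set ?_
  have := Measure.univ_pi_Ioc_ae_eq_Icc (μ := fun _ : Fin d => (volume : Measure ℝ))
    (f := 0) (g := 1)
  refine Filter.EventuallyEq.trans (Filter.EventuallyEq.of_eq (Set.ext fun x => ?_)) this
  exact ⟨fun h i _ => by simpa using h i, fun h i => by simpa using h i trivial⟩

lemma integral_mFourier (k : Fin d → ℤ) :
    ∫ x, UnitAddTorus.mFourier k x = if k = 0 then 1 else 0 := by
  have h := orthonormal_iff_ite.1 (UnitAddTorus.orthonormal_mFourier (d := Fin d)) 0 k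
  simp only [ContinuousMap.inner_toLp, UnitAddTorus.mFourier_zero] at h
  simpa [eq_comm] using h

lemma character_toC (k : Fin d → ℤ) (x : Fin d → ℝ) :
    character k (toC x) = UnitAddTorus.mFourier k (fun i => (x i : UnitAddCircle)) := by
  simp only [character, toC, UnitAddTorus.mFourier, ContinuousMap.coe_mk, fourier_coe_apply]
  rw [← Complex.exp_sum, Finset.mul_sum]
  congr 1
  refine Finset.sum_congr rfl fun i _ => ?_
  push_cast; ring

lemma average_character (k : Fin d → ℤ) :
    average (character k) = if k = 0 then 1 else 0 := by
  rw [← integral_mFourier, integral_torus_eq]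
  simp only [average, character_toC]

/-- Periodic continuous functions on `ℝ^d` descend to the torus. -/
lemma exists_torus_lift {G : (Fin d → ℝ) → ℂ} (hG : Continuous G)
    (hper : ∀ x, ∀ k : Fin d → ℤ, G (x + fun i => (k i : ℝ)) = G x) :
    ∃ F : C(UnitAddTorus (Fin d), ℂ), ∀ x : Fin d → ℝ, F (fun i => (x i : UnitAddCircle)) = G x := by
  have hq : IsOpenQuotientMap (fun (x : Fin d → ℝ) (i : Fin d) => (x i : UnitAddCircle)) :=
    IsOpenQuotientMap.piMap fun _ => QuotientAddGroup.isOpenQuotientMap_mk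
  have hfac : Function.FactorsThrough G
      (fun (x : Fin d → ℝ) (i : Fin d) => (x i : UnitAddCircle)) := by
    intro x y hxy
    have : ∀ i, ∃ n : ℤ, (n : ℝ) = y i - x i := fun i => by
      have h := congrFun hxy i
      obtain ⟨n, hn⟩ := AddSubgroup.mem_zmultiples_iff.1 (QuotientAddGroup.eq.1 h)
      exact ⟨n, by simp at hn; linarith⟩
    choose n hn using this
    rw [← hper x n]
    congr 1; ext i; simp [hn]
  let q : C(Fin d → ℝ, UnitAddTorus (Fin d)) := ⟨_, hq.continuous⟩
  have hq' : Topology.IsQuotientMap q := hq.isQuotientMap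
  exact ⟨hq'.lift ⟨G, hG⟩ hfac, fun x =>
    congrFun (congrArg DFunLike.coe (hq'.lift_comp ⟨G, hG⟩ hfac)) x⟩

lemma integral_Icc_add {G : (Fin d → ℝ) → ℂ} (hG : Continuous G)
    (hper : ∀ x, ∀ k : Fin d → ℤ, G (x + fun i => (k i : ℝ)) = G x) (s : Fin d → ℝ) :
    ∫ x in Set.Icc (0 : Fin d → ℝ) 1, G (x + s) = ∫ x in Set.Icc (0 : Fin d → ℝ) 1, G x := by
  obtain ⟨F, hF⟩ := exists_torus_lift hG hper
  have h := integral_add_right_eq_self (μ := (volume : Measure (UnitAddTorus (Fin d)))) F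
    (fun i => (s i : UnitAddCircle))
  rw [integral_torus_eq, integral_torus_eq] at h
  simp only [hF] at h
  rw [← h]
  congr 1; ext x
  rw [← hF]; rfl

/-- A periodic continuous function with summable Fourier coefficients is the sum of its Fourier
series. -/
lemma hasSum_fourier {G : (Fin d → ℝ) → ℂ} (hG : Continuous G)
    (hper : ∀ x, ∀ k : Fin d → ℤ, G (x + fun i => (k i : ℝ)) = G x)
    (hs : Summable fun k : Fin d → ℤ =>
      ∫ x in Set.Icc (0 : Fin d → ℝ) 1, character (-k) (toC x) * G x) (x : Fin d → ℝ) :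
    HasSum (fun k : Fin d → ℤ => (∫ x in Set.Icc (0 : Fin d → ℝ) 1, character (-k) (toC x) * G x)
      * character k (toC x)) (G x) := by
  obtain ⟨F, hF⟩ := exists_torus_lift hG hper
  have hc : ∀ k, UnitAddTorus.mFourierCoeff F k
      = ∫ x in Set.Icc (0 : Fin d → ℝ) 1, character (-k) (toC x) * G x := fun k => by
    simp only [UnitAddTorus.mFourierCoeff, integral_torus_eq, character_toC, hF, smul_eq_mul]
  have := UnitAddTorus.hasSum_mFourier_series_apply_of_summable (f := F)
    (hs.congr fun k => (hc k).symm) (fun i => (x i : UnitAddCircle))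
  simp only [hc, hF, smul_eq_mul, ← character_toC] at this
  exact this

end Torus

open MeasureTheory in
lemma average_hasSum {ι : Type*} [Countable ι] {a : ι → ℂ} {k : ι → Fin d → ℤ}
    (ha : Summable fun i => ‖a i‖) {f : (Fin d → ℂ) → ℂ}
    (hf : ∀ σ : Fin d → ℝ, HasSum (fun i => a i * character (k i) (toC σ)) (f (toC σ))) :
    HasSum (fun i => if k i = 0 then a i else 0) (average f) := by
  have hcont : ∀ i, Continuous fun σ : Fin d → ℝ => a i * character (k i) (toC σ) := fun i => by
    unfold character toC; fun_prop
  have hint : ∀ i, Integrable (fun σ : Fin d → ℝ => a i * character (k i) (toC σ))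
      (volume.restrict (Set.Icc 0 1)) := fun i =>
    ((hcont i).continuousOn.integrableOn_compact isCompact_Icc)
  have h := hasSum_integral_of_summable_integral_norm hint (by
    simpa [norm_character_toC, measureReal_def, Real.volume_Icc_pi] using ha)
  simp only [fun σ => (hf σ).tsum_eq, integral_const_mul] at h
  refine h.congr_fun fun i => ?_
  have h2 := average_character (k i)
  unfold average at h2
  rw [h2]; split_ifs <;> simp

/-! ### The spaces `𝒜_ρ` -/

section MemA

variable {ρ ρ' : ℝ} {f g : (Fin d → ℂ) → ℂ}

lemma MemA.anti (hf : MemA ρ f) (h : ρ' ≤ ρ) : MemA ρ' f where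
  periodic η hη k := hf.periodic η (closedStrip_mono h hη) k
  holomorphic := hf.holomorphic.mono fun _ hη i => (hη i).trans_le h
  continuousOn := hf.continuousOn.mono (closedStrip_mono h)

lemma MemA.mul (hf : MemA ρ f) (hg : MemA ρ g) : MemA ρ (fun η => f η * g η) where
  periodic η hη k := by rw [hf.periodic η hη k, hg.periodic η hη k]
  holomorphic := hf.holomorphic.mul hg.holomorphic
  continuousOn := hf.continuousOn.mul hg.continuousOn

lemma MemA.sub (hf : MemA ρ f) (hg : MemA ρ g) : MemA ρ (fun η => f η - g η) where
  periodic η hη k := by rw [hf.periodic η hη k, hg.periodic η hη k]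
  holomorphic := hf.holomorphic.sub hg.holomorphic
  continuousOn := hf.continuousOn.sub hg.continuousOn

lemma differentiable_character (k : Fin d → ℤ) : Differentiable ℂ (character k) := by
  unfold character; fun_prop

lemma character_periodic (k l : Fin d → ℤ) (η : Fin d → ℂ) :
    character k (η + fun i => (l i : ℂ)) = character k η := by
  rw [character_add]
  have : character k (fun i => (l i : ℂ)) = 1 := by
    unfold character
    rw [Complex.exp_eq_one_iff]
    exact ⟨∑ i, k i * l i, by push_cast; ring⟩
  rw [this, mul_one]

lemma memA_character (k : Fin d → ℤ) : MemA ρ (character k) where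
  periodic η _ l := character_periodic k l η
  holomorphic := (differentiable_character k).differentiableOn
  continuousOn := (differentiable_character k).continuous.continuousOn

lemma isOpen_strip (ρ : ℝ) : IsOpen (strip d ρ) := by
  have : strip d ρ = ⋂ i, {η | |(η i).im| < ρ} := by ext; simp [strip]
  rw [this]
  exact isOpen_iInter_of_finite fun i => isOpen_lt (by fun_prop) continuous_const

lemma MemA.exists_bound (hf : MemA ρ f) : ∃ M, 0 ≤ M ∧ ∀ η ∈ closedStrip d ρ, ‖f η‖ ≤ M := by
  set K : Set (Fin d → ℂ) := Set.univ.pi fun _ => Set.Icc (0 : ℝ) 1 ×ℂ Set.Icc (-ρ) ρ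
  have hK : IsCompact K := isCompact_univ_pi fun _ => isCompact_Icc.reProdIm isCompact_Icc
  have hsub : K ⊆ closedStrip d ρ := fun η hη i => abs_le.2 (hη i trivial).2
  obtain ⟨M, hM⟩ := hK.exists_bound_of_continuousOn (hf.continuousOn.mono hsub)
  refine ⟨max M 0, le_max_right _ _, fun η hη => ?_⟩
  rw [← hf.periodic η hη fun i => -⌊(η i).re⌋]
  refine (hM _ fun i _ => ?_).trans (le_max_left _ _)
  refine ⟨?_, ?_⟩
  · simp only [Set.mem_preimage, Pi.add_apply, Complex.add_re, Complex.intCast_re, Int.cast_neg,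
      Complex.neg_re, Set.mem_Icc]
    constructor <;> linarith [Int.floor_le (η i).re, Int.lt_floor_add_one (η i).re]
  · simpa [abs_le] using hη i

/-- The points `x + z y`, with `x`, `y` real. -/
def linePoint (x y : Fin d → ℝ) (z : ℂ) : Fin d → ℂ := toC x + z • toC y

lemma linePoint_im (x y : Fin d → ℝ) (z : ℂ) (i : Fin d) : (linePoint x y z i).im = z.im * y i := by
  simp [linePoint, toC]

lemma linePoint_ofReal (x y : Fin d → ℝ) (t : ℝ) : linePoint x y t = toC (x + t • y) := by
  rw [toC_add, toC_smul]; rfl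

lemma eq_linePoint (η : Fin d → ℂ) :
    η = linePoint (fun i => (η i).re) (fun i => (η i).im) Complex.I := by
  ext i; simp only [linePoint, toC, Pi.add_apply, Pi.smul_apply, smul_eq_mul]
  rw [mul_comm]; exact (Complex.re_add_im _).symm

/-- The set of `z` for which `x + z y` lies in the strip of width `ρ`. -/
def lineDomain (ρ : ℝ) (y : Fin d → ℝ) : Set ℂ := {z | ∀ i, |z.im * y i| < ρ}

lemma linePoint_mem {y : Fin d → ℝ} {z : ℂ} (hz : z ∈ lineDomain ρ y) (x : Fin d → ℝ) :
    linePoint x y z ∈ strip d ρ := fun i => by rw [linePoint_im]; exact hz i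

lemma isOpen_lineDomain (ρ : ℝ) (y : Fin d → ℝ) : IsOpen (lineDomain ρ y) := by
  have : lineDomain ρ y = ⋂ i, {z : ℂ | |z.im * y i| < ρ} := by ext; simp [lineDomain]
  rw [this]
  exact isOpen_iInter_of_finite fun i => isOpen_lt (by fun_prop) continuous_const

lemma convex_lineDomain (ρ : ℝ) (y : Fin d → ℝ) : Convex ℝ (lineDomain ρ y) := by
  intro z hz w hw a b ha hb hab i
  have h1 : (a • z + b • w).im * y i = a * (z.im * y i) + b * (w.im * y i) := by simp; ring
  rw [h1]
  calc |a * (z.im * y i) + b * (w.im * y i)| ≤ a * |z.im * y i| + b * |w.im * y i| := by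
        refine (abs_add_le _ _).trans (le_of_eq ?_)
        rw [abs_mul a, abs_mul b, abs_of_nonneg ha, abs_of_nonneg hb]
    _ < ρ := by
        rcases ha.eq_or_lt with h | h
        · subst h; simp at hab; subst hab; simpa using hw i
        · have h2 := mul_lt_mul_of_pos_left (hz i) h
          have h3 := mul_le_mul_of_nonneg_left (hw i).le hb
          have h4 : a * ρ + b * ρ = ρ := by rw [← add_mul, hab, one_mul]
          linarith

lemma zero_mem_lineDomain (hρ : 0 < ρ) (y : Fin d → ℝ) : (0 : ℂ) ∈ lineDomain ρ y :=
  fun i => by simpa using hρ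

lemma linePoint_differentiable (x y : Fin d → ℝ) : Differentiable ℂ (linePoint x y) := by
  unfold linePoint; fun_prop

lemma DifferentiableOn.comp_linePoint (hf : DifferentiableOn ℂ f (strip d ρ)) (x y : Fin d → ℝ) :
    DifferentiableOn ℂ (fun z => f (linePoint x y z)) (lineDomain ρ y) :=
  hf.comp (linePoint_differentiable x y).differentiableOn fun _ hz => linePoint_mem hz x

lemma eqOn_of_eq_ofReal {S : Set ℂ} (hS : IsOpen S) (hS' : IsPreconnected S) (h0 : (0 : ℂ) ∈ S)
    {F G : ℂ → ℂ} (hF : DifferentiableOn ℂ F S) (hG : DifferentiableOn ℂ G S)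
    (h : ∀ t : ℝ, F t = G t) : Set.EqOn F G S := by
  refine (hF.analyticOnNhd hS).eqOn_of_preconnected_of_frequently_eq (hG.analyticOnNhd hS) hS' h0 ?_
  have ht : Filter.Tendsto (fun t : ℝ => (t : ℂ)) (nhdsWithin 0 {0}ᶜ) (nhdsWithin 0 {0}ᶜ) := by
    refine tendsto_nhdsWithin_of_tendsto_nhds_of_eventually_within _ ?_ ?_
    · exact (Complex.continuous_ofReal.tendsto' 0 0 (by simp)).mono_left nhdsWithin_le_nhds
    · filter_upwards [self_mem_nhdsWithin] with t ht using by simpa using ht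
  exact ht.frequently (Filter.Eventually.of_forall h).frequently

/-- Holomorphic functions on a strip that agree at real points are equal. -/
lemma eq_of_eq_on_real (hρ : 0 < ρ) (hf : DifferentiableOn ℂ f (strip d ρ))
    (hg : DifferentiableOn ℂ g (strip d ρ)) (h : ∀ σ : Fin d → ℝ, f (toC σ) = g (toC σ)) :
    ∀ η ∈ strip d ρ, f η = g η := by
  intro η hη
  rw [eq_linePoint η]
  refine eqOn_of_eq_ofReal (isOpen_lineDomain ρ _) (convex_lineDomain ρ _).isPreconnected
    (zero_mem_lineDomain hρ _) (DifferentiableOn.comp_linePoint hf _ _)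
    (DifferentiableOn.comp_linePoint hg _ _)
    (fun t => by simp only [linePoint_ofReal]; exact h _) ?_
  intro i; simpa using hη i

lemma mem_closure_strip (hρ : 0 < ρ) {η : Fin d → ℂ} (hη : η ∈ closedStrip d ρ) :
    η ∈ closure (strip d ρ) := by
  have hlim : Filter.Tendsto (fun t : ℝ => linePoint (fun i => (η i).re) (fun i => (η i).im)
      (t * Complex.I)) (nhdsWithin 1 (Set.Iio 1)) (nhds η) := by
    have hc : Continuous fun t : ℝ => linePoint (fun i => (η i).re) (fun i => (η i).im)
      (t * Complex.I) := (linePoint_differentiable _ _).continuous.comp (by fun_prop)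
    refine (hc.tendsto' 1 η ?_).mono_left nhdsWithin_le_nhds
    conv_rhs => rw [eq_linePoint η]
    simp
  refine mem_closure_of_tendsto hlim ?_
  have : Set.Ioo (0 : ℝ) 1 ∈ nhdsWithin 1 (Set.Iio 1) := Ioo_mem_nhdsLT one_pos
  filter_upwards [this] with t ht i
  rw [linePoint_im]
  have h1 := hη i
  simp only [Complex.mul_im, Complex.ofReal_re, Complex.I_im, mul_one, Complex.ofReal_im,
    Complex.I_re, mul_zero, add_zero, abs_mul, abs_of_pos ht.1]
  rcases (abs_nonneg (η i).im).eq_or_lt with h | h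
  · rw [← h]; simpa using hρ
  · nlinarith [ht.2]

lemma MemA.eq_of_eq_on_real (hρ : 0 < ρ) (hf : MemA ρ f) (hg : MemA ρ g)
    (h : ∀ σ : Fin d → ℝ, f (toC σ) = g (toC σ)) : ∀ η ∈ closedStrip d ρ, f η = g η := by
  have h1 := QPLindstedt.eq_of_eq_on_real hρ hf.holomorphic hg.holomorphic h
  have h2 : Set.EqOn f g (strip d ρ) := h1
  intro η hη
  exact h2.of_subset_closure hf.continuousOn hg.continuousOn (strip_subset_closedStrip le_rfl)
    (fun _ => mem_closure_strip hρ) hη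

lemma MemA.continuous_real (hρ : 0 ≤ ρ) (hf : MemA ρ f) :
    Continuous fun σ : Fin d → ℝ => f (toC σ) :=
  hf.continuousOn.comp_continuous (by unfold toC; fun_prop) fun σ => toC_mem_closedStrip hρ σ

open MeasureTheory in
/-- The average is invariant under imaginary translations. -/
lemma MemA.integral_shift (hρ : 0 < ρ) (hf : MemA ρ f) {y : Fin d → ℝ} (hy : ∀ i, |y i| < ρ) :
    ∫ x in Set.Icc (0 : Fin d → ℝ) 1, f (linePoint x y Complex.I) = average f := by
  obtain ⟨M, hM0, hM⟩ := hf.exists_bound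
  have hcont : ∀ z ∈ lineDomain ρ y, Continuous fun x : Fin d → ℝ => f (linePoint x y z) :=
    fun z hz => hf.continuousOn.comp_continuous (by unfold linePoint toC; fun_prop)
      fun x => strip_subset_closedStrip le_rfl (linePoint_mem hz x)
  have hdiff : DifferentiableOn ℂ
      (fun z => ∫ x in Set.Icc (0 : Fin d → ℝ) 1, f (linePoint x y z)) (lineDomain ρ y) := by
    intro z₀ hz₀
    obtain ⟨s, hs, hball⟩ := Metric.isOpen_iff.1 (isOpen_lineDomain ρ y) z₀ hz₀
    have hsub : ∀ z ∈ Metric.ball z₀ (s / 2), Metric.closedBall z (s / 4) ⊆ lineDomain ρ y := by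
      intro z hz w hw
      refine hball ?_
      rw [Metric.mem_ball] at hz ⊢
      rw [Metric.mem_closedBall] at hw
      linarith [dist_triangle w z z₀]
    have hder : ∀ x, ∀ z ∈ lineDomain ρ y, HasDerivAt (fun z => f (linePoint x y z))
        (fderiv ℂ f (linePoint x y z) (toC y)) z := by
      intro x z hz
      have h1 : HasFDerivAt f (fderiv ℂ f (linePoint x y z)) (linePoint x y z) :=
        (hf.holomorphic.differentiableAt ((isOpen_strip ρ).mem_nhds (linePoint_mem hz x))).hasFDerivAt
      have h2 : HasDerivAt (linePoint x y) (toC y) z := by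
        have := ((hasDerivAt_id z).smul_const (toC y)).const_add (toC x)
        rw [one_smul] at this
        exact this
      exact h1.comp_hasDerivAt z h2
    have key := hasDerivAt_integral_of_dominated_loc_of_deriv_le (𝕜 := ℂ)
      (μ := volume.restrict (Set.Icc (0 : Fin d → ℝ) 1))
      (F := fun z x => f (linePoint x y z))
      (F' := fun z x => fderiv ℂ f (linePoint x y z) (toC y)) (x₀ := z₀)
      (s := Metric.ball z₀ (s / 2)) (bound := fun _ => M / (s / 4))
      (Metric.ball_mem_nhds z₀ (by linarith)) ?_ ?_ ?_ ?_ ?_ ?_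
    · exact key.2.differentiableAt.differentiableWithinAt
    · filter_upwards [(isOpen_lineDomain ρ y).mem_nhds hz₀] with z hz
        using (hcont z hz).aestronglyMeasurable
    · exact (hcont z₀ hz₀).continuousOn.integrableOn_compact isCompact_Icc
    · have h1 : Measurable fun x : Fin d → ℝ => fderiv ℂ f (linePoint x y z₀) (toC y) := by
        have := measurable_fderiv_apply_const ℂ f (toC y)
        refine this.comp (Continuous.measurable ?_)
        unfold linePoint toC; fun_prop
      exact h1.aestronglyMeasurable
    · refine Filter.Eventually.of_forall fun x z hz => ?_
      have hz' : z ∈ lineDomain ρ y := hsub z hz (Metric.mem_closedBall_self (by linarith))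
      rw [← (hder x z hz').deriv]
      refine Complex.norm_deriv_le_of_forall_mem_sphere_norm_le (by linarith) ?_ ?_
      · refine DifferentiableOn.diffContOnCl ?_
        refine (DifferentiableOn.comp_linePoint hf.holomorphic x y).mono ?_
        rw [closure_ball _ (by linarith : s / 4 ≠ 0)]
        exact hsub z hz
      · intro w hw
        exact hM _ (strip_subset_closedStrip le_rfl
          (linePoint_mem (hsub z hz (Metric.sphere_subset_closedBall hw)) x))
    · exact continuous_const.continuousOn.integrableOn_compact isCompact_Icc
    · exact Filter.Eventually.of_forall fun x z hz =>
        hder x z (hsub z hz (Metric.mem_closedBall_self (by linarith)))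
  have hreal : ∀ t : ℝ, ∫ x in Set.Icc (0 : Fin d → ℝ) 1, f (linePoint x y t) = average f := by
    intro t
    simp only [linePoint_ofReal]
    refine integral_Icc_add (G := fun x => f (toC x)) (hf.continuous_real hρ.le) (fun x k => ?_) _
    rw [toC_add, ← hf.periodic _ (toC_mem_closedStrip hρ.le x) k]
    congr 2
  exact eqOn_of_eq_ofReal (isOpen_lineDomain ρ y) (convex_lineDomain ρ y).isPreconnected
    (zero_mem_lineDomain hρ y) hdiff (differentiableOn_const (average f)) hreal
    (fun i => by simpa using hy i)

end MemA

/-! ### Fourier expansion on strips -/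

lemma summable_pi_prod {a : ℤ → ℝ} (ha : ∀ n, 0 ≤ a n) (hs : Summable a) (d : ℕ) :
    Summable fun k : Fin d → ℤ => ∏ i, a (k i) := by
  induction d with
  | zero => exact (hasSum_fintype _).summable
  | succ d ih =>
    rw [← (Fin.consEquiv fun _ : Fin (d + 1) => ℤ).summable_iff]
    refine (hs.mul_of_nonneg ih ha fun k => Finset.prod_nonneg fun i _ => ha _).congr fun x => ?_
    simp [Fin.prod_univ_succ, Fin.consEquiv]

lemma summable_exp_neg_absZ {s : ℝ} (hs : 0 < s) :
    Summable fun k : Fin d → ℤ => Real.exp (-s * absZ k) := by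
  have h1 : Summable fun n : ℤ => Real.exp (-s * |(n : ℝ)|) := by
    have hnat : Summable fun n : ℕ => Real.exp (-s * n) := by
      have := Real.summable_exp_nat_mul_iff.2 (neg_lt_zero.2 hs)
      exact this.congr fun n => by rw [mul_comm]
    refine Summable.of_nat_of_neg ?_ ?_
    · simpa using hnat
    · simpa using hnat
  refine (summable_pi_prod (fun n => Real.exp_nonneg _) h1 d).congr fun k => ?_
  rw [← Real.exp_sum, absZ, Finset.mul_sum]

lemma mul_exp_le {x y t : ℝ} : t * x * Real.exp (y * x) ≤ Real.exp ((y + t) * x) := by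
  rw [add_mul, Real.exp_add, mul_comm]
  exact mul_le_mul_of_nonneg_left (by linarith [Real.add_one_le_exp (t * x)]) (Real.exp_nonneg _)

section Series

variable {ρ : ℝ} {c : (Fin d → ℤ) → ℂ}

/-- The linear form `k·η`. -/
def dotCLM (k : Fin d → ℤ) : (Fin d → ℂ) →L[ℂ] ℂ :=
  ∑ i, (k i : ℂ) • ContinuousLinearMap.proj (R := ℂ) (φ := fun _ : Fin d => ℂ) i

lemma dotCLM_apply (k : Fin d → ℤ) (η : Fin d → ℂ) : dotCLM k η = ∑ i, (k i : ℂ) * η i := by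
  simp [dotCLM]

lemma norm_dotCLM_le (k : Fin d → ℤ) : ‖dotCLM k‖ ≤ absZ k := by
  refine ContinuousLinearMap.opNorm_le_bound _ (absZ_nonneg k) fun η => ?_
  rw [dotCLM_apply, absZ, Finset.sum_mul]
  refine (norm_sum_le _ _).trans (Finset.sum_le_sum fun i _ => ?_)
  rw [norm_mul, Complex.norm_intCast]
  exact mul_le_mul_of_nonneg_left (norm_le_pi_norm η i) (abs_nonneg _)

lemma hasFDerivAt_character (k : Fin d → ℤ) (η : Fin d → ℂ) :
    HasFDerivAt (character k) (character k η • ((2 * Real.pi * Complex.I : ℂ) • dotCLM k)) η := by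
  have h : HasFDerivAt (fun η : Fin d → ℂ => (2 * Real.pi * Complex.I : ℂ) * dotCLM k η)
      ((2 * Real.pi * Complex.I : ℂ) • dotCLM k) η := (dotCLM k).hasFDerivAt.const_mul _
  have h2 := h.cexp
  simp only [dotCLM_apply] at h2
  exact h2

lemma norm_series_term_le (k : Fin d → ℤ) {η : Fin d → ℂ} (hη : η ∈ closedStrip d ρ) :
    ‖c k * character k η‖ ≤ ‖c k‖ * Real.exp (2 * Real.pi * ρ * absZ k) := by
  rw [norm_mul]; exact mul_le_mul_of_nonneg_left (norm_character_le k hη) (norm_nonneg _)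

lemma convex_strip (ρ : ℝ) : Convex ℝ (strip d ρ) := by
  have : strip d ρ = ⋂ i, (fun η : Fin d → ℂ => (η i).im) ⁻¹' Set.Ioo (-ρ) ρ := by
    ext; simp [strip, abs_lt]
  rw [this]
  refine convex_iInter fun i => ?_
  exact (convex_Ioo (-ρ) ρ).linear_preimage
    (Complex.imLm.comp ((LinearMap.proj i : (Fin d → ℂ) →ₗ[ℝ] ℂ)))

/-- Exponential series define elements of `𝒜_ρ`. -/
lemma memA_series (hρ : 0 < ρ)
    (hc : Summable fun k => ‖c k‖ * Real.exp (2 * Real.pi * ρ * absZ k)) :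
    MemA ρ (fun η => ∑' k, c k * character k η) where
  periodic η _ l := by simp only [character_periodic]
  continuousOn := continuousOn_tsum
    (fun k => ((differentiable_character k).continuous.const_mul (c k)).continuousOn) hc
    fun k _ hη => norm_series_term_le k hη
  holomorphic := by
    intro η hη
    have hn : ‖fun i : Fin d => (η i).im‖ < ρ := (pi_norm_lt_iff hρ).2 hη
    set ρ' := (‖fun i : Fin d => (η i).im‖ + ρ) / 2
    have hρ' : ρ' < ρ := by simp only [ρ']; linarith
    have hη' : η ∈ strip d ρ' := fun i => by
      have := norm_le_pi_norm (fun i : Fin d => (η i).im) i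
      simp only [Real.norm_eq_abs] at this
      simp only [ρ']; linarith
    have h0 : (0 : Fin d → ℂ) ∈ strip d ρ' := fun i => by
      simpa using (abs_nonneg _).trans_lt (hη' i)
    have hu : Summable fun k => ‖c k‖ * (2 * Real.pi * absZ k
        * Real.exp (2 * Real.pi * ρ' * absZ k)) := by
      refine (hc.mul_left (ρ - ρ')⁻¹).of_nonneg_of_le (fun k => ?_) fun k => ?_
      · have := absZ_nonneg k; positivity
      · have h1 := mul_exp_le (x := absZ k) (y := 2 * Real.pi * ρ') (t := 2 * Real.pi * (ρ - ρ'))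
        have h2 : 2 * Real.pi * ρ' + 2 * Real.pi * (ρ - ρ') = 2 * Real.pi * ρ := by ring
        rw [h2] at h1
        rw [mul_left_comm (ρ - ρ')⁻¹]
        refine mul_le_mul_of_nonneg_left ?_ (norm_nonneg _)
        rw [le_inv_mul_iff₀ (sub_pos.2 hρ')]
        linarith
    have hd : ∀ k (x : Fin d → ℂ), HasFDerivAt (fun η => c k * character k η)
        (c k • (character k x • ((2 * Real.pi * Complex.I : ℂ) • dotCLM k))) x :=
      fun k x => (hasFDerivAt_character k x).const_mul _
    have := hasFDerivAt_tsum_of_isPreconnected (𝕜 := ℂ) hu (isOpen_strip ρ')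
      (convex_strip ρ').isPreconnected (fun k x _ => hd k x) (fun k x hx => ?_) h0 ?_ hη'
    · exact this.differentiableAt.differentiableWithinAt
    · rw [norm_smul, norm_smul, norm_smul]
      refine mul_le_mul_of_nonneg_left ?_ (norm_nonneg _)
      have hpi : ‖(2 * Real.pi * Complex.I : ℂ)‖ = 2 * Real.pi := by
        simp [abs_of_pos Real.pi_pos]
      rw [hpi]
      have h3 := norm_character_le k (strip_subset_closedStrip le_rfl hx)
      have h4 : 2 * Real.pi * ‖dotCLM k‖ ≤ 2 * Real.pi * absZ k :=
        mul_le_mul_of_nonneg_left (norm_dotCLM_le k) (by positivity)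
      calc _ ≤ Real.exp (2 * Real.pi * ρ' * absZ k) * (2 * Real.pi * absZ k) :=
            mul_le_mul h3 h4 (by positivity) (Real.exp_nonneg _)
        _ = _ := mul_comm _ _
    · refine Summable.of_norm_bounded hc fun k => norm_series_term_le k ?_
      exact strip_subset_closedStrip hρ'.le h0

lemma hasSum_series (hc : Summable fun k => ‖c k‖ * Real.exp (2 * Real.pi * ρ * absZ k))
    {η : Fin d → ℂ} (hη : η ∈ closedStrip d ρ) :
    HasSum (fun k => c k * character k η) (∑' k, c k * character k η) :=
  (Summable.of_norm_bounded hc fun k => norm_series_term_le k hη).hasSum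

end Series

/-- The Fourier coefficients of `f`. -/
def fourierCoef (f : (Fin d → ℂ) → ℂ) (k : Fin d → ℤ) : ℂ :=
  average fun η => character (-k) η * f η

lemma fourierCoef_congr {f g : (Fin d → ℂ) → ℂ} (h : ∀ σ : Fin d → ℝ, f (toC σ) = g (toC σ))
    (k : Fin d → ℤ) : fourierCoef f k = fourierCoef g k := by
  simp only [fourierCoef, average, h]

lemma average_congr {f g : (Fin d → ℂ) → ℂ} (h : ∀ σ : Fin d → ℝ, f (toC σ) = g (toC σ)) :
    average f = average g := by
  simp only [average, h]

lemma fourierCoef_of_hasSum {c : (Fin d → ℤ) → ℂ} (hc : Summable fun k => ‖c k‖)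
    {f : (Fin d → ℂ) → ℂ}
    (hf : ∀ σ : Fin d → ℝ, HasSum (fun k => c k * character k (toC σ)) (f (toC σ)))
    (l : Fin d → ℤ) : fourierCoef f l = c l := by
  have h := average_hasSum (k := fun k => k - l) hc (f := fun η => character (-l) η * f η)
    fun σ => by
      refine ((hf σ).mul_left (character (-l) (toC σ))).congr_fun fun k => ?_
      rw [sub_eq_add_neg, character_add_index]; ring
  simp only [sub_eq_zero] at h
  exact h.unique (hasSum_ite_eq l (c l) |>.congr_fun fun k => by
    split_ifs with h <;> simp [h])

variable {ρ ρ' : ℝ} {f : (Fin d → ℂ) → ℂ}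

lemma MemA.norm_fourierCoef_le (hρ : 0 < ρ) (hf : MemA ρ f) {M : ℝ}
    (hM : ∀ η ∈ closedStrip d ρ, ‖f η‖ ≤ M) (hρ'0 : 0 ≤ ρ') (hρ' : ρ' < ρ) (k : Fin d → ℤ) :
    ‖fourierCoef f k‖ ≤ M * Real.exp (-(2 * Real.pi * ρ') * absZ k) := by
  set y : Fin d → ℝ := fun i => -(ρ' * (SignType.sign (k i : ℝ) : ℝ))
  have hy : ∀ i, |y i| < ρ := fun i => by
    have : |((SignType.sign (k i : ℝ) : SignType) : ℝ)| ≤ 1 := by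
      rcases lt_trichotomy (k i : ℝ) 0 with h | h | h
      · rw [sign_neg h]; simp
      · rw [h]; simp
      · rw [sign_pos h]; simp
    simp only [y, abs_neg, abs_mul, abs_of_nonneg hρ'0]
    nlinarith
  have h := ((memA_character (-k)).mul hf).integral_shift hρ hy
  unfold fourierCoef
  rw [← h]
  have hpt : ∀ x, linePoint x y Complex.I ∈ strip d ρ := fun x =>
    linePoint_mem (fun i => by simpa using hy i) x
  have hM0 : 0 ≤ M := (norm_nonneg _).trans (hM 0 fun i => by simpa using hρ.le)
  have hbd : ∀ x, ‖character (-k) (linePoint x y Complex.I) * f (linePoint x y Complex.I)‖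
      ≤ M * Real.exp (-(2 * Real.pi * ρ') * absZ k) := fun x => by
    rw [norm_mul, mul_comm]
    refine mul_le_mul (hM _ (strip_subset_closedStrip le_rfl (hpt x))) (le_of_eq ?_)
      (norm_nonneg _) hM0
    rw [norm_character]
    congr 1
    simp only [linePoint_im, absZ, Finset.mul_sum]
    refine Finset.sum_congr rfl fun i _ => ?_
    simp only [y, Pi.neg_apply, Complex.I_im, one_mul]
    rw [← sign_mul_self (k i : ℝ)]
    push_cast; ring
  have h2 := MeasureTheory.norm_setIntegral_le_of_norm_le_const (μ := MeasureTheory.volume)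
    (s := Set.Icc (0 : Fin d → ℝ) 1) (by simp [Real.volume_Icc_pi]) fun x _ => hbd x
  simpa [MeasureTheory.measureReal_def, Real.volume_Icc_pi] using h2

/-- The constant in the estimate of the weighted norm by the supremum norm. -/
def fourierConst (d : ℕ) (s : ℝ) : ℝ := ∑' k : Fin d → ℤ, Real.exp (-s * absZ k)

lemma fourierConst_nonneg (s : ℝ) : 0 ≤ fourierConst d s := tsum_nonneg fun _ => Real.exp_nonneg _

lemma MemA.fourierCoef_summable (hρ : 0 < ρ) (hf : MemA ρ f) {M : ℝ}
    (hM : ∀ η ∈ closedStrip d ρ, ‖f η‖ ≤ M) (hρ'0 : 0 ≤ ρ') (hρ' : ρ' < ρ) :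
    (Summable fun k => ‖fourierCoef f k‖ * Real.exp (2 * Real.pi * ρ' * absZ k)) ∧
    ∑' k, ‖fourierCoef f k‖ * Real.exp (2 * Real.pi * ρ' * absZ k)
      ≤ M * fourierConst d (Real.pi * (ρ - ρ')) := by
  have hs := (summable_exp_neg_absZ (d := d) (mul_pos Real.pi_pos (sub_pos.2 hρ'))).mul_left M
  have hle : ∀ k, ‖fourierCoef f k‖ * Real.exp (2 * Real.pi * ρ' * absZ k)
      ≤ M * Real.exp (-(Real.pi * (ρ - ρ')) * absZ k) := fun k => by
    have h1 := hf.norm_fourierCoef_le hρ hM (ρ' := (ρ + ρ') / 2) (by linarith) (by linarith) k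
    calc _ ≤ M * Real.exp (-(2 * Real.pi * ((ρ + ρ') / 2)) * absZ k)
          * Real.exp (2 * Real.pi * ρ' * absZ k) :=
        mul_le_mul_of_nonneg_right h1 (Real.exp_nonneg _)
      _ = _ := by
        rw [mul_assoc, ← Real.exp_add]; congr 2; ring
  have hs2 := hs.of_nonneg_of_le (fun k => by positivity) hle
  refine ⟨hs2, ?_⟩
  rw [fourierConst, ← tsum_mul_left]
  exact hs2.tsum_le_tsum hle hs

/-- Elements of `𝒜_ρ` are the sums of their Fourier series on smaller strips. -/
lemma MemA.hasSum_fourier (hρ : 0 < ρ) (hf : MemA ρ f) (hρ'0 : 0 < ρ') (hρ' : ρ' < ρ)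
    {η : Fin d → ℂ} (hη : η ∈ closedStrip d ρ') :
    HasSum (fun k => fourierCoef f k * character k η) (f η) := by
  obtain ⟨M, _, hM⟩ := hf.exists_bound
  have hs := (hf.fourierCoef_summable hρ hM hρ'0.le hρ').1
  have hs0 := (hf.fourierCoef_summable hρ hM le_rfl hρ).1
  have hreal : ∀ σ : Fin d → ℝ,
      HasSum (fun k => fourierCoef f k * character k (toC σ)) (f (toC σ)) := by
    refine QPLindstedt.hasSum_fourier (G := fun x => f (toC x)) (hf.continuous_real hρ.le)
      (fun x k => ?_) ?_
    · rw [toC_add, ← hf.periodic _ (toC_mem_closedStrip hρ.le x) k]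
      congr 2
    · have h0 : Summable fun k => ‖fourierCoef f k‖ := by simpa using hs0
      exact Summable.of_norm h0
  have := (memA_series hρ'0 hs).eq_of_eq_on_real hρ'0 (hf.anti hρ'.le)
    (fun σ => (hreal σ).tsum_eq) η hη
  rw [← this]
  exact hasSum_series hs hη

/-- Elements of `𝒜_ρ` have finite weighted norm on smaller strips. -/
lemma MemA.wiener (hρ : 0 < ρ) (hf : MemA ρ f) {M : ℝ}
    (hM : ∀ η ∈ closedStrip d ρ, ‖f η‖ ≤ M) (hρ'0 : 0 < ρ') (hρ' : ρ' < ρ) {r : ℝ} (hr : 0 < r) :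
    Wiener ρ' r (fun η _ => f η) (M * fourierConst d (Real.pi * (ρ - ρ'))) := by
  obtain ⟨hs, hle⟩ := hf.fourierCoef_summable hρ hM hρ'0.le hρ'
  have h := Wiener.of_family (ρ := ρ') (f := fun η _ => f η) hr (fourierCoef f) (fun k => (k, 0))
    (by simpa [weight] using hs)
    fun η hη ε _ => by simpa [monom] using hf.hasSum_fourier hρ hρ'0 hρ' hη
  simp only [weight, pow_zero, mul_one] at h
  exact h.mono_right hle

/-! ### Averages, translations, derivatives and small divisors in Wiener algebras -/

/-- The average over the torus, for a fixed `ε`. -/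
def avg (f : (Fin d → ℂ) → ℂ → ℂ) (ε : ℂ) : ℂ := average fun η => f η ε

section Operators

variable {ρ ρ' r σ A : ℝ} {f g : (Fin d → ℂ) → ℂ → ℂ} {c c' : (Fin d → ℤ) × ℕ → ℂ} {M N : ℝ}
  {ε : ℂ}

/-- Coefficientwise comparison of weighted norms. -/
lemma summable_weight_of_le (hr : 0 ≤ r) {K : ℝ}
    (hc : Summable fun m => ‖c m‖ * weight ρ r m) (hM : ∑' m, ‖c m‖ * weight ρ r m ≤ M)
    (h : ∀ m, ‖c' m‖ * weight ρ' r m ≤ K * (‖c m‖ * weight ρ r m)) (hK : 0 ≤ K) :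
    (Summable fun m => ‖c' m‖ * weight ρ' r m) ∧ ∑' m, ‖c' m‖ * weight ρ' r m ≤ K * M := by
  have hs := (hc.mul_left K).of_nonneg_of_le
    (fun m => mul_nonneg (norm_nonneg _) (weight_nonneg hr m)) h
  refine ⟨hs, (hs.tsum_le_tsum h (hc.mul_left K)).trans ?_⟩
  rw [tsum_mul_left]
  exact mul_le_mul_of_nonneg_left hM hK

lemma HasCoeff.hasSum_avg (hρ : 0 ≤ ρ) (hf : HasCoeff ρ r f c) (hε : ‖ε‖ ≤ r) :
    HasSum (fun m => if m.1 = 0 then c m * ε ^ m.2 else 0) (avg f ε) := by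
  refine average_hasSum (a := fun m : (Fin d → ℤ) × ℕ => c m * ε ^ m.2) (k := fun m => m.1) ?_
    fun s => ?_
  · refine hf.summable.of_nonneg_of_le (fun m => norm_nonneg _) fun m => ?_
    rw [norm_mul, norm_pow]
    refine mul_le_mul_of_nonneg_left ?_ (norm_nonneg _)
    have h1 : (1 : ℝ) ≤ Real.exp (2 * Real.pi * ρ * absZ m.1) :=
      Real.one_le_exp (mul_nonneg (by positivity) (absZ_nonneg _))
    calc ‖ε‖ ^ m.2 ≤ 1 * r ^ m.2 := by
          rw [one_mul]; exact pow_le_pow_left₀ (norm_nonneg _) hε _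
      _ ≤ weight ρ r m := mul_le_mul_of_nonneg_right h1
          (pow_nonneg ((norm_nonneg _).trans hε) _)
  · refine (hf.hasSum _ (toC_mem_closedStrip hρ s) ε hε).congr_fun fun m => ?_
    simp only [QPLindstedt.monom]; ring

lemma Wiener.avg (hρ : 0 ≤ ρ) (hr : 0 ≤ r) (hf : Wiener ρ r f M) :
    Wiener ρ r (fun (_ : Fin d → ℂ) ε => QPLindstedt.avg f ε) M := by
  obtain ⟨c, hc, hM⟩ := hf
  obtain ⟨h1, h2⟩ := summable_weight_of_le (K := 1) (ρ' := ρ)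
    (c' := fun m => if m.1 = 0 then c m else 0) hr hc.summable hM (fun m => by
      rw [one_mul]
      refine mul_le_mul_of_nonneg_right ?_ (weight_nonneg hr m)
      split_ifs <;> simp) zero_le_one
  refine ⟨_, ⟨h1, fun η _ ε hε => (hc.hasSum_avg hρ hε).congr_fun fun m => ?_⟩, by simpa using h2⟩
  split_ifs with h <;> simp [QPLindstedt.monom, h, character_zero]

lemma avg_congr (h : ∀ s : Fin d → ℝ, f (toC s) ε = g (toC s) ε) : avg f ε = avg g ε :=
  average_congr h

lemma Wiener.avg_add (hρ : 0 ≤ ρ) (hr : 0 ≤ r) (hf : Wiener ρ r f M) (hg : Wiener ρ r g N)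
    (hε : ‖ε‖ ≤ r) : QPLindstedt.avg (fun η ε => f η ε + g η ε) ε
      = QPLindstedt.avg f ε + QPLindstedt.avg g ε := by
  obtain ⟨c, hc, -⟩ := hf
  obtain ⟨c', hc', -⟩ := hg
  refine ((hc.add hr hc').hasSum_avg hρ hε).unique
    (((hc.hasSum_avg hρ hε).add (hc'.hasSum_avg hρ hε)).congr_fun fun m => ?_)
  split_ifs <;> simp [add_mul]

lemma avg_mul_left (a : ℂ → ℂ) (f : (Fin d → ℂ) → ℂ → ℂ) (ε : ℂ) :
    avg (fun η ε => a ε * f η ε) ε = a ε * avg f ε :=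
  MeasureTheory.integral_const_mul _ _

lemma avg_const (a : ℂ → ℂ) (ε : ℂ) : avg (fun (_ : Fin d → ℂ) ε => a ε) ε = a ε := by
  simp [avg, average, MeasureTheory.measureReal_def, Real.volume_Icc_pi]

lemma Wiener.avg_sub (hρ : 0 ≤ ρ) (hr : 0 < r) (hf : Wiener ρ r f M) (hg : Wiener ρ r g N)
    (hε : ‖ε‖ ≤ r) : QPLindstedt.avg (fun η ε => f η ε - g η ε) ε
      = QPLindstedt.avg f ε - QPLindstedt.avg g ε := by
  have h := hf.avg_add hρ hr.le (hg.const_mul (-1) hρ hr) hε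
  have h2 := avg_mul_left (fun _ => -1) g ε
  rw [h2] at h
  simpa [sub_eq_add_neg] using h

lemma HasCoeff.translate (hf : HasCoeff ρ r f c) (s : Fin d → ℝ) :
    HasCoeff ρ r (fun η ε => f (η + toC s) ε) (fun m => c m * character m.1 (toC s)) where
  summable := by simpa [norm_character_toC] using hf.summable
  hasSum η hη ε hε := by
    refine (hf.hasSum _ (add_toC_mem_closedStrip hη s) ε hε).congr_fun fun m => ?_
    simp only [QPLindstedt.monom, character_add]; ring

lemma Wiener.translate (hf : Wiener ρ r f M) (s : Fin d → ℝ) :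
    Wiener ρ r (fun η ε => f (η + toC s) ε) M := by
  obtain ⟨c, hc, hM⟩ := hf
  exact ⟨_, hc.translate s, by simpa [norm_character_toC] using hM⟩

lemma Wiener.avg_translate (hρ : 0 ≤ ρ) (hf : Wiener ρ r f M) (s : Fin d → ℝ) (hε : ‖ε‖ ≤ r) :
    QPLindstedt.avg (fun η ε => f (η + toC s) ε) ε = QPLindstedt.avg f ε := by
  obtain ⟨c, hc, -⟩ := hf
  refine ((hc.translate s).hasSum_avg hρ hε).unique ((hc.hasSum_avg hρ hε).congr_fun fun m => ?_)
  split_ifs with h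
  · rw [h, character_zero, mul_one]
  · rfl

/-- The product `α·k`. -/
def dotR (α : Fin d → ℝ) (k : Fin d → ℤ) : ℝ := ∑ i, α i * (k i : ℝ)

lemma abs_dotR_le {α : Fin d → ℝ} (hA : ∀ i, |α i| ≤ A) (k : Fin d → ℤ) :
    |dotR α k| ≤ A * absZ k := by
  rw [dotR, absZ, Finset.mul_sum]
  refine (Finset.abs_sum_le_sum_abs _ _).trans (Finset.sum_le_sum fun i _ => ?_)
  rw [abs_mul]
  exact mul_le_mul_of_nonneg_right (hA i) (abs_nonneg _)

/-- The factor `2πi α·k` by which `∂_α` acts on the character of index `k`. -/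
def derivFactor (α : Fin d → ℝ) (k : Fin d → ℤ) : ℂ := 2 * Real.pi * Complex.I * dotR α k

lemma norm_derivFactor_le {α : Fin d → ℝ} (hA : ∀ i, |α i| ≤ A) (k : Fin d → ℤ) :
    ‖derivFactor α k‖ ≤ 2 * Real.pi * A * absZ k := by
  have : ‖derivFactor α k‖ = 2 * Real.pi * |dotR α k| := by
    simp [derivFactor, abs_of_pos Real.pi_pos]
  rw [this, mul_assoc _ A]
  exact mul_le_mul_of_nonneg_left (abs_dotR_le hA k) (by positivity)

lemma derivFactor_zero (α : Fin d → ℝ) : derivFactor α 0 = 0 := by simp [derivFactor, dotR]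

lemma character_smul_toC (α : Fin d → ℝ) (k : Fin d → ℤ) (z : ℂ) :
    character k (z • toC α) = Complex.exp (derivFactor α k * z) := by
  unfold character derivFactor dotR
  congr 1
  simp only [toC, Pi.smul_apply, smul_eq_mul, Complex.ofReal_sum, Complex.ofReal_mul,
    Complex.ofReal_intCast, Finset.mul_sum, Finset.sum_mul]
  refine Finset.sum_congr rfl fun i _ => by ring

lemma monom_add_smul (α : Fin d → ℝ) (m : (Fin d → ℤ) × ℕ) (η : Fin d → ℂ) (z : ℂ) :
    monom m (η + z • toC α) ε = monom m η ε * Complex.exp (derivFactor α m.1 * z) := by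
  rw [monom, monom, character_add, character_smul_toC]; ring

lemma add_smul_mem_closedStrip {α : Fin d → ℝ} (hA : ∀ i, |α i| ≤ A) {η : Fin d → ℂ}
    (hη : η ∈ closedStrip d ρ) {z : ℂ} {B : ℝ} (hz : ‖z‖ ≤ B) :
    η + z • toC α ∈ closedStrip d (ρ + A * B) := fun i => by
  have h1 : (η + z • toC α) i = η i + z * (α i : ℂ) := by simp [toC]
  rw [h1, Complex.add_im, Complex.im_mul_ofReal]
  refine (abs_add_le _ _).trans (add_le_add (hη i) ?_)
  rw [abs_mul, mul_comm]
  exact mul_le_mul (hA i) ((Complex.abs_im_le_norm z).trans hz) (abs_nonneg _)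
    ((abs_nonneg _).trans (hA i))

/-- The weight with the factor `|k|` absorbed by a smaller strip. -/
lemma absZ_mul_weight_le (hr : 0 ≤ r) (hσ : 0 < σ) (m : (Fin d → ℤ) × ℕ) :
    2 * Real.pi * absZ m.1 * weight (ρ - σ) r m ≤ σ⁻¹ * weight ρ r m := by
  unfold weight
  have h1 := mul_exp_le (x := absZ m.1) (y := 2 * Real.pi * (ρ - σ)) (t := 2 * Real.pi * σ)
  have h2 : 2 * Real.pi * (ρ - σ) + 2 * Real.pi * σ = 2 * Real.pi * ρ := by ring
  rw [h2] at h1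
  rw [le_inv_mul_iff₀ hσ]
  calc _ = 2 * Real.pi * σ * absZ m.1 * Real.exp (2 * Real.pi * (ρ - σ) * absZ m.1) * r ^ m.2 := by
        ring
    _ ≤ _ := mul_le_mul_of_nonneg_right h1 (pow_nonneg hr _)

/-- The coefficients of the derivative `∂_α`. -/
def derivCoeff (α : Fin d → ℝ) (c : (Fin d → ℤ) × ℕ → ℂ) (m : (Fin d → ℤ) × ℕ) : ℂ :=
  c m * derivFactor α m.1

lemma norm_derivCoeff_le {α : Fin d → ℝ} (hA : ∀ i, |α i| ≤ A) (hA0 : 0 ≤ A) (hr : 0 ≤ r)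
    (hσ : 0 < σ) (m : (Fin d → ℤ) × ℕ) :
    ‖derivCoeff α c m‖ * weight (ρ - σ) r m ≤ (A / σ) * (‖c m‖ * weight ρ r m) := by
  rw [derivCoeff, norm_mul]
  have h1 := norm_derivFactor_le hA m.1
  have h2 := absZ_mul_weight_le (ρ := ρ) hr hσ m
  calc _ ≤ ‖c m‖ * (2 * Real.pi * A * absZ m.1) * weight (ρ - σ) r m := by
        refine mul_le_mul_of_nonneg_right ?_ (weight_nonneg hr m)
        exact mul_le_mul_of_nonneg_left h1 (norm_nonneg _)
    _ = ‖c m‖ * A * (2 * Real.pi * absZ m.1 * weight (ρ - σ) r m) := by ring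
    _ ≤ ‖c m‖ * A * (σ⁻¹ * weight ρ r m) := mul_le_mul_of_nonneg_left h2 (by positivity)
    _ = _ := by rw [div_eq_mul_inv]; ring

/-- The derivative `∂_α` of the sum of a series of monomials. -/
def derivSeries (α : Fin d → ℝ) (c : (Fin d → ℤ) × ℕ → ℂ) (η : Fin d → ℂ) (ε : ℂ) : ℂ :=
  ∑' m, derivCoeff α c m * monom m η ε

lemma HasCoeff.derivSeries {α : Fin d → ℝ} (hA : ∀ i, |α i| ≤ A) (hA0 : 0 ≤ A) (hr : 0 ≤ r)
    (hσ : 0 < σ) (hf : HasCoeff ρ r f c) :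
    HasCoeff (ρ - σ) r (QPLindstedt.derivSeries α c) (derivCoeff α c) :=
  HasCoeff.of_summable (summable_weight_of_le hr hf.summable le_rfl
    (fun m => norm_derivCoeff_le hA hA0 hr hσ m) (by positivity)).1

lemma HasCoeff.hasDerivAt {α : Fin d → ℝ} (hA : ∀ i, |α i| ≤ A) (hA0 : 0 < A) (hr : 0 ≤ r)
    (hσ : 0 < σ) (hf : HasCoeff ρ r f c) {η : Fin d → ℂ} (hη : η ∈ closedStrip d (ρ - σ))
    (hε : ‖ε‖ ≤ r) :
    HasDerivAt (fun z : ℂ => f (η + z • toC α) ε) (QPLindstedt.derivSeries α c η ε) 0 := by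
  have hs := hf.summable.mul_left (A / (σ / 2))
  set δ := σ / 2 / A
  have hδ : 0 < δ := by positivity
  have hmem : ∀ z ∈ Metric.ball (0 : ℂ) δ, η + z • toC α ∈ closedStrip d (ρ - σ / 2) := by
    intro z hz
    have := add_smul_mem_closedStrip hA hη (mem_ball_zero_iff.1 hz).le
    refine closedStrip_mono (le_of_eq ?_) this
    simp only [δ]; field_simp; ring
  have h0 : (0 : ℂ) ∈ Metric.ball (0 : ℂ) δ := Metric.mem_ball_self hδ
  have hd : ∀ m, ∀ z ∈ Metric.ball (0 : ℂ) δ,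
      HasDerivAt (fun z : ℂ => c m * monom m (η + z • toC α) ε)
        (derivCoeff α c m * monom m (η + z • toC α) ε) z := by
    intro m z _
    have h1 : HasDerivAt (fun z : ℂ => Complex.exp (derivFactor α m.1 * z))
        (Complex.exp (derivFactor α m.1 * z) * derivFactor α m.1) z := by
      simpa using ((hasDerivAt_id z).const_mul (derivFactor α m.1)).cexp
    have h2 := h1.const_mul (c m * monom m η ε)
    simp only [monom_add_smul, derivCoeff]
    convert! h2 using 1
    · ext z; ring
    · ring
  have key := hasDerivAt_tsum_of_isPreconnected hs Metric.isOpen_ball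
    (convex_ball (0 : ℂ) δ).isPreconnected hd (fun m z hz => ?_) h0 ?_ h0
  · simp only [zero_smul, add_zero] at key
    refine key.congr_of_eventuallyEq ?_
    filter_upwards [Metric.ball_mem_nhds (0 : ℂ) hδ] with z hz
    exact (hf.hasSum _ (closedStrip_mono (by linarith) (hmem z hz)) ε hε).tsum_eq.symm
  · exact (norm_term_le _ m (hmem z hz) hε).trans
      (norm_derivCoeff_le hA hA0.le hr (by positivity) m)
  · simp only [zero_smul, add_zero]
    exact (hf.hasSum _ (closedStrip_mono (by linarith) hη) ε hε).summable

/-- Existence of the derivative along `α`, with the loss of a part of the strip. -/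
lemma Wiener.exists_deriv {α : Fin d → ℝ} (hA : ∀ i, |α i| ≤ A) (hA0 : 0 < A) (hr : 0 ≤ r)
    (hσ : 0 < σ) (hρσ : 0 ≤ ρ - σ) (hf : Wiener ρ r f M) :
    ∃ p, Wiener (ρ - σ) r p (A / σ * M) ∧ (∀ ε : ℂ, ‖ε‖ ≤ r → QPLindstedt.avg p ε = 0) ∧
      ∀ η ∈ closedStrip d (ρ - σ), ∀ ε : ℂ, ‖ε‖ ≤ r →
        HasDerivAt (fun z : ℂ => f (η + z • toC α) ε) (p η ε) 0 := by
  obtain ⟨c, hc, hM⟩ := hf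
  have hd := hc.derivSeries hA hA0.le hr hσ
  refine ⟨_, ⟨_, hd, ?_⟩, fun ε hε => ?_, fun η hη ε hε => hc.hasDerivAt hA hA0 hr hσ hη hε⟩
  · exact (summable_weight_of_le hr hc.summable hM
      (fun m => norm_derivCoeff_le hA hA0.le hr hσ m) (by positivity)).2
  · refine (hd.hasSum_avg hρσ hε).unique (hasSum_zero.congr_fun fun m => ?_)
    split_ifs with h
    · simp [derivCoeff, h, derivFactor_zero]
    · rfl

/-- The small divisors of the translation by `s` are bounded below by `κ |k|^(-n)`. -/
def SmallDivisors (s : Fin d → ℝ) (κ : ℝ) (n : ℕ) : Prop :=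
  ∀ k : Fin d → ℤ, k ≠ 0 → κ ≤ ‖1 - character k (toC (-s))‖ * absZ k ^ n

lemma absZ_pow_mul_weight_le (hr : 0 ≤ r) (hσ : 0 < σ) (n : ℕ) (m : (Fin d → ℤ) × ℕ) :
    absZ m.1 ^ n * weight (ρ - σ) r m ≤ n.factorial / σ ^ n * weight ρ r m := by
  unfold weight
  have h0 := absZ_nonneg m.1
  have h1 : (σ * absZ m.1) ^ n / n.factorial ≤ Real.exp (2 * Real.pi * σ * absZ m.1) := by
    refine (Real.pow_div_factorial_le_exp _ (by positivity) n).trans (Real.exp_le_exp.2 ?_)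
    have : σ * absZ m.1 ≤ 2 * Real.pi * (σ * absZ m.1) :=
      le_mul_of_one_le_left (by positivity) (by linarith [Real.two_le_pi])
    linarith
  have h2 : Real.exp (2 * Real.pi * ρ * absZ m.1) = Real.exp (2 * Real.pi * (ρ - σ) * absZ m.1)
      * Real.exp (2 * Real.pi * σ * absZ m.1) := by rw [← Real.exp_add]; congr 1; ring
  rw [h2]
  have h3 : absZ m.1 ^ n ≤ n.factorial / σ ^ n * Real.exp (2 * Real.pi * σ * absZ m.1) := by
    rw [div_le_iff₀ (by positivity), mul_pow] at h1
    rw [div_mul_eq_mul_div, le_div_iff₀ (by positivity)]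
    linarith
  calc _ = absZ m.1 ^ n * (Real.exp (2 * Real.pi * (ρ - σ) * absZ m.1) * r ^ m.2) := by ring
    _ ≤ n.factorial / σ ^ n * Real.exp (2 * Real.pi * σ * absZ m.1)
        * (Real.exp (2 * Real.pi * (ρ - σ) * absZ m.1) * r ^ m.2) :=
      mul_le_mul_of_nonneg_right h3 (by positivity)
    _ = _ := by ring

/-- The cohomological equation of first order. -/
lemma Wiener.exists_cohomology {s : Fin d → ℝ} {κ : ℝ} {n : ℕ} (hs : SmallDivisors s κ n)
    (hκ : 0 < κ) (hr : 0 ≤ r) (hσ : 0 < σ) (hρσ : 0 ≤ ρ - σ) (hf : Wiener ρ r f M) :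
    ∃ v, Wiener (ρ - σ) r v (n.factorial / κ / σ ^ n * M) ∧
      (∀ ε : ℂ, ‖ε‖ ≤ r → QPLindstedt.avg v ε = 0) ∧
      ∀ η ∈ closedStrip d (ρ - σ), ∀ ε : ℂ, ‖ε‖ ≤ r →
        v η ε - v (η + toC (-s)) ε = f η ε - QPLindstedt.avg f ε := by
  obtain ⟨c, hc, hM⟩ := hf
  set b : (Fin d → ℤ) × ℕ → ℂ :=
    fun m => if m.1 = 0 then 0 else c m / (1 - character m.1 (toC (-s)))
  have hb : ∀ m, ‖b m‖ * weight (ρ - σ) r m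
      ≤ n.factorial / κ / σ ^ n * (‖c m‖ * weight ρ r m) := by
    intro m
    by_cases h : m.1 = 0
    · simp only [b, h, if_true, norm_zero, zero_mul]
      exact mul_nonneg (by positivity) (mul_nonneg (norm_nonneg _) (weight_nonneg hr m))
    · have h1 := hs m.1 h
      have hk : 0 < absZ m.1 := zero_lt_one.trans_le (one_le_absZ h)
      have hpos : 0 < ‖1 - character m.1 (toC (-s))‖ := by
        by_contra hneg
        rw [le_antisymm (not_lt.1 hneg) (norm_nonneg _), zero_mul] at h1
        linarith
      have h2 : ‖b m‖ ≤ ‖c m‖ * (absZ m.1 ^ n / κ) := by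
        simp only [b, h, if_false, norm_div]
        rw [div_eq_mul_inv]
        refine mul_le_mul_of_nonneg_left ?_ (norm_nonneg _)
        rw [inv_le_comm₀ hpos (by positivity), inv_div, div_le_iff₀ (by positivity)]
        exact h1
      have h3 := absZ_pow_mul_weight_le (ρ := ρ) hr hσ n m
      calc _ ≤ ‖c m‖ * (absZ m.1 ^ n / κ) * weight (ρ - σ) r m :=
            mul_le_mul_of_nonneg_right h2 (weight_nonneg hr m)
        _ = ‖c m‖ / κ * (absZ m.1 ^ n * weight (ρ - σ) r m) := by ring
        _ ≤ ‖c m‖ / κ * (n.factorial / σ ^ n * weight ρ r m) :=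
            mul_le_mul_of_nonneg_left h3 (by positivity)
        _ = _ := by ring
  obtain ⟨h1, h2⟩ := summable_weight_of_le hr hc.summable hM hb (by positivity)
  have hv : HasCoeff (ρ - σ) r _ b := HasCoeff.of_summable h1
  refine ⟨_, ⟨b, hv, h2⟩, fun ε hε => ?_, fun η hη ε hε => ?_⟩
  · refine (hv.hasSum_avg hρσ hε).unique (hasSum_zero.congr_fun fun m => ?_)
    split_ifs with h
    · simp [b, h]
    · rfl
  · have e1 := (hv.hasSum η hη ε hε).sub ((hv.translate (-s)).hasSum η hη ε hε)
    have e2 := (hc.hasSum η (closedStrip_mono (by linarith) hη) ε hε).sub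
      (hc.hasSum_avg (by linarith) hε)
    refine e1.unique (e2.congr_fun fun m => ?_)
    by_cases h : m.1 = 0
    · simp [b, h, QPLindstedt.monom, character_zero]
    · have h1 := hs m.1 h
      have hne : 1 - character m.1 (toC (-s)) ≠ 0 := by
        intro h0; rw [h0, norm_zero, zero_mul] at h1; linarith
      simp only [b, h, if_false, sub_zero]
      field_simp

end Operators

/-! ### Composition, inversion and the linearized equation -/

section Composition

variable {ρ ρ₁ r σ A : ℝ} {f g h u V : (Fin d → ℂ) → ℂ → ℂ} {c : (Fin d → ℤ) × ℕ → ℂ}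
  {M N S B U : ℝ}

lemma Wiener.comp_family (hρ : 0 ≤ ρ) (hr : 0 < r) {F : (Fin d → ℤ) × ℕ → (Fin d → ℂ) → ℂ → ℂ}
    {T : (Fin d → ℤ) × ℕ → ℝ} {D : ℝ} (hF : ∀ m, Wiener ρ r (F m) (T m))
    (hT : ∀ m, weight ρ r m * T m ≤ D * weight ρ₁ r m) (hD : 0 ≤ D)
    (hc : Summable fun m => ‖c m‖ * weight ρ₁ r m) (hS : ∑' m, ‖c m‖ * weight ρ₁ r m ≤ S)
    (hf : ∀ η ∈ closedStrip d ρ, ∀ ε : ℂ, ‖ε‖ ≤ r →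
      HasSum (fun m => c m * (monom m η ε * F m η ε)) (f η ε)) :
    Wiener ρ r f (D * S) := by
  have h1 : ∀ m, Wiener ρ r (fun η ε => c m * (monom m η ε * F m η ε))
      (‖c m‖ * (weight ρ r m * T m)) := fun m =>
    ((Wiener.of_monom m hr).mul hρ hr (hF m)).const_mul (c m) hρ hr
  have hle : ∀ m, ‖c m‖ * (weight ρ r m * T m) ≤ D * (‖c m‖ * weight ρ₁ r m) := fun m => by
    rw [mul_left_comm D]; exact mul_le_mul_of_nonneg_left (hT m) (norm_nonneg _)
  have hs := (hc.mul_left D).of_nonneg_of_le (fun m => (h1 m).nonneg hr.le) hle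
  refine (Wiener.hasSum hr h1 hs.hasSum hf).mono_right ?_
  refine (hs.tsum_le_tsum hle (hc.mul_left D)).trans ?_
  rw [tsum_mul_left]
  exact mul_le_mul_of_nonneg_left hS hD

lemma Wiener.exp (hρ : 0 ≤ ρ) (hr : 0 < r) (hf : Wiener ρ r f M) :
    Wiener ρ r (fun η ε => Complex.exp (f η ε)) (Real.exp M) := by
  refine hf.powerSeries (a := fun n => ((n.factorial : ℂ))⁻¹) hρ hr ?_ fun η _ ε _ => ?_
  · have := NormedSpace.expSeries_div_hasSum_exp (𝔸 := ℝ) M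
    rw [← Real.exp_eq_exp_ℝ] at this
    refine this.congr_fun fun n => ?_
    simp [div_eq_inv_mul]
  · have := NormedSpace.expSeries_div_hasSum_exp (𝔸 := ℂ) (f η ε)
    rw [← Complex.exp_eq_exp_ℂ] at this
    refine this.congr_fun fun n => ?_
    simp [div_eq_inv_mul]

lemma hasSum_tail_two {E : Type*} [NormedField E] {a : ℕ → E} {x : E} (h : HasSum a x) :
    HasSum (fun n => if n < 2 then 0 else a n) (x - a 0 - a 1) := by
  have h2 := h.sub (hasSum_sum_of_ne_finset_zero (s := Finset.range 2)
    (f := fun n => if n < 2 then a n else 0) fun n hn => by simp at hn; simp; omega)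
  simp only [Finset.sum_range_succ, Finset.sum_range_zero] at h2
  norm_num at h2
  rw [← sub_sub] at h2
  refine h2.congr_fun fun n => ?_
  split_ifs <;> first | (simp; done) | (exfalso; omega)

lemma exp_sub_one_sub_le {x : ℝ} (hx : 0 ≤ x) : Real.exp x - 1 - x ≤ x ^ 2 * Real.exp x := by
  have h1 : Real.exp x - 1 ≤ x * Real.exp x := by
    have h := Real.add_one_le_exp (-x)
    have h2 : Real.exp (-x) * Real.exp x = 1 := by rw [← Real.exp_add]; simp
    nlinarith [Real.exp_pos x]
  nlinarith

lemma Wiener.exp_remainder (hρ : 0 ≤ ρ) (hr : 0 < r) (hf : Wiener ρ r f M) :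
    Wiener ρ r (fun η ε => Complex.exp (f η ε) - 1 - f η ε) (M ^ 2 * Real.exp M) := by
  refine Wiener.mono_right ?_ (exp_sub_one_sub_le (hf.nonneg hr.le))
  refine hf.powerSeries (a := fun n => if n < 2 then 0 else ((n.factorial : ℂ))⁻¹) hρ hr ?_
    fun η _ ε _ => ?_
  · have := NormedSpace.expSeries_div_hasSum_exp (𝔸 := ℝ) M
    rw [← Real.exp_eq_exp_ℝ] at this
    have h2 := hasSum_tail_two this
    simp only [pow_zero, Nat.factorial_zero, Nat.cast_one, div_one, pow_one,
      Nat.factorial_one] at h2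
    refine h2.congr_fun fun n => ?_
    split_ifs <;> simp [div_eq_inv_mul]
  · have := NormedSpace.expSeries_div_hasSum_exp (𝔸 := ℂ) (f η ε)
    rw [← Complex.exp_eq_exp_ℂ] at this
    have h2 := hasSum_tail_two this
    simp only [pow_zero, Nat.factorial_zero, Nat.cast_one, div_one, pow_one,
      Nat.factorial_one] at h2
    refine h2.congr_fun fun n => ?_
    split_ifs <;> simp [div_eq_inv_mul]

/-- The quadratic remainder of the Taylor expansion of `V` along `α`. -/
def remainder (α : Fin d → ℝ) (V dV h u : (Fin d → ℂ) → ℂ → ℂ) (η : Fin d → ℂ) (ε : ℂ) : ℂ :=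
  V (η + (h η ε + u η ε) • toC α) ε - V (η + h η ε • toC α) ε
    - u η ε * dV (η + h η ε • toC α) ε

lemma Wiener.remainder {α : Fin d → ℝ} (hA : ∀ i, |α i| ≤ A) (hA0 : 0 < A) (hρ : 0 ≤ ρ)
    (hr : 0 < r) (hV : HasCoeff ρ₁ r V c) (hS : ∑' m, ‖c m‖ * weight ρ₁ r m ≤ S)
    (hh : Wiener ρ r h B) (hu : Wiener ρ r u U) {g : ℝ} (hg : 0 < g)
    (hgap : ρ + A * (B + U) + g ≤ ρ₁) :
    Wiener ρ r (QPLindstedt.remainder α V (derivSeries α c) h u) (2 * (A * U / g) ^ 2 * S) := by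
  have hB := hh.nonneg hr.le
  have hU := hu.nonneg hr.le
  set b : (Fin d → ℤ) × ℕ → ℂ := fun m => derivFactor α m.1
  have hb : ∀ m, ‖b m‖ ≤ 2 * Real.pi * A * absZ m.1 := fun m => norm_derivFactor_le hA m.1
  refine Wiener.comp_family (ρ₁ := ρ₁) (c := c) hρ hr (F := fun m η ε => Complex.exp (b m * h η ε) *
    (Complex.exp (b m * u η ε) - 1 - b m * u η ε)) (fun m =>
    ((hh.const_mul (b m) hρ hr).exp hρ hr).mul hρ hr
      ((hu.const_mul (b m) hρ hr).exp_remainder hρ hr)) (fun m => ?_) (by positivity)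
    hV.summable hS fun η hη ε hε => ?_
  · set x := absZ m.1
    have hx : 0 ≤ x := absZ_nonneg m.1
    have h1 : ‖b m‖ * B ≤ 2 * Real.pi * x * (A * B) := by
      calc _ ≤ 2 * Real.pi * A * x * B := mul_le_mul_of_nonneg_right (hb m) hB
        _ = _ := by ring
    have h2 : ‖b m‖ * U ≤ 2 * Real.pi * x * (A * U) := by
      calc _ ≤ 2 * Real.pi * A * x * U := mul_le_mul_of_nonneg_right (hb m) hU
        _ = _ := by ring
    have h3 : (‖b m‖ * U) ^ 2 ≤ (2 * Real.pi * x * (A * U)) ^ 2 :=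
      pow_le_pow_left₀ (by positivity) h2 2
    have h4 : (2 * Real.pi * x * g) ^ 2 ≤ 2 * Real.exp (2 * Real.pi * x * g) := by
      have := Real.pow_div_factorial_le_exp (2 * Real.pi * x * g) (by positivity) 2
      rw [div_le_iff₀ (by positivity)] at this
      norm_num [Nat.factorial] at this
      linarith
    have h5 : (2 * Real.pi * x * (A * U)) ^ 2
        ≤ 2 * (A * U / g) ^ 2 * Real.exp (2 * Real.pi * x * g) := by
      have h6 : (2 * Real.pi * x * (A * U)) ^ 2 = (A * U / g) ^ 2 * (2 * Real.pi * x * g) ^ 2 := by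
        field_simp
      rw [h6]
      nlinarith [sq_nonneg (A * U / g)]
    have h7 : Real.exp (‖b m‖ * B) * ((‖b m‖ * U) ^ 2 * Real.exp (‖b m‖ * U))
        ≤ Real.exp (2 * Real.pi * x * (A * B)) * (2 * (A * U / g) ^ 2 *
          Real.exp (2 * Real.pi * x * g) * Real.exp (2 * Real.pi * x * (A * U))) := by
      gcongr
      exact h3.trans h5
    have h8 : Real.exp (2 * Real.pi * ρ * x) * (Real.exp (2 * Real.pi * x * (A * B)) *
        (2 * (A * U / g) ^ 2 * Real.exp (2 * Real.pi * x * g)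
          * Real.exp (2 * Real.pi * x * (A * U))))
        ≤ 2 * (A * U / g) ^ 2 * Real.exp (2 * Real.pi * ρ₁ * x) := by
      have : Real.exp (2 * Real.pi * ρ * x) * (Real.exp (2 * Real.pi * x * (A * B)) *
          (2 * (A * U / g) ^ 2 * Real.exp (2 * Real.pi * x * g)
            * Real.exp (2 * Real.pi * x * (A * U))))
          = 2 * (A * U / g) ^ 2 * Real.exp (2 * Real.pi * x * (ρ + A * (B + U) + g)) := by
        have e : 2 * Real.pi * x * (ρ + A * (B + U) + g) = 2 * Real.pi * ρ * x
          + 2 * Real.pi * x * (A * B) + 2 * Real.pi * x * g + 2 * Real.pi * x * (A * U) := by ring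
        rw [e, Real.exp_add, Real.exp_add, Real.exp_add]; ring
      rw [this]
      refine mul_le_mul_of_nonneg_left (Real.exp_le_exp.2 ?_) (by positivity)
      calc _ ≤ 2 * Real.pi * x * ρ₁ := mul_le_mul_of_nonneg_left hgap (by positivity)
        _ = _ := by ring
    unfold weight
    calc _ = Real.exp (2 * Real.pi * ρ * x) * (Real.exp (‖b m‖ * B) *
          ((‖b m‖ * U) ^ 2 * Real.exp (‖b m‖ * U))) * r ^ m.2 := by ring
      _ ≤ Real.exp (2 * Real.pi * ρ * x) * (Real.exp (2 * Real.pi * x * (A * B)) *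
          (2 * (A * U / g) ^ 2 * Real.exp (2 * Real.pi * x * g)
            * Real.exp (2 * Real.pi * x * (A * U)))) * r ^ m.2 := by gcongr
      _ ≤ 2 * (A * U / g) ^ 2 * Real.exp (2 * Real.pi * ρ₁ * x) * r ^ m.2 := by gcongr
      _ = _ := by ring
  · have hz1 : η + (h η ε + u η ε) • toC α ∈ closedStrip d ρ₁ := by
      refine closedStrip_mono ?_ (add_smul_mem_closedStrip hA hη
        ((norm_add_le _ _).trans (add_le_add (hh.norm_le hη hε) (hu.norm_le hη hε))))
      linarith
    have hz2 : η + h η ε • toC α ∈ closedStrip d (ρ₁ - g) := by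
      refine closedStrip_mono ?_ (add_smul_mem_closedStrip hA hη (hh.norm_le hη hε))
      nlinarith
    have e1 := hV.hasSum _ hz1 ε hε
    have e2 := hV.hasSum _ (closedStrip_mono (by linarith) hz2) ε hε
    have e3 := (hV.derivSeries hA hA0.le hr.le hg).hasSum _ hz2 ε hε
    refine ((e1.sub e2).sub (e3.mul_left (u η ε))).congr_fun fun m => ?_
    simp only [monom_add_smul, derivCoeff, mul_add, Complex.exp_add, b]
    ring

lemma Wiener.one_add_ne_zero (hf : Wiener ρ r f M) (hM : M < 1) {η : Fin d → ℂ}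
    (hη : η ∈ closedStrip d ρ) {ε : ℂ} (hε : ‖ε‖ ≤ r) : 1 + f η ε ≠ 0 := by
  intro h0
  have h1 : f η ε = -1 := by linear_combination h0
  have h2 := hf.norm_le hη hε
  rw [h1, norm_neg, norm_one] at h2
  linarith

lemma Wiener.inv_one_add (hρ : 0 ≤ ρ) (hr : 0 < r) (hf : Wiener ρ r f M) (hM : M < 1) :
    Wiener ρ r (fun η ε => (1 + f η ε)⁻¹) (1 - M)⁻¹ := by
  refine hf.powerSeries (a := fun n => (-1) ^ n) hρ hr ?_ fun η hη ε hε => ?_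
  · simpa using hasSum_geometric_of_lt_one (hf.nonneg hr.le) hM
  · have h1 : ‖-f η ε‖ < 1 := by rw [norm_neg]; exact (hf.norm_le hη hε).trans_lt hM
    have := hasSum_geometric_of_norm_lt_one h1
    rw [sub_neg_eq_add] at this
    refine this.congr_fun fun n => ?_
    rw [← mul_pow, neg_one_mul]

lemma Wiener.inv_one_add_sub_one (hρ : 0 ≤ ρ) (hr : 0 < r) (hf : Wiener ρ r f M) (hM : M < 1) :
    Wiener ρ r (fun η ε => (1 + f η ε)⁻¹ - 1) (M * (1 - M)⁻¹) := by
  refine ((hf.neg hρ hr).mul hρ hr (hf.inv_one_add hρ hr hM)).congr fun η hη ε hε => ?_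
  have := hf.one_add_ne_zero hM hη hε
  field_simp
  ring

/-- Solution of the linearized hull equation, up to the factor `1 + p`. -/
lemma exists_linear_solution {s : Fin d → ℝ} {κ : ℝ} {n : ℕ} (hs : SmallDivisors s κ n)
    (hκ : 0 < κ) (hr : 0 < r) (hσ : 0 < σ) (hρσ : 0 ≤ ρ - 2 * σ) {p : (Fin d → ℂ) → ℂ → ℂ}
    (hp : Wiener ρ r p (1 / 8)) (hp0 : ∀ ε : ℂ, ‖ε‖ ≤ r → avg p ε = 0) {F : ℝ}
    (hf : Wiener ρ r f F) :
    ∃ (u : (Fin d → ℂ) → ℂ → ℂ) (k : ℂ → ℂ),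
      Wiener (ρ - 2 * σ) r u (26 * (n.factorial / κ / σ ^ n) ^ 2 * F) ∧
      Wiener (d := d) ρ r (fun _ ε => k ε) (2 * F) ∧
      (∀ ε : ℂ, ‖ε‖ ≤ r → avg u ε = 0) ∧
      ∀ η ∈ closedStrip d (ρ - 2 * σ), ∀ ε : ℂ, ‖ε‖ ≤ r →
        (1 + p η ε) * (u (η + toC s) ε + u (η + toC (-s)) ε - 2 * u η ε)
          - u η ε * (p (η + toC s) ε + p (η + toC (-s)) ε - 2 * p η ε)
          = (1 + p η ε) * (f η ε - k ε) := by
  have hρ : 0 ≤ ρ := by linarith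
  have hρ1 : 0 ≤ ρ - σ := by linarith
  have hF := hf.nonneg hr.le
  set Λ : ℝ := n.factorial / κ / σ ^ n
  have hΛ : 0 ≤ Λ := by positivity
  set L : (Fin d → ℂ) → ℂ → ℂ := fun η ε => 1 + p η ε
  have hL : Wiener ρ r L (9 / 8) :=
    ((Wiener.const (1 : ℂ) hr).add hr.le hp).mono_right (by norm_num)
  have hone : Wiener (d := d) ρ r (fun _ _ => (1 : ℂ)) 1 :=
    (Wiener.const (1 : ℂ) hr).mono_right (by norm_num)
  have hL1 : ∀ ε : ℂ, ‖ε‖ ≤ r → avg L ε = 1 := fun ε hε => by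
    have := hone.avg_add hρ hr.le hp hε
    rw [hp0 ε hε, avg_const (fun _ => 1), add_zero] at this
    exact this
  set k : ℂ → ℂ := fun ε => avg (fun η ε => L η ε * f η ε) ε
  have hk : Wiener (d := d) ρ r (fun _ ε => k ε) (9 / 8 * F) := (hL.mul hρ hr hf).avg hρ hr.le
  set G : (Fin d → ℂ) → ℂ → ℂ := fun η ε => L η ε * (f η ε - k ε)
  have hG : Wiener ρ r G (5 / 2 * F) :=
    (hL.mul hρ hr (hf.sub hρ hr hk)).mono_right (by linarith)
  have hG0 : ∀ ε : ℂ, ‖ε‖ ≤ r → avg G ε = 0 := fun ε hε => by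
    have h1 := (hL.mul hρ hr hf).avg_sub hρ hr (hk.mul hρ hr hL) hε
    have h2 : avg G ε = avg (fun η ε => L η ε * f η ε - k ε * L η ε) ε :=
      avg_congr fun x => by simp only [G]; ring
    rw [h2, h1, avg_mul_left, hL1 ε hε, mul_one, sub_self]
  obtain ⟨b₀, hb₀, -, hb₀e⟩ := hG.exists_cohomology hs hκ hr.le hσ hρ1
  set b : (Fin d → ℂ) → ℂ → ℂ := fun η ε => b₀ (η + toC (-s)) ε
  have hb : Wiener (ρ - σ) r b (5 / 2 * (Λ * F)) := (hb₀.translate (-s)).mono_right (by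
    simp only [Λ]; exact le_of_eq (by ring))
  set q : (Fin d → ℂ) → ℂ → ℂ :=
    fun η ε => p η ε + p (η + toC (-s)) ε + p η ε * p (η + toC (-s)) ε
  have hq : Wiener ρ r q (17 / 64) :=
    ((hp.add hr.le (hp.translate (-s))).add hr.le (hp.mul hρ hr (hp.translate (-s)))).mono_right
      (by norm_num)
  have hqL : ∀ η ε, 1 + q η ε = L η ε * L (η + toC (-s)) ε := fun η ε => by
    simp only [q, L]; ring
  set i : (Fin d → ℂ) → ℂ → ℂ := fun η ε => (1 + q η ε)⁻¹
  have hi : Wiener (ρ - σ) r i (64 / 47) :=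
    ((hq.inv_one_add hρ hr (by norm_num)).mono_right (by norm_num)).mono (by linarith) hr.le le_rfl
  have hi1 : Wiener (ρ - σ) r (fun η ε => i η ε - 1) (17 / 47) :=
    ((hq.inv_one_add_sub_one hρ hr (by norm_num)).mono_right (by norm_num)).mono
      (by linarith) hr.le le_rfl
  have hi1a := hi1.avg hρ1 hr.le
  have hone' : Wiener (d := d) (ρ - σ) r (fun _ _ => (1 : ℂ)) 1 :=
    hone.mono (by linarith) hr.le le_rfl
  have hia : ∀ ε : ℂ, ‖ε‖ ≤ r → 1 + avg (fun η ε => i η ε - 1) ε = avg i ε := fun ε hε => by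
    rw [hi.avg_sub hρ1 hr hone' hε, avg_const (fun _ => 1)]; ring
  set κ₁ : ℂ → ℂ := fun ε =>
    -avg (fun η ε => b η ε * i η ε) ε * (1 + avg (fun η ε => i η ε - 1) ε)⁻¹
  have hκ₁ : Wiener (d := d) (ρ - σ) r (fun _ ε => κ₁ ε) (16 / 3 * (Λ * F)) :=
    ((((hb.mul hρ1 hr hi).avg hρ1 hr.le).neg hρ1 hr).mul hρ1 hr
      (hi1a.inv_one_add hρ1 hr (by norm_num))).mono_right (le_of_eq (by ring))
  set y : (Fin d → ℂ) → ℂ → ℂ := fun η ε => (b η ε + κ₁ ε) * i η ε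
  have hy : Wiener (ρ - σ) r y (32 / 3 * (Λ * F)) :=
    ((hb.add hr.le hκ₁).mul hρ1 hr hi).mono_right (le_of_eq (by ring))
  have hy0 : ∀ ε : ℂ, ‖ε‖ ≤ r → avg y ε = 0 := fun ε hε => by
    have h1 := (hb.mul hρ1 hr hi).avg_add hρ1 hr.le (hκ₁.mul hρ1 hr hi) hε
    have h2 : avg y ε = avg (fun η ε => b η ε * i η ε + κ₁ ε * i η ε) ε :=
      avg_congr fun x => by simp only [y]; ring
    have h3 := hi1a.one_add_ne_zero (by norm_num) (toC_mem_closedStrip hρ1 0) hε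
    rw [h2, h1, avg_mul_left, ← hia ε hε]
    simp only [κ₁]
    field_simp
    ring
  obtain ⟨v₀, hv₀, -, hv₀e⟩ := hy.exists_cohomology hs hκ hr.le hσ (by linarith)
  have h2σ : ρ - σ - σ = ρ - 2 * σ := by ring
  rw [h2σ] at hv₀ hv₀e
  have hv₀' : Wiener (ρ - 2 * σ) r v₀ (32 / 3 * (Λ ^ 2 * F)) :=
    hv₀.mono_right (by simp only [Λ]; exact le_of_eq (by ring))
  have hL' : Wiener (ρ - 2 * σ) r L (9 / 8) := hL.mono (by linarith) hr.le le_rfl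
  set w : ℂ → ℂ := fun ε => avg (fun η ε => L η ε * v₀ η ε) ε
  have hw : Wiener (d := d) (ρ - 2 * σ) r (fun _ ε => w ε) (12 * (Λ ^ 2 * F)) :=
    ((hL'.mul hρσ hr hv₀').avg hρσ hr.le).mono_right (le_of_eq (by ring))
  refine ⟨fun η ε => L η ε * (v₀ η ε - w ε), k, ?_, hk.mono_right (by linarith), fun ε hε => ?_,
    fun η hη ε hε => ?_⟩
  · refine (hL'.mul hρσ hr (hv₀'.sub hρσ hr hw)).mono_right ?_
    have : 0 ≤ Λ ^ 2 * F := by positivity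
    linarith
  · have h1 := (hL'.mul hρσ hr hv₀').avg_sub hρσ hr (hw.mul hρσ hr hL') hε
    have h2 : avg (fun η ε => L η ε * (v₀ η ε - w ε)) ε
        = avg (fun η ε => L η ε * v₀ η ε - w ε * L η ε) ε := avg_congr fun x => by ring
    rw [h2, h1, avg_mul_left, hL1 ε hε, mul_one, sub_self]
  · have hcancel : η + toC s + toC (-s) = η := by rw [toC_neg]; abel
    have hηs := add_toC_mem_closedStrip hη s
    have sub1 : closedStrip d (ρ - 2 * σ) ⊆ closedStrip d (ρ - σ) := closedStrip_mono (by linarith)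
    have sub2 : closedStrip d (ρ - 2 * σ) ⊆ closedStrip d ρ := closedStrip_mono (by linarith)
    have a1 := hv₀e η hη ε hε
    have a2 := hv₀e _ hηs ε hε
    have a3 := hb₀e η (sub1 hη) ε hε
    rw [hy0 ε hε, sub_zero] at a1 a2
    rw [hG0 ε hε, sub_zero] at a3
    rw [hcancel] at a2
    have n1 := hq.one_add_ne_zero (by norm_num) (sub2 hη) hε
    have n2 := hq.one_add_ne_zero (by norm_num) (sub2 hηs) hε
    have i1 : (L η ε * L (η + toC (-s)) ε) * i η ε = 1 := by
      rw [← hqL]; exact mul_inv_cancel₀ n1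
    have i2 : (L (η + toC s) ε * L η ε) * i (η + toC s) ε = 1 := by
      have := hqL (η + toC s) ε
      rw [hcancel] at this
      rw [← this]; exact mul_inv_cancel₀ n2
    have b1 : b (η + toC s) ε = b₀ η ε := by simp only [b, hcancel]
    have b2 : b η ε = b₀ (η + toC (-s)) ε := rfl
    have y1 : y η ε = (b₀ (η + toC (-s)) ε + κ₁ ε) * i η ε := rfl
    have y2 : y (η + toC s) ε = (b₀ η ε + κ₁ ε) * i (η + toC s) ε := by
      rw [← b1]
    have l0 : p η ε = L η ε - 1 := by simp only [L]; ring
    have l1 : p (η + toC s) ε = L (η + toC s) ε - 1 := by simp only [L]; ring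
    have l2 : p (η + toC (-s)) ε = L (η + toC (-s)) ε - 1 := by simp only [L]; ring
    have g1 : (1 + p η ε) * (f η ε - k ε) = G η ε := rfl
    rw [g1, l0, l1, l2, ← a3]
    rw [y1] at a1
    rw [y2] at a2
    linear_combination (L η ε * L (η + toC s) ε) * a2 - (L η ε * L (η + toC (-s)) ε) * a1
      + (b₀ η ε + κ₁ ε) * i2 - (b₀ (η + toC (-s)) ε + κ₁ ε) * i1

end Composition

/-! ### Newton iteration -/

section Newton

variable {ρ ρ₁ r σ A : ℝ} {V h p : (Fin d → ℂ) → ℂ → ℂ} {l : ℂ → ℂ} {c : (Fin d → ℤ) × ℕ → ℂ}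
  {S B P E κ : ℝ} {s α : Fin d → ℝ} {n : ℕ}

/-- The error in the hull equation. -/
def hullErr (s α : Fin d → ℝ) (V h : (Fin d → ℂ) → ℂ → ℂ) (l : ℂ → ℂ) (η : Fin d → ℂ) (ε : ℂ) : ℂ :=
  h (η + toC s) ε + h (η + toC (-s)) ε - 2 * h η ε + V (η + h η ε • toC α) ε + l ε

/-- An approximate solution `h`, `l` of the hull equation, with derivative `p = ∂_α h`. -/
structure Approx (s α : Fin d → ℝ) (V : (Fin d → ℂ) → ℂ → ℂ) (ρ r B P E : ℝ)
    (h p : (Fin d → ℂ) → ℂ → ℂ) (l : ℂ → ℂ) : Prop where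
  wiener : Wiener ρ r h B
  wiener_deriv : Wiener ρ r p P
  avg_eq : ∀ ε : ℂ, ‖ε‖ ≤ r → avg h ε = 0
  avg_deriv : ∀ ε : ℂ, ‖ε‖ ≤ r → avg p ε = 0
  hasDerivAt : ∀ η ∈ closedStrip d ρ, ∀ ε : ℂ, ‖ε‖ ≤ r →
    HasDerivAt (fun z : ℂ => h (η + z • toC α) ε) (p η ε) 0
  err : Wiener ρ r (hullErr s α V h l) E

lemma hasDerivAt_comp_along {f V : (Fin d → ℂ) → ℂ} {η : Fin d → ℂ} {f' V' : ℂ}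
    (hf : HasDerivAt (fun z : ℂ => f (η + z • toC α)) f' 0)
    (hV : HasDerivAt (fun z : ℂ => V (η + f η • toC α + z • toC α)) V' 0) :
    HasDerivAt (fun z : ℂ => V (η + z • toC α + f (η + z • toC α) • toC α)) ((1 + f') * V') 0 := by
  have h1 : HasDerivAt (fun z : ℂ => z + (f (η + z • toC α) - f η)) (1 + f') 0 :=
    (hasDerivAt_id (0 : ℂ)).add (hf.sub_const (f η))
  have h0 : (0 : ℂ) + (f (η + (0 : ℂ) • toC α) - f η) = 0 := by simp
  have h2 : HasDerivAt (fun z : ℂ => V (η + f η • toC α + z • toC α)) V'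
      ((0 : ℂ) + (f (η + (0 : ℂ) • toC α) - f η)) := by rw [h0]; exact hV
  have h3 := HasDerivAt.comp (0 : ℂ) h2 h1
  rw [mul_comm] at h3
  convert! h3 using 1
  ext z
  simp only [Function.comp]
  congr 1
  rw [add_smul, sub_smul]; abel

lemma hasDerivAt_hullErr (hA : ∀ i, |α i| ≤ A) (hA0 : 0 < A) (hr : 0 ≤ r)
    (hV : HasCoeff ρ₁ r V c) {g : ℝ} (hg : 0 < g) {ε : ℂ} (hε : ‖ε‖ ≤ r) {η : Fin d → ℂ}
    (hη : η ∈ closedStrip d ρ)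
    (hd : ∀ η ∈ closedStrip d ρ, HasDerivAt (fun z : ℂ => h (η + z • toC α) ε) (p η ε) 0)
    (hh : ‖h η ε‖ ≤ B) (hgap : ρ + A * B + g ≤ ρ₁) :
    HasDerivAt (fun z : ℂ => hullErr s α V h l (η + z • toC α) ε)
      (p (η + toC s) ε + p (η + toC (-s)) ε - 2 * p η ε
        + (1 + p η ε) * derivSeries α c (η + h η ε • toC α) ε) 0 := by
  have hmem : η + h η ε • toC α ∈ closedStrip d (ρ₁ - g) :=
    closedStrip_mono (by linarith) (add_smul_mem_closedStrip hA hη hh)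
  have h1 := hd _ (add_toC_mem_closedStrip hη s)
  have h2 := hd _ (add_toC_mem_closedStrip hη (-s))
  have h3 := hd _ hη
  have h4 := hasDerivAt_comp_along (f := fun η => h η ε) (V := fun η => V η ε) h3
    (hV.hasDerivAt hA hA0 hr hg hmem hε)
  have h5 := (((h1.add h2).sub (h3.const_mul 2)).add h4).add_const (l ε)
  convert! h5 using 1
  ext z
  simp only [hullErr, Pi.add_apply, Pi.sub_apply, add_right_comm η]

/-- One step of Newton's method. -/
lemma Approx.newton_step (happ : Approx s α V ρ r B P E h p l) (hs : SmallDivisors s κ n)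
    (hκ : 0 < κ) (hA : ∀ i, |α i| ≤ A) (hA0 : 0 < A) (hr : 0 < r) (hσ : 0 < σ)
    (hρσ : 0 ≤ ρ - 3 * σ) (hV : HasCoeff ρ₁ r V c) (hS : ∑' m, ‖c m‖ * weight ρ₁ r m ≤ S)
    (hP : P ≤ 1 / 8) {g U : ℝ} (hg : 0 < g) (hU : U = 26 * (n.factorial / κ / σ ^ n) ^ 2 * E)
    (hgap : ρ + A * (B + U) + g ≤ ρ₁) :
    ∃ (h' p' : (Fin d → ℂ) → ℂ → ℂ) (l' : ℂ → ℂ),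
      Approx s α V (ρ - 3 * σ) r (B + U) (P + A / σ * U)
        (8 / 7 * U * (A / σ * E) + 2 * (A * U / g) ^ 2 * S) h' p' l' ∧
      Wiener (ρ - 3 * σ) r (fun η ε => h' η ε - h η ε) U ∧
      Wiener (d := d) (ρ - 3 * σ) r (fun _ ε => l' ε - l ε) (2 * E) := by
  have hρ : 0 ≤ ρ := by linarith
  have hE := happ.err.nonneg hr.le
  have hp8 := happ.wiener_deriv.mono_right hP
  obtain ⟨u, k, hu, hk, hu0, hue⟩ := exists_linear_solution hs hκ hr hσ (by linarith) hp8
    happ.avg_deriv (happ.err.neg hρ hr)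
  rw [← hU] at hu
  have hU0 := hu.nonneg hr.le
  have h3σ : ρ - 2 * σ - σ = ρ - 3 * σ := by ring
  obtain ⟨du, hdu, hdu0, hdue⟩ := hu.exists_deriv hA hA0 hr.le hσ (by linarith)
  rw [h3σ] at hdu hdue
  obtain ⟨e', he', -, hee⟩ := happ.err.exists_deriv hA hA0 hr.le hσ (by linarith)
  have s3 : closedStrip d (ρ - 3 * σ) ⊆ closedStrip d ρ := closedStrip_mono (by linarith)
  have s32 : closedStrip d (ρ - 3 * σ) ⊆ closedStrip d (ρ - 2 * σ) := closedStrip_mono (by linarith)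
  have s31 : closedStrip d (ρ - 3 * σ) ⊆ closedStrip d (ρ - σ) := closedStrip_mono (by linarith)
  have hh3 : Wiener (ρ - 3 * σ) r h B := happ.wiener.mono (by linarith) hr.le le_rfl
  have hp3 : Wiener (ρ - 3 * σ) r p P := happ.wiener_deriv.mono (by linarith) hr.le le_rfl
  have hu3 : Wiener (ρ - 3 * σ) r u U := hu.mono (by linarith) hr.le le_rfl
  have he3 : Wiener (ρ - 3 * σ) r e' (A / σ * E) := he'.mono (by linarith) hr.le le_rfl
  refine ⟨fun η ε => h η ε + u η ε, fun η ε => p η ε + du η ε, fun ε => l ε + k ε,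
    ⟨hh3.add hr.le hu3, hp3.add hr.le hdu, fun ε hε => ?_, fun ε hε => ?_, fun η hη ε hε => ?_, ?_⟩,
    by simpa using hu3, by simpa using hk.mono (by linarith) hr.le le_rfl⟩
  · rw [hh3.avg_add hρσ hr.le hu3 hε, happ.avg_eq ε hε, hu0 ε hε, add_zero]
  · rw [hp3.avg_add hρσ hr.le hdu hε, happ.avg_deriv ε hε, hdu0 ε hε, add_zero]
  · exact (happ.hasDerivAt η (s3 hη) ε hε).add (hdue η hη ε hε)
  · have hQ := Wiener.remainder hA hA0 hρσ hr hV hS hh3 hu3 hg (by linarith)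
    have hinv := (hp8.mono (ρ' := ρ - 3 * σ) (by linarith) hr.le le_rfl).inv_one_add hρσ hr
      (by norm_num)
    refine ((((hinv.mul hρσ hr hu3).mul hρσ hr he3).add hr.le hQ).mono_right
      (le_of_eq ?_)).congr fun η hη ε hε => ?_
    · norm_num
    · have hne := hp8.one_add_ne_zero (by norm_num) (s3 hη) hε
      have h1 := hue η (s32 hη) ε hε
      have hgap' : ρ + A * B + g ≤ ρ₁ := by nlinarith
      have h2 := (hee η (s31 hη) ε hε).unique (hasDerivAt_hullErr hA hA0 hr.le hV hg hε (s3 hη)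
        (fun η hη => happ.hasDerivAt η hη ε hε) (happ.wiener.norm_le (s3 hη) hε) hgap')
      rw [h2]
      refine mul_left_cancel₀ hne ?_
      rw [mul_add (1 + p η ε), ← mul_assoc (1 + p η ε), ← mul_assoc (1 + p η ε),
        mul_inv_cancel₀ hne, one_mul]
      simp only [hullErr, QPLindstedt.remainder] at h1 ⊢
      linear_combination h1

end Newton

/-! ### Convergence of the iteration -/

section Convergence

variable {ρ ρ₁ r A : ℝ} {V : (Fin d → ℂ) → ℂ → ℂ} {c : (Fin d → ℤ) × ℕ → ℂ}
  {κ β : ℝ} {s α : Fin d → ℝ} {N : ℕ}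

/-- Geometrically convergent approximate solutions converge to a solution. -/
lemma exists_solution_of_approx {h p : ℕ → (Fin d → ℂ) → ℂ → ℂ} {l : ℕ → ℂ → ℂ}
    {B P E ρs : ℕ → ℝ} {K : ℝ} (hρ : 0 ≤ ρ) (hr : 0 < r) (hA : ∀ i, |α i| ≤ A) (hA0 : 0 < A)
    (hV : HasCoeff ρ₁ r V c) (hgap : ρ + A * β < ρ₁) (hρs : ∀ n, ρ ≤ ρs n)
    (happ : ∀ n, Approx s α V (ρs n) r (B n) (P n) (E n) (h n) (p n) (l n))
    (hh : ∀ n, Wiener ρ r (fun η ε => h (n + 1) η ε - h n η ε) (β / 2 * (1 / 2) ^ n))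
    (hl : ∀ n, Wiener (d := d) ρ r (fun _ ε => l (n + 1) ε - l n ε) (K * (1 / 2) ^ n))
    (h0 : ∀ η ε, h 0 η ε = 0) (l0 : ∀ ε, l 0 ε = 0)
    (hE : Filter.Tendsto E Filter.atTop (nhds 0)) :
    ∃ (H : (Fin d → ℂ) → ℂ → ℂ) (L : ℂ → ℂ), Wiener ρ r H β ∧
      Wiener (d := d) ρ r (fun _ ε => L ε) (K * 2) ∧ (∀ ε : ℂ, ‖ε‖ ≤ r → avg H ε = 0) ∧
      ∀ η ∈ closedStrip d ρ, ∀ ε : ℂ, ‖ε‖ ≤ r → hullErr s α V H L η ε = 0 := by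
  have hβ : 0 ≤ β := by
    have := (hh 0).nonneg hr.le
    rw [pow_zero] at this; linarith
  have geo : ∀ n, HasSum (fun i : ℕ => β / 2 * (1 / 2) ^ (n + i)) (β * (1 / 2) ^ n) := fun n => by
    have := hasSum_geometric_two.mul_left (β / 2 * (1 / 2) ^ n)
    have e : β / 2 * (1 / 2) ^ n * 2 = β * (1 / 2) ^ n := by ring
    rw [e] at this
    exact this.congr_fun fun i => by rw [pow_add]; ring
  set H : (Fin d → ℂ) → ℂ → ℂ := fun η ε => ∑' n, (h (n + 1) η ε - h n η ε)
  set L : ℂ → ℂ := fun ε => ∑' n, (l (n + 1) ε - l n ε)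
  have hsum : ∀ η ∈ closedStrip d ρ, ∀ ε : ℂ, ‖ε‖ ≤ r →
      HasSum (fun n => h (n + 1) η ε - h n η ε) (H η ε) := fun η hη ε hε => by
    have g0 := (geo 0).summable
    simp only [zero_add] at g0
    exact (Summable.of_norm_bounded g0 fun n => (hh n).norm_le hη hε).hasSum
  have hsuml : ∀ ε : ℂ, ‖ε‖ ≤ r → HasSum (fun n => l (n + 1) ε - l n ε) (L ε) := fun ε hε =>
    (Summable.of_norm_bounded (summable_geometric_two.mul_left K)
      fun n => (hl n).norm_le (toC_mem_closedStrip hρ 0) hε).hasSum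
  have htail : ∀ n, ∀ η ∈ closedStrip d ρ, ∀ ε : ℂ, ‖ε‖ ≤ r →
      HasSum (fun i => h (n + i + 1) η ε - h (n + i) η ε) (H η ε - h n η ε) :=
    fun n η hη ε hε => by
      have h1 := (hasSum_nat_add_iff' n).2 (hsum η hη ε hε)
      rw [Finset.sum_range_sub (fun n => h n η ε), h0, sub_zero] at h1
      exact h1.congr_fun fun i => by rw [add_comm n i]
  have hdiff : ∀ n, Wiener ρ r (fun η ε => H η ε - h n η ε) (β * (1 / 2) ^ n) := fun n =>
    Wiener.hasSum hr (fun i => hh (n + i)) (geo n) (htail n)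
  have hH : Wiener ρ r H β := by
    simpa [h0] using hdiff 0
  refine ⟨H, L, hH, Wiener.hasSum hr hl (hasSum_geometric_two.mul_left K) fun η _ ε hε =>
    hsuml ε hε, fun ε hε => ?_, fun η hη ε hε => ?_⟩
  · have hle : ∀ n : ℕ, ‖avg H ε‖ ≤ β * (1 / 2) ^ n := fun n => by
      have h1 := ((hdiff n).avg hρ hr.le).norm_le (toC_mem_closedStrip hρ 0) hε
      have h2 := hH.avg_sub hρ hr ((happ n).wiener.mono (hρs n) hr.le le_rfl) hε
      rw [(happ n).avg_eq ε hε, sub_zero] at h2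
      rwa [h2] at h1
    have hlim : Filter.Tendsto (fun n : ℕ => β * (1 / 2) ^ n) Filter.atTop (nhds 0) := by
      simpa using (tendsto_pow_atTop_nhds_zero_of_lt_one (r := (1 / 2 : ℝ)) (by norm_num)
        (by norm_num)).const_mul β
    exact norm_le_zero_iff.1 (ge_of_tendsto' hlim hle)
  · have th : ∀ η ∈ closedStrip d ρ,
        Filter.Tendsto (fun n => h n η ε) Filter.atTop (nhds (H η ε)) := fun η hη => by
      have := (hsum η hη ε hε).tendsto_sum_nat
      simpa only [Finset.sum_range_sub (fun n => h n η ε), h0, sub_zero] using this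
    have tl : Filter.Tendsto (fun n => l n ε) Filter.atTop (nhds (L ε)) := by
      have := (hsuml ε hε).tendsto_sum_nat
      simpa only [Finset.sum_range_sub (fun n => l n ε), l0, sub_zero] using this
    have hcV : ContinuousAt (fun z : ℂ => V (η + z • toC α) ε) (H η ε) := by
      have hmem := add_smul_mem_closedStrip hA hη (hH.norm_le hη hε)
      have h1 := (hV.hasDerivAt hA hA0 hr.le (σ := ρ₁ - (ρ + A * β)) (by linarith)
        (η := η + H η ε • toC α) (by simpa using hmem) hε).continuousAt
      have h2 : ContinuousAt (fun z : ℂ => z - H η ε) (H η ε) := by fun_prop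
      have h3 := ContinuousAt.comp (x := H η ε) (f := fun z : ℂ => z - H η ε)
        (g := fun z : ℂ => V (η + H η ε • toC α + z • toC α) ε) (by simpa using h1) h2
      convert! h3 using 1
      ext z
      simp only [Function.comp]
      congr 1
      rw [sub_smul]; abel
    have t1 : Filter.Tendsto (fun n => hullErr s α V (h n) (l n) η ε) Filter.atTop
        (nhds (hullErr s α V H L η ε)) :=
      (((((th _ (add_toC_mem_closedStrip hη s)).add (th _ (add_toC_mem_closedStrip hη (-s)))).sub
        ((th η hη).const_mul 2)).add (hcV.tendsto.comp (th η hη))).add tl)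
    refine tendsto_nhds_unique t1 (squeeze_zero_norm (fun n => ?_) hE)
    exact (happ n).err.norm_le (closedStrip_mono (hρs n) hη) hε

/-- The sequence of widths in the iteration. -/
def width (ρ σ : ℝ) (n : ℕ) : ℝ := ρ + 6 * (σ / 2 ^ n)

lemma width_succ (ρ σ : ℝ) (n : ℕ) : width ρ σ n - 3 * (σ / 2 ^ n) = width ρ σ (n + 1) := by
  unfold width; rw [pow_succ]; field_simp; ring

lemma le_width {σ : ℝ} (hσ : 0 ≤ σ) (n : ℕ) : ρ ≤ width ρ σ n := by
  unfold width; have : 0 ≤ σ / 2 ^ n := by positivity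
  linarith

lemma width_le {σ : ℝ} (hσ : 0 ≤ σ) (n : ℕ) : width ρ σ n ≤ ρ + 6 * σ := by
  unfold width
  have : σ / 2 ^ n ≤ σ := div_le_self hσ (one_le_pow₀ (by norm_num))
  linarith

/-- The small divisor constant along the iteration. -/
lemma factorial_div_width (κ σ : ℝ) (N n : ℕ) (hσ : σ ≠ 0) :
    N.factorial / κ / (σ / 2 ^ n) ^ N = N.factorial / κ / σ ^ N * (2 ^ N) ^ n := by
  rw [div_pow, ← pow_mul, ← pow_mul, mul_comm n N]
  field_simp

/-- Existence of an exact solution for a small interaction. -/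
theorem exists_hull_solution (hs : SmallDivisors s κ N) (hκ : 0 < κ) (hA : ∀ i, |α i| ≤ A)
    (hA0 : 0 < A) (hρ : 0 < ρ) (hρ₁ : ρ < ρ₁) (hβ : 0 < β) :
    ∃ ε₀ : ℝ, 0 < ε₀ ∧ ∀ (r : ℝ) (V : (Fin d → ℂ) → ℂ → ℂ) (c : (Fin d → ℤ) × ℕ → ℂ), 0 < r →
      HasCoeff ρ₁ r V c → ∑' m, ‖c m‖ * weight ρ₁ r m ≤ ε₀ →
      ∃ (H : (Fin d → ℂ) → ℂ → ℂ) (L : ℂ → ℂ), Wiener ρ r H β ∧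
        (∃ K, Wiener (d := d) ρ r (fun _ ε => L ε) K) ∧ (∀ ε : ℂ, ‖ε‖ ≤ r → avg H ε = 0) ∧
        ∀ η ∈ closedStrip d ρ, ∀ ε : ℂ, ‖ε‖ ≤ r → hullErr s α V H L η ε = 0 := by
  set g := (ρ₁ - ρ) / 4
  have hg : 0 < g := by simp only [g]; linarith
  set σ := g / 6
  have hσ : 0 < σ := by positivity
  set b := min β (g / A)
  have hb : 0 < b := by positivity
  have hbA : A * b ≤ g := by
    calc A * b ≤ A * (g / A) := mul_le_mul_of_nonneg_left (min_le_right _ _) hA0.le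
      _ = g := by field_simp
  set T : ℝ := 2 ^ N
  have hT : 1 ≤ T := one_le_pow₀ (by norm_num)
  set y : ℝ := (2 * T ^ 2)⁻¹
  have hy : 0 < y := by positivity
  have hyT : 2 * T ^ 2 * y = 1 := mul_inv_cancel₀ (by positivity)
  have hy2 : y ≤ 1 / 2 := by
    have h1 : y * 1 ≤ y * T ^ 2 := mul_le_mul_of_nonneg_left (one_le_pow₀ hT) hy.le
    linarith
  set K := 26 * (N.factorial / κ / σ ^ N) ^ 2
  have hK : 0 < K := by positivity
  set C := 8 / 7 * K * (A / σ) + 2 * (A / g) ^ 2 * K ^ 2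
  have hC : 0 < C := by positivity
  obtain ⟨ε₀, hε₀, e1, e2, e3, e4⟩ : ∃ ε₀ : ℝ, 0 < ε₀ ∧ K * ε₀ ≤ b / 2 ∧
      A / σ * K * ε₀ ≤ 1 / 16 ∧ C * ε₀ ≤ y ^ 2 ∧ ε₀ ≤ 1 := by
    refine ⟨min (min (b / 2 / K) (1 / 16 / (A / σ * K))) (min (y ^ 2 / C) 1), by positivity,
      ?_, ?_, ?_, ?_⟩
    · rw [← le_div_iff₀' hK]; exact (min_le_left _ _).trans (min_le_left _ _)
    · rw [← le_div_iff₀' (by positivity)]; exact (min_le_left _ _).trans (min_le_right _ _)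
    · rw [← le_div_iff₀' hC]; exact (min_le_right _ _).trans (min_le_left _ _)
    · exact (min_le_right _ _).trans (min_le_right _ _)
  refine ⟨ε₀, hε₀, fun r V c hr hV hS => ?_⟩
  set P : ℕ → ((Fin d → ℂ) → ℂ → ℂ) × ((Fin d → ℂ) → ℂ → ℂ) × (ℂ → ℂ) → Prop := fun n x =>
    Approx s α V (width ρ σ n) r (b * (1 - (1 / 2) ^ n)) (1 / 8 * (1 - (1 / 2) ^ n))
      (ε₀ * (y ^ n) ^ 2) x.1 x.2.1 x.2.2
  have hstep : ∀ n x, P n x → ∃ x', P (n + 1) x' ∧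
      Wiener ρ r (fun η ε => x'.1 η ε - x.1 η ε) (b / 2 * (1 / 2) ^ n) ∧
      Wiener (d := d) ρ r (fun _ ε => x'.2.2 ε - x.2.2 ε) (2 * ε₀ * (1 / 2) ^ n) := by
    intro n x hx
    have hσn : 0 < σ / 2 ^ n := by positivity
    have hyn : 0 < y ^ n := by positivity
    have hyn1 : y ^ n ≤ 1 := pow_le_one₀ hy.le (by linarith)
    have hyn2 : y ^ n ≤ (1 / 2) ^ n := pow_le_pow_left₀ hy.le hy2 n
    have h2n : (0 : ℝ) < 2 ^ n := by positivity
    have h2n1 : (1 : ℝ) ≤ 2 ^ n := one_le_pow₀ (by norm_num)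
    have hT2 : (2 : ℝ) ^ n * (T ^ n) ^ 2 * y ^ n = 1 := by
      rw [← pow_mul, mul_comm n 2, pow_mul, ← mul_pow, ← mul_pow, hyT, one_pow]
    set U := 26 * (N.factorial / κ / (σ / 2 ^ n) ^ N) ^ 2 * (ε₀ * (y ^ n) ^ 2) with hU
    have hU1 : 2 ^ n * U = K * ε₀ * y ^ n := by
      rw [hU, factorial_div_width κ σ N n hσ.ne']
      calc _ = K * ε₀ * y ^ n * (2 ^ n * (T ^ n) ^ 2 * y ^ n) := by simp only [K, T]; ring
        _ = _ := by rw [hT2, mul_one]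
    have hU0 : 0 ≤ U := by positivity
    have hU2 : 2 ^ n * U ≤ b / 2 * (1 / 2) ^ n := by
      rw [hU1]; exact mul_le_mul e1 hyn2 hyn.le (by positivity)
    have hU3 : U ≤ b / 2 * (1 / 2) ^ n := le_trans (le_mul_of_one_le_left hU0 h2n1) hU2
    have hU4 : U ≤ K * ε₀ * y ^ n := by
      rw [← hU1]; exact le_mul_of_one_le_left hU0 h2n1
    have hAU : A / (σ / 2 ^ n) * U = A / σ * (2 ^ n * U) := by field_simp
    have hAU2 : A / (σ / 2 ^ n) * U ≤ 1 / 16 * (1 / 2) ^ n := by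
      rw [hAU, hU1]
      calc A / σ * (K * ε₀ * y ^ n) = A / σ * K * ε₀ * y ^ n := by ring
        _ ≤ 1 / 16 * (1 / 2) ^ n := mul_le_mul e2 hyn2 hyn.le (by positivity)
    have hhalf : (0 : ℝ) < (1 / 2) ^ n := by positivity
    have hbU : b * (1 - (1 / 2) ^ n) + U ≤ b * (1 - (1 / 2) ^ (n + 1)) := by
      rw [pow_succ]; linarith
    have hgap : width ρ σ n + A * (b * (1 - (1 / 2) ^ n) + U) + g ≤ ρ₁ := by
      have w := width_le (ρ := ρ) hσ.le n
      have h1 : A * (b * (1 - (1 / 2) ^ n) + U) ≤ A * b := by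
        refine mul_le_mul_of_nonneg_left (hbU.trans ?_) hA0.le
        have : (0 : ℝ) < (1 / 2) ^ (n + 1) := by positivity
        nlinarith
      have h2 : 6 * σ = g := by simp only [σ]; ring
      have h3 : ρ₁ = ρ + 4 * g := by simp only [g]; ring
      linarith
    obtain ⟨h', p', l', h1, h2, h3⟩ := hx.newton_step hs hκ hA hA0 hr hσn
      (by rw [width_succ]; exact hρ.le.trans (le_width hσ.le _)) hV hS
      (by nlinarith) hg hU hgap
    rw [width_succ] at h1 h2 h3
    refine ⟨(h', p', l'), ⟨h1.wiener.mono_right hbU, h1.wiener_deriv.mono_right ?_, h1.avg_eq,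
      h1.avg_deriv, h1.hasDerivAt, h1.err.mono_right ?_⟩,
      (h2.mono (le_width hσ.le _) hr.le le_rfl).mono_right hU3,
      (h3.mono (le_width hσ.le _) hr.le le_rfl).mono_right ?_⟩
    · rw [pow_succ]; linarith
    · have f1 : 8 / 7 * U * (A / (σ / 2 ^ n) * (ε₀ * (y ^ n) ^ 2))
          ≤ 8 / 7 * K * (A / σ) * ε₀ * (ε₀ * (y ^ n) ^ 2) := by
        have : 8 / 7 * U * (A / (σ / 2 ^ n) * (ε₀ * (y ^ n) ^ 2))
            = 8 / 7 * (A / σ) * (ε₀ * (y ^ n) ^ 2) * (2 ^ n * U) := by field_simp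
        rw [this, hU1]
        calc _ = 8 / 7 * (A / σ) * (ε₀ * (y ^ n) ^ 2) * (K * ε₀) * y ^ n := by ring
          _ ≤ 8 / 7 * (A / σ) * (ε₀ * (y ^ n) ^ 2) * (K * ε₀) * 1 :=
              mul_le_mul_of_nonneg_left hyn1 (by positivity)
          _ = _ := by ring
      have f2 : 2 * (A * U / g) ^ 2 * ε₀ ≤ 2 * (A / g) ^ 2 * K ^ 2 * ε₀ * (ε₀ * (y ^ n) ^ 2) := by
        have h5 : U ^ 2 ≤ (K * ε₀ * y ^ n) ^ 2 := pow_le_pow_left₀ hU0 hU4 2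
        calc 2 * (A * U / g) ^ 2 * ε₀ = 2 * (A / g) ^ 2 * ε₀ * U ^ 2 := by ring
          _ ≤ 2 * (A / g) ^ 2 * ε₀ * (K * ε₀ * y ^ n) ^ 2 :=
              mul_le_mul_of_nonneg_left h5 (by positivity)
          _ = 2 * (A / g) ^ 2 * K ^ 2 * (ε₀ ^ 2 * (y ^ n) ^ 2) * ε₀ := by ring
          _ ≤ 2 * (A / g) ^ 2 * K ^ 2 * (ε₀ ^ 2 * (y ^ n) ^ 2) * 1 :=
              mul_le_mul_of_nonneg_left e4 (by positivity)
          _ = _ := by ring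
      calc _ ≤ 8 / 7 * K * (A / σ) * ε₀ * (ε₀ * (y ^ n) ^ 2)
            + 2 * (A / g) ^ 2 * K ^ 2 * ε₀ * (ε₀ * (y ^ n) ^ 2) := add_le_add f1 f2
        _ = C * ε₀ * (ε₀ * (y ^ n) ^ 2) := by simp only [C]; ring
        _ ≤ y ^ 2 * (ε₀ * (y ^ n) ^ 2) := mul_le_mul_of_nonneg_right e3 (by positivity)
        _ = _ := by rw [pow_succ]; ring
    · calc 2 * (ε₀ * (y ^ n) ^ 2) = 2 * ε₀ * (y ^ n * y ^ n) := by ring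
        _ ≤ 2 * ε₀ * (1 * (1 / 2) ^ n) :=
            mul_le_mul_of_nonneg_left (mul_le_mul hyn1 hyn2 hyn.le zero_le_one) (by positivity)
        _ = _ := by ring
  have hinit : P 0 (fun _ _ => 0, fun _ _ => 0, fun _ => 0) := by
    have hw : width ρ σ 0 ≤ ρ₁ := by
      have := width_le (ρ := ρ) hσ.le 0
      simp only [σ, g] at *; linarith
    have hz : Wiener (d := d) (width ρ σ 0) r (fun _ _ => (0 : ℂ)) 0 := by
      simpa using Wiener.const (d := d) (ρ := width ρ σ 0) (0 : ℂ) hr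
    refine ⟨by simpa using hz, by simpa using hz, fun ε _ => avg_const (fun _ => 0) ε,
      fun ε _ => avg_const (fun _ => 0) ε, fun η _ ε _ => hasDerivAt_const _ _, ?_⟩
    have h1 : Wiener (width ρ σ 0) r V ε₀ := Wiener.mono ⟨c, hV, hS⟩ hw hr.le le_rfl
    refine (h1.mono_right (by simp)).congr fun η _ ε _ => by simp [hullErr]
  choose! F hF using hstep
  set x : ℕ → ((Fin d → ℂ) → ℂ → ℂ) × ((Fin d → ℂ) → ℂ → ℂ) × (ℂ → ℂ) := fun n =>
    Nat.rec (fun _ _ => 0, fun _ _ => 0, fun _ => 0) F n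
  have hx : ∀ n, P n (x n) := fun n => by
    induction n with
    | zero => exact hinit
    | succ n ih => exact (hF n _ ih).1
  have hElim : Filter.Tendsto (fun n : ℕ => ε₀ * (y ^ n) ^ 2) Filter.atTop (nhds 0) := by
    simpa using ((tendsto_pow_atTop_nhds_zero_of_lt_one hy.le (by linarith)).pow 2).const_mul ε₀
  obtain ⟨H, L, r1, r2, r3, r4⟩ := exists_solution_of_approx (β := b) (K := 2 * ε₀) hρ.le hr hA hA0
    hV (by simp only [g] at hbA hg; linarith) (le_width hσ.le) hx (fun n => (hF n _ (hx n)).2.1)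
    (fun n => (hF n _ (hx n)).2.2) (fun _ _ => rfl) (fun _ => rfl) hElim
  exact ⟨H, L, r1.mono_right (min_le_left _ _), ⟨_, r2⟩, r3, r4⟩

end Convergence

/-! ### Invariant functions and local uniqueness -/

lemma hasSum_character_translate {C : (Fin d → ℤ) → ℂ} {f : (Fin d → ℂ) → ℂ}
    (hf : ∀ σ : Fin d → ℝ, HasSum (fun k => C k * character k (toC σ)) (f (toC σ)))
    (s σ : Fin d → ℝ) :
    HasSum (fun k => (C k * character k (toC s)) * character k (toC σ)) (f (toC σ + toC s)) := by
  have := hf (σ + s)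
  rw [toC_add] at this
  refine this.congr_fun fun k => ?_
  rw [character_add]; ring

/-- Functions invariant under a nonresonant translation are constant. -/
lemma eq_average_of_invariant {C : (Fin d → ℤ) → ℂ} (hC : Summable fun k => ‖C k‖)
    {f : (Fin d → ℂ) → ℂ}
    (hf : ∀ σ : Fin d → ℝ, HasSum (fun k => C k * character k (toC σ)) (f (toC σ)))
    {s : Fin d → ℝ} (hs : ∀ k : Fin d → ℤ, k ≠ 0 → character k (toC s) ≠ 1)
    (hinv : ∀ σ : Fin d → ℝ, f (toC σ + toC s) = f (toC σ)) (σ : Fin d → ℝ) :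
    f (toC σ) = average f := by
  have h1 : ∀ k, C k * character k (toC s) = C k := fun k => by
    have e1 := fourierCoef_of_hasSum (f := f) (c := fun k => C k * character k (toC s))
      (by simpa [norm_character_toC] using hC)
      (fun σ => by rw [← hinv]; exact hasSum_character_translate hf s σ) k
    rw [← e1, fourierCoef_of_hasSum hC hf]
  have h2 : ∀ k, k ≠ 0 → C k = 0 := fun k hk => by
    have h2 : C k * (character k (toC s) - 1) = 0 := by linear_combination h1 k
    exact (mul_eq_zero.1 h2).resolve_right (sub_ne_zero.2 (hs k hk))
  have h3 : ∀ σ : Fin d → ℝ, f (toC σ) = C 0 := fun σ => by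
    refine (hf σ).unique ?_
    have := hasSum_single (f := fun k => C k * character k (toC σ)) 0
      fun k hk => by simp [h2 k hk]
    simpa [character_zero] using this
  have h4 := average_hasSum (k := id) hC hf
  have h5 := hasSum_single (f := fun k => if id k = 0 then C k else 0) 0 fun k hk => by simp [hk]
  rw [h3, h4.unique h5]; simp

section Sections

variable {ρ ρ' r M : ℝ} {f : (Fin d → ℂ) → ℂ → ℂ} {c : (Fin d → ℤ) × ℕ → ℂ} {ε : ℂ}

/-- The Fourier coefficients in `η` of a function with coefficients `c`, at a fixed `ε`. -/
lemma HasCoeff.exists_fourier (hf : HasCoeff ρ r f c) (hε : ‖ε‖ ≤ r) :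
    ∃ C : (Fin d → ℤ) → ℂ,
      (Summable fun k => ‖C k‖ * Real.exp (2 * Real.pi * ρ * absZ k)) ∧
      ∑' k, ‖C k‖ * Real.exp (2 * Real.pi * ρ * absZ k) ≤ ∑' m, ‖c m‖ * weight ρ r m ∧
      ∀ η ∈ closedStrip d ρ, HasSum (fun k => C k * character k η) (f η ε) := by
  have hle : ∀ m : (Fin d → ℤ) × ℕ, ‖c m * ε ^ m.2‖ * Real.exp (2 * Real.pi * ρ * absZ m.1)
      ≤ ‖c m‖ * weight ρ r m := fun m => by
    rw [norm_mul, norm_pow, weight, mul_assoc, mul_comm (‖ε‖ ^ m.2)]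
    gcongr
  have hs := hf.summable.of_nonneg_of_le (fun m => by positivity) hle
  obtain ⟨h1, h2, h3⟩ := tsum_norm_fiber_le (fun m : (Fin d → ℤ) × ℕ => m.1)
    (a := fun m => c m * ε ^ m.2) (w := fun k => Real.exp (2 * Real.pi * ρ * absZ k)) (fun k => Real.exp_pos _) hs
  refine ⟨_, h2, h3.trans (hs.tsum_le_tsum hle hf.summable), fun η hη => ?_⟩
  have h4 : HasSum (fun m => c m * ε ^ m.2 * character m.1 η) (f η ε) :=
    (hf.hasSum η hη ε hε).congr_fun fun m => by simp only [monom]; ring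
  exact hasSum_fiber (fun m : (Fin d → ℤ) × ℕ => m.1) (a := fun m => c m * ε ^ m.2)
    (w := fun k => character k η) h4 fun k => (h1 k).of_norm

lemma Wiener.exists_fourier (hf : Wiener ρ r f M) (hε : ‖ε‖ ≤ r) :
    ∃ C : (Fin d → ℤ) → ℂ,
      (Summable fun k => ‖C k‖ * Real.exp (2 * Real.pi * ρ * absZ k)) ∧
      ∑' k, ‖C k‖ * Real.exp (2 * Real.pi * ρ * absZ k) ≤ M ∧
      ∀ η ∈ closedStrip d ρ, HasSum (fun k => C k * character k η) (f η ε) := by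
  obtain ⟨c, hc, hM⟩ := hf
  obtain ⟨C, h1, h2, h3⟩ := hc.exists_fourier hε
  exact ⟨C, h1, h2.trans hM, h3⟩

lemma wiener_of_fourier {C : (Fin d → ℤ) → ℂ} {F : (Fin d → ℂ) → ℂ} (hr : 0 < r)
    (hs : Summable fun k => ‖C k‖ * Real.exp (2 * Real.pi * ρ * absZ k))
    (hM : ∑' k, ‖C k‖ * Real.exp (2 * Real.pi * ρ * absZ k) ≤ M)
    (hf : ∀ η ∈ closedStrip d ρ, HasSum (fun k => C k * character k η) (F η)) :
    Wiener ρ r (fun η _ => F η) M := by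
  have h := Wiener.of_family (ρ := ρ) (f := fun η _ => F η) hr C (fun k => (k, 0))
    (by simpa [weight] using hs) fun η hη ε _ => by simpa [monom] using hf η hη
  simp only [weight, pow_zero, mul_one] at h
  exact h.mono_right hM

lemma Wiener.freeze (hf : Wiener ρ r f M) (hε : ‖ε‖ ≤ r) {r' : ℝ} (hr' : 0 < r') :
    Wiener ρ r' (fun η _ => f η ε) M := by
  obtain ⟨C, h1, h2, h3⟩ := hf.exists_fourier hε
  exact wiener_of_fourier hr' h1 h2 h3

lemma summable_of_summable_exp (hρ : 0 ≤ ρ) {C : (Fin d → ℤ) → ℂ}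
    (hs : Summable fun k => ‖C k‖ * Real.exp (2 * Real.pi * ρ * absZ k)) :
    Summable fun k => ‖C k‖ :=
  hs.of_nonneg_of_le (fun _ => norm_nonneg _) fun k =>
    le_mul_of_one_le_right (norm_nonneg _)
      (Real.one_le_exp (mul_nonneg (by positivity) (absZ_nonneg _)))

lemma Wiener.memA (hρ : 0 < ρ) (hf : Wiener ρ r f M) (hε : ‖ε‖ ≤ r) :
    ∃ F, MemA ρ F ∧ ∀ η ∈ closedStrip d ρ, F η = f η ε := by
  obtain ⟨C, h1, -, h3⟩ := hf.exists_fourier hε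
  exact ⟨_, memA_series hρ h1, fun η hη => (h3 η hη).tsum_eq⟩

lemma Wiener.eq_zero_of_real (hρ : 0 ≤ ρ) (hf : Wiener ρ r f M) (hε : ‖ε‖ ≤ r)
    (h0 : ∀ σ : Fin d → ℝ, f (toC σ) ε = 0) : ∀ η ∈ closedStrip d ρ, f η ε = 0 := by
  obtain ⟨C, h1, -, h3⟩ := hf.exists_fourier hε
  have h1' := summable_of_summable_exp hρ h1
  have hC : ∀ k, C k = 0 := fun k => by
    have e1 := fourierCoef_of_hasSum (f := fun η => f η ε) h1'
      (fun σ => h3 _ (toC_mem_closedStrip hρ σ)) k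
    rw [← e1, fourierCoef_congr (g := fun _ => 0) h0]
    simp [fourierCoef, average]
  intro η hη
  refine (h3 η hη).unique (hasSum_zero.congr_fun fun k => by simp [hC])

lemma SmallDivisors.character_ne_one {s : Fin d → ℝ} {κ : ℝ} {n : ℕ} (hs : SmallDivisors s κ n)
    (hκ : 0 < κ) (k : Fin d → ℤ) (hk : k ≠ 0) : character k (toC s) ≠ 1 := by
  intro h
  have h1 := hs k hk
  have h2 : character k (toC s) * character k (toC (-s)) = 1 := by
    rw [← character_add, ← toC_add, add_neg_cancel, toC_zero, character_zero_right]
  rw [h, one_mul] at h2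
  rw [h2, sub_self, norm_zero, zero_mul] at h1
  linarith

lemma Wiener.eq_avg_of_invariant {s : Fin d → ℝ} {κ : ℝ} {n : ℕ} (hs : SmallDivisors s κ n)
    (hκ : 0 < κ) (hρ : 0 ≤ ρ) (hf : Wiener ρ r f M) (hε : ‖ε‖ ≤ r)
    (hinv : ∀ σ : Fin d → ℝ, f (toC σ + toC s) ε = f (toC σ) ε) (σ : Fin d → ℝ) :
    f (toC σ) ε = QPLindstedt.avg f ε := by
  obtain ⟨C, h1, -, h3⟩ := hf.exists_fourier hε
  exact eq_average_of_invariant (f := fun η => f η ε) (summable_of_summable_exp hρ h1)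
    (fun σ => h3 _ (toC_mem_closedStrip hρ σ)) (hs.character_ne_one hκ) hinv σ

end Sections

section Uniqueness

variable {ρ ρ₁ r σ A : ℝ} {V h p : (Fin d → ℂ) → ℂ → ℂ} {l : ℂ → ℂ} {c : (Fin d → ℤ) × ℕ → ℂ}
  {κ : ℝ} {s α : Fin d → ℝ} {n : ℕ} {ε : ℂ}

/-- The homogeneous linearized equation has no nonzero normalized solution. -/
lemma linear_solution_unique (hs : SmallDivisors s κ n) (hκ : 0 < κ) (hρ : 0 ≤ ρ) (hr : 0 < r)
    (hp : Wiener ρ r p (1 / 8)) (hp0 : ∀ ε : ℂ, ‖ε‖ ≤ r → avg p ε = 0)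
    {z : (Fin d → ℂ) → ℂ → ℂ} {Z : ℝ} (hz : Wiener ρ r z Z) (hz0 : avg z ε = 0) (hε : ‖ε‖ ≤ r)
    {m : ℂ}
    (heq : ∀ σ : Fin d → ℝ,
        (1 + p (toC σ) ε) * (z (toC σ + toC s) ε + z (toC σ + toC (-s)) ε - 2 * z (toC σ) ε)
          - z (toC σ) ε * (p (toC σ + toC s) ε + p (toC σ + toC (-s)) ε - 2 * p (toC σ) ε)
          = (1 + p (toC σ) ε) * m) :
    ∀ η ∈ closedStrip d ρ, z η ε = 0 := by
  set L : (Fin d → ℂ) → ℂ → ℂ := fun η ε => 1 + p η ε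
  have hone : Wiener (d := d) ρ r (fun _ _ => (1 : ℂ)) 1 := by
    simpa using Wiener.const (d := d) (ρ := ρ) (1 : ℂ) hr
  have hL : Wiener ρ r L (1 + 1 / 8) := hone.add hr.le hp
  have hL1 : avg L ε = 1 := by
    have := hone.avg_add hρ hr.le hp hε
    rw [hp0 ε hε, avg_const (fun _ => 1), add_zero] at this
    exact this
  have hne : ∀ σ : Fin d → ℝ, L (toC σ) ε ≠ 0 := fun σ =>
    hp.one_add_ne_zero (by norm_num) (toC_mem_closedStrip hρ σ) hε
  have hLi := hp.inv_one_add hρ hr (by norm_num)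
  set v : (Fin d → ℂ) → ℂ → ℂ := fun η ε => z η ε * (L η ε)⁻¹
  have hv : Wiener ρ r v _ := hz.mul hρ hr hLi
  have hzv : ∀ σ : Fin d → ℝ, z (toC σ) ε = L (toC σ) ε * v (toC σ) ε := fun σ => by
    have := hne σ
    simp only [v]; field_simp
  set y : (Fin d → ℂ) → ℂ → ℂ :=
    fun η ε => L η ε * L (η + toC (-s)) ε * (v η ε - v (η + toC (-s)) ε)
  have hy : Wiener ρ r y _ := (hL.mul hρ hr (hL.translate (-s))).mul hρ hr
    (hv.sub hρ hr (hv.translate (-s)))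
  have hcancel : ∀ σ : Fin d → ℝ, toC σ + toC s + toC (-s) = toC σ := fun σ => by
    rw [toC_neg]; abel
  have hyeq : ∀ σ : Fin d → ℝ, y (toC σ + toC s) ε - y (toC σ) ε = m * L (toC σ) ε := fun σ => by
    have e := heq σ
    have z1 := hzv σ
    have z2 := hzv (σ + s)
    have z3 := hzv (σ + -s)
    rw [toC_add] at z2 z3
    rw [z1, z2, z3] at e
    have l0 : p (toC σ) ε = L (toC σ) ε - 1 := by simp only [L]; ring
    have l1 : p (toC σ + toC s) ε = L (toC σ + toC s) ε - 1 := by simp only [L]; ring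
    have l2 : p (toC σ + toC (-s)) ε = L (toC σ + toC (-s)) ε - 1 := by simp only [L]; ring
    rw [l0, l1, l2] at e
    simp only [y, hcancel]
    linear_combination e
  have hm : m = 0 := by
    have e1 := (hy.translate s).avg_sub hρ hr hy hε
    rw [hy.avg_translate hρ s hε, sub_self] at e1
    have e2 : avg (fun η ε => y (η + toC s) ε - y η ε) ε = avg (fun η ε => m * L η ε) ε :=
      avg_congr hyeq
    rw [avg_mul_left (fun _ => m), hL1, mul_one, e1] at e2
    exact e2.symm
  have hyc := hy.eq_avg_of_invariant hs hκ hρ hε fun σ => by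
    have := hyeq σ
    rw [hm, zero_mul] at this
    linear_combination this
  set q : (Fin d → ℂ) → ℂ → ℂ :=
    fun η ε => p η ε + p (η + toC (-s)) ε + p η ε * p (η + toC (-s)) ε
  have hq : Wiener ρ r q (17 / 64) :=
    ((hp.add hr.le (hp.translate (-s))).add hr.le (hp.mul hρ hr (hp.translate (-s)))).mono_right
      (by norm_num)
  have hqL : ∀ η ε, 1 + q η ε = L η ε * L (η + toC (-s)) ε := fun η ε => by
    simp only [q, L]; ring
  have hi1 := hq.inv_one_add_sub_one hρ hr (by norm_num)
  have hi := hq.inv_one_add hρ hr (by norm_num)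
  have hia : avg (fun η ε => (1 + q η ε)⁻¹) ε ≠ 0 := by
    have e1 := hi.avg_sub hρ hr hone hε
    rw [avg_const (fun _ => 1)] at e1
    have e2 := (hi1.avg hρ hr.le).norm_le (toC_mem_closedStrip hρ 0) hε
    rw [e1] at e2
    intro h0
    rw [h0] at e2
    norm_num at e2
  have hvs : ∀ σ : Fin d → ℝ, v (toC σ) ε - v (toC σ + toC (-s)) ε
      = avg y ε * (1 + q (toC σ) ε)⁻¹ := fun σ => by
    have e := hyc σ
    have n1 := hq.one_add_ne_zero (by norm_num) (toC_mem_closedStrip hρ σ) hε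
    rw [← e, hqL]
    rw [hqL] at n1
    simp only [y]
    rw [eq_mul_inv_iff_mul_eq₀ n1]; ring
  have hy0 : avg y ε = 0 := by
    have e1 := hv.avg_sub hρ hr (hv.translate (-s)) hε
    rw [hv.avg_translate hρ (-s) hε, sub_self] at e1
    have e2 : avg (fun η ε => v η ε - v (η + toC (-s)) ε) ε
        = avg (fun η ε' => avg y ε * (1 + q η ε')⁻¹) ε := avg_congr hvs
    rw [avg_mul_left (fun _ => avg y ε), e1] at e2
    exact (mul_eq_zero.1 e2.symm).resolve_right hia
  have hvc := hv.eq_avg_of_invariant hs hκ hρ hε fun σ => by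
    have := hvs (σ + s)
    rw [hy0, zero_mul, toC_add, hcancel] at this
    linear_combination this
  have hv0 : avg v ε = 0 := by
    have e : avg z ε = avg (fun η ε' => avg v ε * L η ε') ε := avg_congr fun σ => by
      rw [hzv, hvc]; ring
    rw [avg_mul_left (fun _ => avg v ε), hL1, hz0, mul_one] at e
    exact e.symm
  exact hz.eq_zero_of_real hρ hε fun σ => by rw [hzv, hvc, hv0, mul_zero]

/-- The difference of two solutions satisfies a quadratic estimate. -/
lemma difference_step (hs : SmallDivisors s κ n) (hκ : 0 < κ) (hA : ∀ i, |α i| ≤ A) (hA0 : 0 < A)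
    (hr : 0 < r) (hσ : 0 < σ) (hρσ : 0 ≤ ρ - 2 * σ) (hV : HasCoeff ρ₁ r V c) {S : ℝ}
    (hS : ∑' m, ‖c m‖ * weight ρ₁ r m ≤ S) {B X g : ℝ} (hh : Wiener ρ r h B)
    (hp : Wiener ρ r p (1 / 8)) (hp0 : ∀ ε : ℂ, ‖ε‖ ≤ r → avg p ε = 0)
    (hd : ∀ η ∈ closedStrip d ρ, ∀ ε : ℂ, ‖ε‖ ≤ r →
      HasDerivAt (fun z : ℂ => h (η + z • toC α) ε) (p η ε) 0)
    (he : ∀ η ∈ closedStrip d ρ, ∀ ε : ℂ, ‖ε‖ ≤ r → hullErr s α V h l η ε = 0)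
    {w : (Fin d → ℂ) → ℂ → ℂ} {l' : ℂ → ℂ} (hw : Wiener ρ r w X)
    (hw0 : ∀ ε : ℂ, ‖ε‖ ≤ r → avg w ε = 0)
    (he' : ∀ η ∈ closedStrip d ρ, ∀ ε : ℂ, ‖ε‖ ≤ r →
      hullErr s α V (fun η ε => h η ε + w η ε) l' η ε = 0)
    (hg : 0 < g) (hgap : ρ + A * (B + X) + g ≤ ρ₁) :
    Wiener (ρ - 2 * σ) r w
      (26 * (n.factorial / κ / σ ^ n) ^ 2 * (2 * (A * X / g) ^ 2 * S)) := by
  have hρ : 0 ≤ ρ := by linarith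
  have hX := hw.nonneg hr.le
  have hQ := Wiener.remainder hA hA0 hρ hr hV hS hh hw hg hgap
  obtain ⟨u, k, hu, -, hu0, hue⟩ := exists_linear_solution hs hκ hr hσ hρσ hp hp0 (hQ.neg hρ hr)
  refine hu.congr fun η hη ε hε => ?_
  have hw2 : Wiener (ρ - 2 * σ) r w X := hw.mono (by linarith) hr.le le_rfl
  have hp2 : Wiener (ρ - 2 * σ) r p (1 / 8) := hp.mono (by linarith) hr.le le_rfl
  have hgap' : ρ + A * B + g ≤ ρ₁ := by nlinarith
  have hz := hw2.sub hρσ hr hu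
  have hz0 := hw2.avg_sub hρσ hr hu hε
  rw [hw0 ε hε, hu0 ε hε, sub_self] at hz0
  have herr : Wiener ρ r (hullErr s α V h l) 0 := by
    have : Wiener (d := d) ρ r (fun _ _ => (0 : ℂ)) 0 := by
      simpa using Wiener.const (d := d) (ρ := ρ) (0 : ℂ) hr
    exact this.congr he
  obtain ⟨e', hew, -, hee⟩ := herr.exists_deriv hA hA0 hr.le hσ (by linarith)
  refine sub_eq_zero.1 (linear_solution_unique hs hκ hρσ hr hp2 hp0 hz hz0 hε
    (m := k ε - (l' ε - l ε)) (fun x => ?_) η hη)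
  have x0 := toC_mem_closedStrip hρ x
  have h1 := hue (toC x) (toC_mem_closedStrip hρσ x) ε hε
  have h2 := (hee (toC x) (toC_mem_closedStrip (by linarith) x) ε hε).unique
    (hasDerivAt_hullErr hA hA0 hr.le hV hg hε x0 (fun η hη => hd η hη ε hε)
      (hh.norm_le x0 hε) hgap')
  have h3 := hew.norm_le (toC_mem_closedStrip (by linarith) x) hε
  rw [mul_zero, norm_le_zero_iff] at h3
  rw [h3] at h2
  have h4 := he (toC x) x0 ε hε
  have h5 := he' (toC x) x0 ε hε
  simp only [hullErr, remainder] at h1 h4 h5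
  linear_combination (1 + p (toC x) ε) * (h5 - h4) - h1 + w (toC x) ε * h2

/-- Local uniqueness of solutions with small derivative. -/
theorem local_uniqueness (hs : SmallDivisors s κ n) (hκ : 0 < κ) (hA : ∀ i, |α i| ≤ A)
    (hA0 : 0 < A) (hρ : 0 < ρ) :
    ∃ δ : ℝ, 0 < δ ∧ ∀ (r : ℝ) (V : (Fin d → ℂ) → ℂ → ℂ) (c : (Fin d → ℤ) × ℕ → ℂ), 0 < r →
      HasCoeff ρ r V c → ∑' m, ‖c m‖ * weight ρ r m ≤ 1 →
      ∀ (H G : (Fin d → ℂ) → ℂ → ℂ) (L L' : ℂ → ℂ), Wiener ρ r H (ρ / (16 * A)) →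
        (∀ ε : ℂ, ‖ε‖ ≤ r → avg H ε = 0) →
        (∀ η ∈ closedStrip d (ρ / 2), ∀ ε : ℂ, ‖ε‖ ≤ r → hullErr s α V H L η ε = 0) →
        Wiener (ρ / 2) r (fun η ε => G η ε - H η ε) δ →
        (∀ ε : ℂ, ‖ε‖ ≤ r → avg G ε = 0) →
        (∀ η ∈ closedStrip d (ρ / 2), ∀ ε : ℂ, ‖ε‖ ≤ r → hullErr s α V G L' η ε = 0) →
        ∀ (x : Fin d → ℝ) (ε : ℂ), ‖ε‖ ≤ r → G (toC x) ε = H (toC x) ε := by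
  set g := ρ / 4
  have hg : 0 < g := by positivity
  set σ := ρ / 24
  have hσ : 0 < σ := by positivity
  set T : ℝ := 2 ^ n
  have hT : 1 ≤ T := one_le_pow₀ (by norm_num)
  set y : ℝ := (2 * T ^ 2)⁻¹
  have hy : 0 < y := by positivity
  have hyT : 2 * (T ^ 2 * y) = 1 := by rw [← mul_assoc]; exact mul_inv_cancel₀ (by positivity)
  have hy1 : y ≤ 1 / 2 := by
    have h1 : y * 1 ≤ y * T ^ 2 := mul_le_mul_of_nonneg_left (one_le_pow₀ hT) hy.le
    linarith
  set K := 26 * (n.factorial / κ / σ ^ n) ^ 2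
  have hK : 0 < K := by positivity
  set C := 2 * K * (A / g) ^ 2
  have hC : 0 < C := by positivity
  obtain ⟨δ, hδ, d1, d2⟩ : ∃ δ : ℝ, 0 < δ ∧ C * δ ≤ y ∧ A * δ ≤ ρ / 16 := by
    refine ⟨min (y / C) (ρ / 16 / A), by positivity, ?_, ?_⟩
    · rw [← le_div_iff₀' hC]; exact min_le_left _ _
    · rw [← le_div_iff₀' hA0]; exact min_le_right _ _
  refine ⟨δ, hδ, fun r V c hr hV hS H G L L' hH hH0 hHe hW hG0 hGe x ε hε => ?_⟩
  obtain ⟨p, hp, hp0, hpd⟩ := hH.exists_deriv (σ := ρ / 2) hA hA0 hr.le (by positivity)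
    (by linarith)
  have hρ2 : ρ - ρ / 2 = ρ / 2 := by ring
  rw [hρ2] at hp hpd
  have hp8 : Wiener (ρ / 2) r p (1 / 8) := hp.mono_right (le_of_eq (by field_simp; norm_num))
  set w : (Fin d → ℂ) → ℂ → ℂ := fun η ε => G η ε - H η ε
  have hHw : (fun η ε => H η ε + w η ε) = G := by ext η ε; simp [w]
  have hH2 : Wiener (ρ / 2) r H (ρ / (16 * A)) := hH.mono (by linarith) hr.le le_rfl
  have hw0 : ∀ ε : ℂ, ‖ε‖ ≤ r → avg w ε = 0 := fun ε hε => by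
    have := hH2.avg_add (by positivity) hr.le hW hε
    rw [show (fun η ε => H η ε + (G η ε - H η ε)) = G from hHw, hH0 ε hε, hG0 ε hε, zero_add] at this
    exact this.symm
  have hle : ∀ i, width (ρ / 4) σ i ≤ ρ / 2 := fun i => by
    have := width_le (ρ := ρ / 4) hσ.le i
    simp only [σ] at *; linarith
  have hge : ∀ i, ρ / 4 ≤ width (ρ / 4) σ i := fun i => le_width hσ.le i
  have key : ∀ i : ℕ, Wiener (width (ρ / 4) σ i) r w (δ * y ^ i) := by
    intro i
    induction i with
    | zero => simpa using hW.mono (hle 0) hr.le le_rfl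
    | succ i ih =>
      have hσi : 0 < σ / 2 ^ i := by positivity
      have hyi : y ^ i ≤ 1 := pow_le_one₀ hy.le (by linarith)
      have hsub : closedStrip d (width (ρ / 4) σ i) ⊆ closedStrip d (ρ / 2) :=
        closedStrip_mono (hle i)
      have hws := width_succ (ρ / 4) σ i
      have hgi := hge (i + 1)
      have hb : width (ρ / 4) σ i + A * (ρ / (16 * A) + δ * y ^ i) + g ≤ ρ := by
        have h1 : A * (ρ / (16 * A)) = ρ / 16 := by field_simp
        have h2 : A * (δ * y ^ i) ≤ ρ / 16 := by
          rw [← mul_assoc]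
          exact (mul_le_of_le_one_right (by positivity) hyi).trans d2
        have := hle i
        rw [mul_add, h1]; simp only [g]; linarith
      have h := difference_step hs hκ hA hA0 hr hσi (by linarith) hV hS
        (hH2.mono (hle i) hr.le le_rfl) (hp8.mono (hle i) hr.le le_rfl) hp0
        (fun η hη => hpd η (hsub hη)) (fun η hη => hHe η (hsub hη)) ih hw0
        (by rw [hHw]; exact fun η hη => hGe η (hsub hη)) hg hb
      refine (h.mono (by linarith) hr.le le_rfl).mono_right ?_
      rw [factorial_div_width κ σ n i hσ.ne']
      have hTy : T ^ 2 * y ≤ 1 := by linarith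
      have h3 : (T ^ 2 * y) ^ i ≤ 1 := pow_le_one₀ (by positivity) hTy
      calc _ = C * δ * (T ^ 2 * y) ^ i * (δ * y ^ i) := by
            simp only [C, K, T]; ring
        _ ≤ C * δ * 1 * (δ * y ^ i) := by gcongr
        _ ≤ y * 1 * (δ * y ^ i) := by gcongr
        _ = δ * y ^ (i + 1) := by ring
  have hlim : Filter.Tendsto (fun i : ℕ => δ * y ^ i) Filter.atTop (nhds 0) := by
    simpa using (tendsto_pow_atTop_nhds_zero_of_lt_one hy.le (by linarith)).const_mul δ
  have h0 : ‖w (toC x) ε‖ ≤ 0 := ge_of_tendsto' hlim fun i =>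
    (key i).norm_le (toC_mem_closedStrip ((by positivity : (0:ℝ) ≤ ρ / 4).trans (hge i)) x) hε
  exact sub_eq_zero.1 (norm_le_zero_iff.1 h0)

end Uniqueness

/-- The Diophantine condition bounds the small divisors from below. -/
lemma IsDiophantine.smallDivisors {ω : ℝ} {α : Fin d → ℝ} {ν τ : ℝ}
    (h : IsDiophantine ω α ν τ) : SmallDivisors (ω • α) (4 * ν) ⌈τ⌉₊ := by
  intro k hk
  have hk1 := one_le_absZ hk
  set θ : ℝ := ω * ∑ i, α i * (k i : ℝ)
  set x : ℝ := θ - round θ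
  have hx : |x| ≤ 1 / 2 := abs_sub_round θ
  have hd : ν * absZ k ^ (-τ) ≤ |x| := h k hk (round θ)
  have hchar : character k (toC (-(ω • α))) = Complex.exp (Complex.I * ((-(2 * Real.pi * x) : ℝ) : ℂ)) := by
    have e1 : character k (toC (-(ω • α))) = Complex.exp (derivFactor α k * ((-ω : ℝ) : ℂ)) := by
      rw [← character_smul_toC, ← toC_smul, neg_smul]
    rw [e1, Complex.exp_eq_exp_iff_exists_int]
    refine ⟨-round θ, ?_⟩
    simp only [derivFactor, dotR, x, θ]
    push_cast; ring
  have hnorm : ‖1 - character k (toC (-(ω • α)))‖ = 2 * |Real.sin (Real.pi * x)| := by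
    rw [hchar, norm_sub_rev, Complex.norm_exp_I_mul_ofReal_sub_one, Real.norm_eq_abs, abs_mul,
      abs_two]
    congr 1
    rw [show -(2 * Real.pi * x) / 2 = -(Real.pi * x) by ring, Real.sin_neg, abs_neg]
  have hsin : 2 * |x| ≤ |Real.sin (Real.pi * x)| := by
    have := Real.mul_abs_le_abs_sin (x := Real.pi * x) (by
      rw [abs_mul, abs_of_pos Real.pi_pos]; nlinarith [Real.pi_pos])
    rw [abs_mul, abs_of_pos Real.pi_pos] at this
    calc 2 * |x| = 2 / Real.pi * (Real.pi * |x|) := by field_simp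
      _ ≤ _ := this
  have hpow : absZ k ^ τ ≤ absZ k ^ ⌈τ⌉₊ := by
    rw [← Real.rpow_natCast]; exact Real.rpow_le_rpow_of_exponent_le hk1 (Nat.le_ceil τ)
  have hpos : 0 < absZ k := zero_lt_one.trans_le hk1
  have h2 : ν ≤ |x| * absZ k ^ τ := by
    calc ν = ν * absZ k ^ (-τ) * absZ k ^ τ := by
          rw [mul_assoc, ← Real.rpow_add hpos]; simp
      _ ≤ _ := mul_le_mul_of_nonneg_right hd (Real.rpow_nonneg hpos.le _)
  have h3 : ν ≤ |x| * absZ k ^ ⌈τ⌉₊ := h2.trans (mul_le_mul_of_nonneg_left hpow (abs_nonneg _))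
  rw [hnorm]
  nlinarith [pow_pos hpos ⌈τ⌉₊]

/-! ### Formal series -/

section PowerSeries

open PowerSeries Finset

variable {a T : ℕ → ℂ}

lemma coeff_mk_pow_eq_zero (ha : a 0 = 0) {n j : ℕ} (h : n < j) : coeff n (mk a ^ j) = 0 := by
  have h1 : (X : PowerSeries ℂ) ∣ mk a := X_dvd_iff.2 (by
    rw [← coeff_zero_eq_constantCoeff_apply, coeff_mk, ha])
  exact X_pow_dvd_iff.1 (pow_dvd_pow_of_dvd h1 j) n h

lemma coeff_subst_mk (ha : a 0 = 0) (T : PowerSeries ℂ) {n N : ℕ} (hN : n < N) :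
    coeff n (subst (mk a) T) = ∑ j ∈ range N, coeff j T * coeff n (mk a ^ j) := by
  have hs : HasSubst (mk a) := HasSubst.of_constantCoeff_zero' (by
    rw [← coeff_zero_eq_constantCoeff_apply, coeff_mk, ha])
  rw [coeff_subst' hs]
  simp only [smul_eq_mul]
  refine finsum_eq_sum_of_support_subset _ fun j hj => ?_
  simp only [coe_range, Set.mem_Iio]
  by_contra hjn
  exact hj (by simp only; rw [coeff_mk_pow_eq_zero ha (by omega), mul_zero])

lemma coeff_mk_pow (ha : a 0 = 0) (n j : ℕ) :
    coeff n (mk a ^ j) = ∑ m ∈ ((univ : Finset (Fin j)).piAntidiag n).filter (fun m => ∀ i, 1 ≤ m i),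
      ∏ i, a (m i) := by
  have h1 : mk a ^ j = ∏ _i : Fin j, mk a := by simp
  have h2 : ∀ m ∈ (univ : Finset (Fin j)).piAntidiag n, ∏ i, a (m i) ≠ 0 → ∀ i, 1 ≤ m i := by
    intro m _ hm i
    by_contra hi
    refine hm (prod_eq_zero (mem_univ i) ?_)
    rw [Nat.lt_one_iff.1 (not_le.1 hi), ha]
  rw [sum_filter_of_ne h2, h1, coeff_prod]
  simp only [coeff_mk]
  refine sum_bij' (fun f _ => (f : Fin j → ℕ)) (fun m _ => Finsupp.equivFunOnFinite.symm m)
    ?_ ?_ ?_ ?_ ?_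
  · intro f hf
    simp only [mem_finsuppAntidiag] at hf
    simpa using hf.1
  · intro m hm
    simp only [mem_piAntidiag] at hm
    simpa [mem_finsuppAntidiag] using hm.1
  · intro f _; ext; simp
  · intro m _; ext; simp
  · intro f _; rfl

lemma hasSum_antidiagonal {x y : ℕ → ℂ} {s t : ℝ} (hx : Summable fun n => ‖x n‖)
    (hy : Summable fun n => ‖y n‖) (hxs : ∑' n, ‖x n‖ ≤ s) (hyt : ∑' n, ‖y n‖ ≤ t) :
    (Summable fun n => ‖∑ p ∈ antidiagonal n, x p.1 * y p.2‖) ∧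
    ∑' n, ‖∑ p ∈ antidiagonal n, x p.1 * y p.2‖ ≤ s * t ∧
    HasSum (fun n => ∑ p ∈ antidiagonal n, x p.1 * y p.2) ((∑' n, x n) * ∑' n, y n) := by
  have h1 := summable_norm_sum_mul_antidiagonal_of_summable_norm hx hy
  have h2 : Summable fun n => ∑ p ∈ antidiagonal n, ‖x p.1‖ * ‖y p.2‖ :=
    summable_sum_mul_antidiagonal_of_summable_mul (f := fun n => ‖x n‖) (g := fun n => ‖y n‖)
      (hx.mul_of_nonneg hy (fun _ => norm_nonneg _) fun _ => norm_nonneg _)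
  refine ⟨h1, ?_, ?_⟩
  · calc ∑' n, ‖∑ p ∈ antidiagonal n, x p.1 * y p.2‖
        ≤ ∑' n, ∑ p ∈ antidiagonal n, ‖x p.1‖ * ‖y p.2‖ :=
          h1.tsum_le_tsum (fun n => (norm_sum_le _ _).trans
            (sum_le_sum fun p _ => (norm_mul _ _).le)) h2
      _ = (∑' n, ‖x n‖) * ∑' n, ‖y n‖ :=
          (tsum_mul_tsum_eq_tsum_sum_antidiagonal_of_summable_norm
            (f := fun n => ‖x n‖) (g := fun n => ‖y n‖) hx.norm hy.norm).symm
      _ ≤ s * t := mul_le_mul hxs hyt (tsum_nonneg fun _ => norm_nonneg _)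
          ((tsum_nonneg fun _ => norm_nonneg _).trans hxs)
  · rw [tsum_mul_tsum_eq_tsum_sum_antidiagonal_of_summable_norm hx hy]
    exact h1.of_norm.hasSum

lemma summable_coeff_pow {ε : ℂ} {s : ℝ} (ha : Summable fun n => ‖a n * ε ^ n‖)
    (hs : ∑' n, ‖a n * ε ^ n‖ ≤ s) (j : ℕ) :
    (Summable fun n => ‖coeff n (mk a ^ j) * ε ^ n‖) ∧
    ∑' n, ‖coeff n (mk a ^ j) * ε ^ n‖ ≤ s ^ j ∧
    HasSum (fun n => coeff n (mk a ^ j) * ε ^ n) ((∑' n, a n * ε ^ n) ^ j) := by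
  have hs0 : 0 ≤ s := (tsum_nonneg fun n => norm_nonneg _).trans hs
  induction j with
  | zero =>
    have h1 : ∀ n ≠ 0, ‖coeff n (mk a ^ 0) * ε ^ n‖ = 0 := fun n hn => by
      simp [coeff_one, hn]
    have h2 : HasSum (fun n => ‖coeff n (mk a ^ 0) * ε ^ n‖) 1 := by
      have := hasSum_single 0 h1
      simpa using this
    refine ⟨h2.summable, by simpa using h2.tsum_eq.le, ?_⟩
    have := hasSum_single (f := fun n => coeff n (mk a ^ 0) * ε ^ n) 0
      fun n hn => norm_eq_zero.1 (h1 n hn)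
    simpa using this
  | succ j ih =>
    obtain ⟨i1, i2, i3⟩ := ih
    have hc : ∀ n, coeff n (mk a ^ (j + 1)) * ε ^ n = ∑ p ∈ antidiagonal n,
        (coeff p.1 (mk a ^ j) * ε ^ p.1) * (a p.2 * ε ^ p.2) := fun n => by
      rw [pow_succ, coeff_mul, sum_mul]
      refine sum_congr rfl fun p hp => ?_
      have h1 : ε ^ n = ε ^ p.1 * ε ^ p.2 := by rw [← pow_add, mem_antidiagonal.1 hp]
      rw [coeff_mk, h1, mul_mul_mul_comm]
    have := hasSum_antidiagonal i1 ha i2 hs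
    rw [i3.tsum_eq, ← pow_succ, ← pow_succ] at this
    simpa only [hc] using this

/-- Evaluation of a substitution of power series. -/
lemma hasSum_subst {ε : ℂ} {s : ℝ} (ha0 : a 0 = 0) (ha : Summable fun n => ‖a n * ε ^ n‖)
    (hs : ∑' n, ‖a n * ε ^ n‖ ≤ s) (hT : Summable fun j => ‖T j‖ * s ^ j) :
    HasSum (fun n => coeff n (subst (mk a) (mk T)) * ε ^ n)
      (∑' j, T j * (∑' n, a n * ε ^ n) ^ j) := by
  have key := summable_coeff_pow ha hs
  have hsum : Summable fun x : ℕ × ℕ => T x.1 * (coeff x.2 (mk a ^ x.1) * ε ^ x.2) := by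
    refine Summable.of_norm ?_
    refine (summable_prod_of_nonneg fun x => norm_nonneg _).2 ⟨fun j => ?_, ?_⟩
    · simp only [norm_mul (T _)]
      exact (key j).1.mul_left _
    · refine hT.of_nonneg_of_le (fun j => tsum_nonneg fun n => norm_nonneg _) fun j => ?_
      simp only [norm_mul (T _), tsum_mul_left]
      exact mul_le_mul_of_nonneg_left (key j).2.1 (norm_nonneg _)
  have h1 := hsum.hasSum.prod_fiberwise fun j => (key j).2.2.mul_left (T j)
  rw [h1.tsum_eq]
  refine ((Equiv.prodComm ℕ ℕ).hasSum_iff.2 hsum.hasSum).prod_fiberwise fun n => ?_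
  rw [coeff_subst_mk ha0 (mk T) (Nat.lt_succ_self n), sum_mul]
  simp only [coeff_mk, mul_assoc]
  refine hasSum_sum_of_ne_finset_zero fun j hj => ?_
  simp only [Function.comp, Equiv.prodComm_apply, Prod.swap]
  rw [coeff_mk_pow_eq_zero ha0 (by simpa using hj)]; simp

lemma eq_zero_of_hasSum_zero {f : ℕ → ℂ} {r : ℝ} (hr : 0 < r)
    (h : ∀ ε : ℂ, ‖ε‖ ≤ r → HasSum (fun n => f n * ε ^ n) 0) (n : ℕ) : f n = 0 := by
  have hp : HasFPowerSeriesAt (0 : ℂ → ℂ) (FormalMultilinearSeries.ofScalars ℂ f) 0 := by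
    rw [hasFPowerSeriesAt_iff]
    filter_upwards [Metric.ball_mem_nhds (0 : ℂ) hr] with z hz
    have := h z (by simpa using (Metric.mem_ball.1 hz).le)
    simpa [FormalMultilinearSeries.coeff_ofScalars, mul_comm] using this
  have h0 := congrArg (fun p => FormalMultilinearSeries.coeff p n) hp.eq_zero
  rw [FormalMultilinearSeries.coeff_ofScalars] at h0
  exact h0

end PowerSeries

section Formal

variable {ω : ℝ} {α : Fin d → ℝ} {U : (Fin d → ℂ) → ℂ} {h g : ℕ → (Fin d → ℂ) → ℂ} {l m : ℕ → ℂ}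

lemma knownTerm_congr {η : Fin d → ℂ} {n : ℕ} (hgh : ∀ k, 1 ≤ k → k < n → g k η = h k η) :
    knownTerm α U g n η = knownTerm α U h n η := by
  unfold knownTerm
  refine Finset.sum_congr rfl fun j hj => ?_
  congr 1
  refine Finset.sum_congr rfl fun m hm => Finset.prod_congr rfl fun i _ => ?_
  rw [Finset.mem_filter, Finset.mem_piAntidiag] at hm
  refine hgh _ (hm.2 i) ?_
  have : m i ≤ n - 1 := by
    rw [← hm.1.1]; exact Finset.single_le_sum (fun _ _ => Nat.zero_le _) (Finset.mem_univ i)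
  have := Finset.mem_range.1 hj
  omega

lemma coeff_formalComp {η : Fin d → ℂ} (h0 : h 0 η = 0) {n : ℕ} (hn : 1 ≤ n) :
    PowerSeries.coeff (n - 1) (formalComp α U h η) = knownTerm α U h n η := by
  have e1 : seriesAt h η - PowerSeries.C (h 0 η) = PowerSeries.mk fun n => h n η := by
    rw [h0, map_zero, sub_zero]; rfl
  rw [formalComp, e1, coeff_subst_mk (a := fun n => h n η) h0 _ (Nat.sub_one_lt_of_lt hn), knownTerm]
  refine Finset.sum_congr rfl fun j _ => ?_
  rw [coeff_mk_pow (a := fun n => h n η) h0, taylorAlong, PowerSeries.coeff_mk, h0, zero_smul,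
    add_zero]

/-- The coefficients of the formal hull equation. -/
lemma formalHullSolution_iff_coeff : FormalHullSolution ω α U h l ↔
    ∀ (σ : Fin d → ℝ) (n : ℕ), secondDiff ω α (h n) (toC σ)
      + (if n = 0 then 0 else PowerSeries.coeff (n - 1) (formalComp α U h (toC σ))) + l n = 0 := by
  unfold FormalHullSolution
  refine forall_congr' fun σ => ?_
  rw [PowerSeries.ext_iff]
  refine forall_congr' fun n => ?_
  have hX : PowerSeries.coeff n (PowerSeries.X * formalComp α U h (toC σ))
      = if n = 0 then 0 else PowerSeries.coeff (n - 1) (formalComp α U h (toC σ)) := by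
    cases n with
    | zero => simp
    | succ n => simp [PowerSeries.coeff_succ_X_mul]
  have h2 : PowerSeries.coeff n (2 * seriesAt h (toC σ)) = 2 * h n (toC σ) := by
    rw [two_mul, map_add, seriesAt, PowerSeries.coeff_mk, two_mul]
  rw [map_add, map_add, map_sub, map_add, hX, h2]
  simp only [seriesAt, PowerSeries.coeff_mk, secondDiff, map_zero]

lemma formalHullSolution_iff (h0 : ∀ σ : Fin d → ℝ, h 0 (toC σ) = 0) :
    FormalHullSolution ω α U h l ↔
      (∀ σ : Fin d → ℝ, secondDiff ω α (h 0) (toC σ) + l 0 = 0) ∧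
      ∀ n, 1 ≤ n → SolvesCohomological ω α (knownTerm α U h n) (h n) (l n) := by
  rw [formalHullSolution_iff_coeff]
  constructor
  · refine fun H => ⟨fun σ => by simpa using H σ 0, fun n hn σ => ?_⟩
    have := H σ n
    rwa [if_neg (by omega), coeff_formalComp (h0 σ) hn] at this
  · rintro ⟨H1, H2⟩ σ n
    rcases Nat.eq_zero_or_pos n with rfl | hn
    · simpa using H1 σ
    · rw [if_neg (by omega), coeff_formalComp (h0 σ) hn]
      exact H2 n hn σ

lemma secondDiff_eq (φ : (Fin d → ℂ) → ℂ) (η : Fin d → ℂ) :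
    secondDiff ω α φ η = φ (η + toC (ω • α)) + φ (η + toC (-(ω • α))) - 2 * φ η := by
  rw [secondDiff, toC_neg, toC_smul, ← sub_eq_add_neg η]

lemma secondDiff_toC (φ : (Fin d → ℂ) → ℂ) (σ : Fin d → ℝ) :
    secondDiff ω α φ (toC σ)
      = φ (toC (σ + ω • α)) + φ (toC (σ + -(ω • α))) - 2 * φ (toC σ) := by
  rw [secondDiff_eq, toC_add, toC_add]

variable {κ : ℝ} {N : ℕ}

lemma MemA.exists_wiener {ρ : ℝ} {φ : (Fin d → ℂ) → ℂ} (hρ : 0 < ρ) (hφ : MemA ρ φ) :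
    ∃ M, Wiener (ρ / 2) 1 (fun η _ => φ η) M := by
  obtain ⟨M, -, hM⟩ := hφ.exists_bound
  exact ⟨_, hφ.wiener hρ hM (by positivity) (by linarith) one_pos⟩

/-- Uniqueness for the cohomological equation of second order. -/
lemma cohomology_unique (hs : SmallDivisors (ω • α) κ N) (hκ : 0 < κ) {ρ : ℝ} (hρ : 0 < ρ)
    {φ : (Fin d → ℂ) → ℂ} (hφ : MemA ρ φ) (hav : average φ = 0) {c : ℂ}
    (heq : ∀ σ : Fin d → ℝ, secondDiff ω α φ (toC σ) + c = 0) :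
    c = 0 ∧ ∀ σ : Fin d → ℝ, φ (toC σ) = 0 := by
  obtain ⟨M, hW⟩ := hφ.exists_wiener hρ
  have hp : Wiener (d := d) (ρ / 2) 1 (fun _ _ => (0 : ℂ)) (1 / 8) :=
    (Wiener.const (0 : ℂ) one_pos).mono_right (by norm_num)
  have hz := linear_solution_unique (ε := 0) (m := -c) hs hκ (by positivity) one_pos hp
    (fun ε _ => avg_const (fun _ => 0) ε) hW hav (by simp) fun σ => by
      have := heq σ
      rw [secondDiff_eq] at this
      linear_combination this
  have h0 : ∀ σ : Fin d → ℝ, φ (toC σ) = 0 := fun σ =>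
    hz _ (toC_mem_closedStrip (by positivity) σ)
  refine ⟨?_, h0⟩
  have := heq 0
  rw [secondDiff_toC, h0, h0, h0] at this
  simpa using this

lemma average_sub {ρ : ℝ} (hρ : 0 ≤ ρ) {φ ψ : (Fin d → ℂ) → ℂ} (hφ : MemA ρ φ)
    (hψ : MemA ρ ψ) : average (fun η => φ η - ψ η) = average φ - average ψ :=
  MeasureTheory.integral_sub
    ((hφ.continuous_real hρ).continuousOn.integrableOn_compact isCompact_Icc)
    ((hψ.continuous_real hρ).continuousOn.integrableOn_compact isCompact_Icc)

lemma average_secondDiff {ρ : ℝ} (hρ : 0 < ρ) {φ : (Fin d → ℂ) → ℂ} (hφ : MemA ρ φ) :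
    average (secondDiff ω α φ) = 0 := by
  obtain ⟨M, hW⟩ := hφ.exists_wiener hρ
  have hρ' : 0 ≤ ρ / 2 := by positivity
  have h0 : ‖(0 : ℂ)‖ ≤ 1 := by simp
  have e1 := ((hW.translate (ω • α)).add zero_le_one (hW.translate (-(ω • α)))).avg_sub hρ' one_pos
    (hW.const_mul 2 hρ' one_pos) h0
  rw [(hW.translate (ω • α)).avg_add hρ' zero_le_one (hW.translate (-(ω • α))) h0,
    hW.avg_translate hρ' _ h0, hW.avg_translate hρ' _ h0, avg_mul_left (fun _ => 2)] at e1
  have e2 : average (secondDiff ω α φ) = avg (fun η (_ : ℂ) =>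
      φ (η + toC (ω • α)) + φ (η + toC (-(ω • α))) - 2 * φ η) 0 :=
    average_congr fun σ => secondDiff_eq _ _
  rw [e2, e1]; ring

lemma average_const_sub_secondDiff {ρ : ℝ} (hρ : 0 < ρ) {φ : (Fin d → ℂ) → ℂ} (hφ : MemA ρ φ)
    (a : ℂ) : average (fun η => a - secondDiff ω α φ η) = a := by
  have hc := hφ.continuous_real hρ.le
  have h1 : Continuous fun σ : Fin d → ℝ => secondDiff ω α φ (toC σ) := by
    simp only [secondDiff_toC]
    exact ((hc.comp (continuous_id.add continuous_const)).add
      (hc.comp (continuous_id.add continuous_const))).sub (continuous_const.mul hc)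
  have e : average (fun η => a - secondDiff ω α φ η)
      = average (fun _ : Fin d → ℂ => a) - average (secondDiff ω α φ) :=
    MeasureTheory.integral_sub (continuous_const.continuousOn.integrableOn_compact isCompact_Icc)
      (h1.continuousOn.integrableOn_compact isCompact_Icc)
  rw [e, average_secondDiff hρ hφ, sub_zero]
  exact avg_const (fun _ => a) 0

lemma secondDiff_sub (φ ψ : (Fin d → ℂ) → ℂ) (η : Fin d → ℂ) :
    secondDiff ω α (fun η => φ η - ψ η) η = secondDiff ω α φ η - secondDiff ω α ψ η := by
  simp only [secondDiff]; ring

/-- Two normalized solutions of the same cohomological equation agree. -/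
lemma solvesCohomological_unique (hs : SmallDivisors (ω • α) κ N) (hκ : 0 < κ) {ρ ρ' : ℝ}
    (hρ : 0 < ρ) (hρ' : 0 < ρ') {φ ψ R R' : (Fin d → ℂ) → ℂ} (hφ : MemA ρ φ) (hψ : MemA ρ' ψ)
    (hφ0 : average φ = 0) (hψ0 : average ψ = 0) {a b : ℂ}
    (hR : ∀ σ : Fin d → ℝ, R (toC σ) = R' (toC σ))
    (h1 : SolvesCohomological ω α R φ a) (h2 : SolvesCohomological ω α R' ψ b) :
    a = b ∧ ∀ σ : Fin d → ℝ, φ (toC σ) = ψ (toC σ) := by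
  have hm : 0 < min ρ ρ' := lt_min hρ hρ'
  have hφ' := hφ.anti (min_le_left ρ ρ')
  have hψ' := hψ.anti (min_le_right ρ ρ')
  have := cohomology_unique hs hκ hm (hφ'.sub hψ')
    (by rw [average_sub hm.le hφ' hψ', hφ0, hψ0, sub_zero]) (c := a - b) fun σ => by
      rw [secondDiff_sub]
      linear_combination h1 σ - h2 σ - hR σ
  exact ⟨sub_eq_zero.1 this.1, fun σ => sub_eq_zero.1 (this.2 σ)⟩

lemma FormalHullSolution.zero_order (hs : SmallDivisors (ω • α) κ N) (hκ : 0 < κ)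
    (hmem : ∃ ρ : ℝ, 0 < ρ ∧ MemA ρ (h 0)) (hsol : FormalHullSolution ω α U h l)
    (hnorm : FormalNormalized h) : l 0 = 0 ∧ ∀ σ : Fin d → ℝ, h 0 (toC σ) = 0 := by
  obtain ⟨ρ, hρ, hm⟩ := hmem
  exact cohomology_unique hs hκ hρ hm (hnorm 0) fun σ => by
    simpa using formalHullSolution_iff_coeff.1 hsol σ 0

/-- Uniqueness of the formal solution. -/
lemma FormalHullSolution.unique (hs : SmallDivisors (ω • α) κ N) (hκ : 0 < κ)
    (hh : ∀ n, ∃ ρ : ℝ, 0 < ρ ∧ MemA ρ (h n)) (hg : ∀ n, ∃ ρ : ℝ, 0 < ρ ∧ MemA ρ (g n))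
    (hsol : FormalHullSolution ω α U h l) (gsol : FormalHullSolution ω α U g m)
    (hnorm : FormalNormalized h) (gnorm : FormalNormalized g) (n : ℕ) :
    m n = l n ∧ ∀ σ : Fin d → ℝ, g n (toC σ) = h n (toC σ) := by
  obtain ⟨l0, h0⟩ := hsol.zero_order hs hκ (hh 0) hnorm
  obtain ⟨m0, g0⟩ := gsol.zero_order hs hκ (hg 0) gnorm
  have hc := ((formalHullSolution_iff h0).1 hsol).2
  have gc := ((formalHullSolution_iff g0).1 gsol).2
  induction n using Nat.strong_induction_on with
  | _ n ih =>
    rcases Nat.eq_zero_or_pos n with rfl | hn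
    · exact ⟨by rw [l0, m0], fun σ => by rw [h0, g0]⟩
    · obtain ⟨ρ, hρ, hm⟩ := hh n
      obtain ⟨ρ', hρ', gm⟩ := hg n
      exact solvesCohomological_unique hs hκ hρ' hρ gm hm (gnorm n) (hnorm n)
        (fun σ => knownTerm_congr fun k _ hk => (ih k hk).2 σ) (gc n hn) (hc n hn)

end Formal

/-! ### Reality of the coefficients -/

section Reality

open ComplexConjugate

variable {ω : ℝ} {α : Fin d → ℝ} {U φ : (Fin d → ℂ) → ℂ} {h : ℕ → (Fin d → ℂ) → ℂ} {l : ℕ → ℂ}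
  {ρ ρ₀ : ℝ}

/-- The Schwarz reflection `η ↦ conj (φ (conj η))`. -/
def reflection (φ : (Fin d → ℂ) → ℂ) : (Fin d → ℂ) → ℂ := star ∘ φ ∘ star

lemma reflection_toC (φ : (Fin d → ℂ) → ℂ) (σ : Fin d → ℝ) :
    reflection φ (toC σ) = conj (φ (toC σ)) := by
  have : star (toC σ) = toC σ := by ext i; simp [toC]
  simp only [reflection, Function.comp, this]; rfl

lemma star_mem_closedStrip {η : Fin d → ℂ} (hη : η ∈ closedStrip d ρ) :
    star η ∈ closedStrip d ρ := fun i => by simpa using hη i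

lemma star_mem_strip {η : Fin d → ℂ} (hη : η ∈ strip d ρ) : star η ∈ strip d ρ :=
  fun i => by simpa using hη i

lemma MemA.reflection (hφ : MemA ρ φ) : MemA ρ (reflection φ) where
  periodic η hη k := by
    have e : star (η + fun i => (k i : ℂ)) = star η + fun i => (k i : ℂ) := by
      ext i; simp
    simp only [QPLindstedt.reflection, Function.comp, e,
      hφ.periodic _ (star_mem_closedStrip hη) k]
  holomorphic η hη := by
    have h1 := (hφ.holomorphic.differentiableAt
      ((isOpen_strip ρ).mem_nhds (star_mem_strip hη))).star_star
    rw [star_star] at h1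
    exact h1.differentiableWithinAt
  continuousOn := continuous_star.comp_continuousOn
    (hφ.continuousOn.comp continuous_star.continuousOn fun _ hη => star_mem_closedStrip hη)

lemma average_reflection (φ : (Fin d → ℂ) → ℂ) : average (reflection φ) = conj (average φ) := by
  simp only [average, reflection_toC]
  exact integral_conj

lemma iteratedDeriv_conj_conj (f : ℂ → ℂ) (n : ℕ) :
    iteratedDeriv n (conj ∘ f ∘ conj) = conj ∘ iteratedDeriv n f ∘ conj := by
  induction n with
  | zero => simp
  | succ n ih => rw [iteratedDeriv_succ, ih, deriv_conj_conj, ← iteratedDeriv_succ]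

lemma conj_dirDeriv (hρ₀ : 0 < ρ₀) (hU : MemA ρ₀ U) (hreal : RealOnReal U) (j : ℕ)
    (σ : Fin d → ℝ) : conj (dirDeriv α j U (toC σ)) = dirDeriv α j U (toC σ) := by
  set F : ℂ → ℂ := fun t => U (toC σ + t • toC α)
  have hS := isOpen_lineDomain ρ₀ α
  have h0 := zero_mem_lineDomain hρ₀ α
  have hF : DifferentiableOn ℂ F (lineDomain ρ₀ α) := DifferentiableOn.comp_linePoint hU.holomorphic σ α
  have hF' : DifferentiableOn ℂ (conj ∘ F ∘ conj) (lineDomain ρ₀ α) := fun z hz => by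
    have hz' : conj z ∈ lineDomain ρ₀ α := fun i => by simpa using hz i
    have := (hF.differentiableAt (hS.mem_nhds hz')).conj_conj
    rw [Complex.conj_conj] at this
    exact this.differentiableWithinAt
  have heq : Set.EqOn (conj ∘ F ∘ conj) F (lineDomain ρ₀ α) :=
    eqOn_of_eq_ofReal hS (convex_lineDomain ρ₀ α).isPreconnected h0 hF' hF fun t => by
      have e : F t = U (toC (σ + t • α)) := by simp only [F]; rw [toC_add, toC_smul]
      simp only [Function.comp, Complex.conj_ofReal, e]
      exact Complex.conj_eq_iff_im.2 (hreal _)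
  have h1 := (heq.eventuallyEq_of_mem (hS.mem_nhds h0)).iteratedDeriv_eq j
  rw [iteratedDeriv_conj_conj] at h1
  simp only [Function.comp, map_zero] at h1
  exact h1

lemma conj_knownTerm (hρ₀ : 0 < ρ₀) (hU : MemA ρ₀ U) (hreal : RealOnReal U) (n : ℕ)
    (σ : Fin d → ℝ) : knownTerm α U (fun n => reflection (h n)) n (toC σ)
      = conj (knownTerm α U h n (toC σ)) := by
  simp only [knownTerm, map_sum, map_mul, map_prod, map_inv₀, Complex.conj_natCast, reflection_toC,
    conj_dirDeriv hρ₀ hU hreal]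

lemma secondDiff_reflection (φ : (Fin d → ℂ) → ℂ) (σ : Fin d → ℝ) :
    secondDiff ω α (reflection φ) (toC σ) = conj (secondDiff ω α φ (toC σ)) := by
  simp only [secondDiff_toC, reflection_toC, map_sub, map_add, map_mul, Complex.conj_ofNat]

/-- The formal solution of an equation with real interaction is real. -/
lemma FormalHullSolution.real {κ : ℝ} {N : ℕ} (hs : SmallDivisors (ω • α) κ N) (hκ : 0 < κ)
    (hρ₀ : 0 < ρ₀) (hU : MemA ρ₀ U) (hreal : RealOnReal U)
    (hh : ∀ n, ∃ ρ : ℝ, 0 < ρ ∧ MemA ρ (h n)) (hsol : FormalHullSolution ω α U h l)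
    (hnorm : FormalNormalized h) (n : ℕ) : RealOnReal (h n) ∧ ((l n).re : ℂ) = l n := by
  obtain ⟨l0, h0⟩ := hsol.zero_order hs hκ (hh 0) hnorm
  obtain ⟨e0, e1⟩ := (formalHullSolution_iff h0).1 hsol
  have hg : FormalHullSolution ω α U (fun n => reflection (h n)) fun n => conj (l n) := by
    refine (formalHullSolution_iff fun σ => by rw [reflection_toC, h0, map_zero]).2
      ⟨fun σ => ?_, fun n hn σ => ?_⟩
    · rw [secondDiff_reflection, ← map_add, e0, map_zero]
    · rw [secondDiff_reflection, conj_knownTerm hρ₀ hU hreal, ← map_add, ← map_add, e1 n hn σ,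
        map_zero]
  have := hsol.unique hs hκ hh
    (fun n => (hh n).imp fun ρ hρ => ⟨hρ.1, hρ.2.reflection⟩) hg hnorm
    (fun n => by rw [average_reflection, hnorm n, map_zero]) n
  refine ⟨fun σ => ?_, Complex.conj_eq_iff_re.1 this.1⟩
  have h2 := this.2 σ
  rw [reflection_toC] at h2
  exact Complex.conj_eq_iff_im.1 h2

end Reality

/-! ### From convergent to formal solutions -/

section Analytic

variable {ω : ℝ} {α : Fin d → ℝ} {U : (Fin d → ℂ) → ℂ} {ρ₀ A s : ℝ}

lemma hasSum_taylorAlong (hU : MemA ρ₀ U) (hA : ∀ i, |α i| ≤ A) (hA0 : 0 < A) (hs : A * s < ρ₀)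
    (σ : Fin d → ℝ) {z : ℂ} (hz : ‖z‖ ≤ s) :
    HasSum (fun j : ℕ => ((j.factorial : ℂ))⁻¹ * dirDeriv α j U (toC σ) * z ^ j)
      (U (toC σ + z • toC α)) := by
  have hd : DifferentiableOn ℂ (fun t : ℂ => U (toC σ + t • toC α)) (Metric.ball 0 (ρ₀ / A)) := by
    refine (DifferentiableOn.comp_linePoint hU.holomorphic σ α).mono fun w hw i => ?_
    rw [mem_ball_zero_iff, lt_div_iff₀ hA0] at hw
    rw [abs_mul]
    exact (mul_le_mul (Complex.abs_im_le_norm w) (hA i) (abs_nonneg _) (norm_nonneg _)).trans_lt hw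
  have hz' : z ∈ Metric.ball (0 : ℂ) (ρ₀ / A) := by
    rw [mem_ball_zero_iff, lt_div_iff₀ hA0, mul_comm]
    exact (mul_le_mul_of_nonneg_left hz hA0.le).trans_lt hs
  refine (Complex.hasSum_taylorSeries_on_ball hd hz').congr_fun fun j => ?_
  simp only [dirDeriv, sub_zero, smul_eq_mul]; ring

/-- The coefficients of an analytic family of solutions form a formal solution. -/
lemma formalHullSolution_of_hasSum {κ : ℝ} {N : ℕ} (hsd : SmallDivisors (ω • α) κ N) (hκ : 0 < κ)
    (hU : MemA ρ₀ U) (hA : ∀ i, |α i| ≤ A) (hA0 : 0 < A) (hs0 : 0 ≤ s) (hs : A * s < ρ₀)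
    {r : ℝ} (hr : 0 < r) {h : ℕ → (Fin d → ℂ) → ℂ} {l : ℕ → ℂ} {H : (Fin d → ℂ) → ℂ → ℂ}
    {L : ℂ → ℂ} (hmem : ∃ ρ : ℝ, 0 < ρ ∧ MemA ρ (h 0)) (hav : average (h 0) = 0)
    (hh : ∀ (σ : Fin d → ℝ) (ε : ℂ), ‖ε‖ ≤ r →
      HasSum (fun n => h n (toC σ) * ε ^ n) (H (toC σ) ε))
    (hb : ∀ (σ : Fin d → ℝ) (ε : ℂ), ‖ε‖ ≤ r → (Summable fun n => ‖h n (toC σ) * ε ^ n‖) ∧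
      ∑' n, ‖h n (toC σ) * ε ^ n‖ ≤ s)
    (hl : ∀ ε : ℂ, ‖ε‖ ≤ r → HasSum (fun n => l n * ε ^ n) (L ε))
    (he : ∀ (σ : Fin d → ℝ) (ε : ℂ), ‖ε‖ ≤ r → secondDiff ω α (fun η => H η ε) (toC σ)
      + ε * U (toC σ + H (toC σ) ε • toC α) + L ε = 0) :
    FormalHullSolution ω α U h l := by
  have hsum0 : ∀ {a : ℕ → ℂ} {x : ℂ}, HasSum (fun n => a n * (0 : ℂ) ^ n) x → x = a 0 :=
    fun {a x} ha => ha.unique (by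
      simpa using hasSum_single (f := fun n => a n * (0 : ℂ) ^ n) 0 fun n hn => by simp [hn])
  have hr0 : ‖(0 : ℂ)‖ ≤ r := by simpa using hr.le
  have hH0 : ∀ σ : Fin d → ℝ, H (toC σ) 0 = h 0 (toC σ) := fun σ => hsum0 (hh σ 0 hr0)
  have h0 : ∀ σ : Fin d → ℝ, h 0 (toC σ) = 0 := by
    obtain ⟨ρ, hρ, hm⟩ := hmem
    refine (cohomology_unique hsd hκ hρ hm hav (c := l 0) fun σ => ?_).2
    have := he σ 0 hr0
    rw [secondDiff_toC, hsum0 (hl 0 hr0)] at this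
    simp only [hH0] at this
    rw [secondDiff_toC]
    simpa using this
  rw [formalHullSolution_iff_coeff]
  intro σ
  have e1 : formalComp α U h (toC σ) = PowerSeries.subst (PowerSeries.mk fun n => h n (toC σ))
      (PowerSeries.mk fun j => ((j.factorial : ℂ))⁻¹ * dirDeriv α j U (toC σ)) := by
    rw [formalComp, h0, map_zero, sub_zero, zero_smul, add_zero]; rfl
  refine eq_zero_of_hasSum_zero hr fun ε hε => ?_
  obtain ⟨b1, b2⟩ := hb σ ε hε
  have hT : Summable fun j : ℕ => ‖((j.factorial : ℂ))⁻¹ * dirDeriv α j U (toC σ)‖ * s ^ j := by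
    have := (hasSum_taylorAlong hU hA hA0 hs σ (z := (s : ℂ))
      (by rw [Complex.norm_real, Real.norm_of_nonneg hs0])).summable.norm
    refine this.congr fun j => ?_
    rw [norm_mul, norm_pow, Complex.norm_real, Real.norm_of_nonneg hs0]
  have hHs : ‖H (toC σ) ε‖ ≤ s := by
    rw [← (hh σ ε hε).tsum_eq]
    exact (norm_tsum_le_tsum_norm b1).trans b2
  have h1 := hasSum_subst (h0 σ) b1 b2 hT
  rw [← e1, (hh σ ε hε).tsum_eq, (hasSum_taylorAlong hU hA hA0 hs σ hHs).tsum_eq] at h1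
  have h2 : HasSum (fun n => (if n = 0 then 0
      else PowerSeries.coeff (n - 1) (formalComp α U h (toC σ))) * ε ^ n)
      (ε * U (toC σ + H (toC σ) ε • toC α)) := by
    rw [← hasSum_nat_add_iff' 1]
    simp only [Nat.add_eq_zero_iff, one_ne_zero, and_false, if_false, Nat.add_sub_cancel,
      Finset.sum_range_one, if_true, zero_mul, sub_zero]
    refine (h1.mul_left ε).congr_fun fun n => ?_
    rw [pow_succ]; ring
  have h3 : HasSum (fun n => secondDiff ω α (h n) (toC σ) * ε ^ n)
      (secondDiff ω α (fun η => H η ε) (toC σ)) := by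
    simp only [secondDiff_toC]
    refine (((hh (σ + ω • α) ε hε).add (hh (σ + -(ω • α)) ε hε)).sub
      ((hh σ ε hε).mul_left 2)).congr_fun fun n => ?_
    ring
  have h4 := (h3.add h2).add (hl ε hε)
  rw [he σ ε hε] at h4
  exact h4.congr_fun fun n => by ring

end Analytic

/-! ### Expansion in powers of `ε` -/

section Expansion

variable {ρ r : ℝ} {f : (Fin d → ℂ) → ℂ → ℂ} {c : (Fin d → ℤ) × ℕ → ℂ} {ε : ℂ}

lemma MemA.congr {φ ψ : (Fin d → ℂ) → ℂ} (hφ : MemA ρ φ) (h : ∀ η ∈ closedStrip d ρ, ψ η = φ η) :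
    MemA ρ ψ where
  periodic η hη k := by
    have hk : (η + fun i => (k i : ℂ)) ∈ closedStrip d ρ := fun i => by simpa using hη i
    rw [h _ hk, h η hη, hφ.periodic η hη k]
  holomorphic := hφ.holomorphic.congr fun η hη => h η (strip_subset_closedStrip le_rfl hη)
  continuousOn := hφ.continuousOn.congr h

/-- The coefficient of `ε ^ n`, a function of `η`. -/
def coeffFun (c : (Fin d → ℤ) × ℕ → ℂ) (n : ℕ) (η : Fin d → ℂ) : ℂ :=
  ∑' k, c (k, n) * character k η

lemma HasCoeff.summable_coeff (hr : 0 < r) (hf : HasCoeff ρ r f c) (n : ℕ) :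
    Summable fun k => ‖c (k, n)‖ * Real.exp (2 * Real.pi * ρ * absZ k) := by
  have h1 := hf.summable.comp_injective (Prod.mk_left_injective (α := Fin d → ℤ) n)
  refine (h1.mul_right ((r ^ n)⁻¹)).congr fun k => ?_
  have : r ^ n ≠ 0 := by positivity
  simp only [Function.comp, weight]
  field_simp

lemma HasCoeff.memA_coeffFun (hρ : 0 < ρ) (hr : 0 < r) (hf : HasCoeff ρ r f c) (n : ℕ) :
    MemA ρ (coeffFun c n) := memA_series hρ (hf.summable_coeff hr n)

lemma HasCoeff.norm_coeffFun_le (hr : 0 < r) (hf : HasCoeff ρ r f c) (n : ℕ)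
    {η : Fin d → ℂ} (hη : η ∈ closedStrip d ρ) :
    r ^ n * ‖coeffFun c n η‖ ≤ ∑' k, ‖c (k, n)‖ * weight ρ r (k, n) := by
  have h1 := tsum_of_norm_bounded (hf.summable_coeff hr n).hasSum fun k =>
    norm_series_term_le (c := fun k => c (k, n)) k hη
  refine (mul_le_mul_of_nonneg_left h1 (by positivity)).trans (le_of_eq ?_)
  rw [← tsum_mul_left]
  refine tsum_congr fun k => ?_
  simp only [weight]; ring

lemma HasCoeff.hasSum_norm (hf : HasCoeff ρ r f c) :
    HasSum (fun n => ∑' k, ‖c (k, n)‖ * weight ρ r (k, n)) (∑' m, ‖c m‖ * weight ρ r m) := by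
  have h := (Equiv.prodComm ℕ (Fin d → ℤ)).hasSum_iff.2 hf.summable.hasSum
  exact h.prod_fiberwise fun n => (h.summable.prod_factor n).hasSum

lemma HasCoeff.summable_stripNorm (hρ : 0 ≤ ρ) (hr : 0 < r) (hf : HasCoeff ρ r f c) :
    Summable fun n => r ^ n * stripNorm ρ (coeffFun c n) := by
  have : Nonempty (closedStrip d ρ) := ⟨⟨_, toC_mem_closedStrip hρ 0⟩⟩
  refine hf.hasSum_norm.summable.of_nonneg_of_le
    (fun n => mul_nonneg (by positivity) (Real.iSup_nonneg fun _ => norm_nonneg _)) fun n => ?_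
  rw [← le_div_iff₀' (by positivity)]
  refine ciSup_le fun η => ?_
  rw [le_div_iff₀' (by positivity)]
  exact hf.norm_coeffFun_le hr n η.2

lemma HasCoeff.summable_coeffFun (hr : 0 < r) (hf : HasCoeff ρ r f c) {η : Fin d → ℂ}
    (hη : η ∈ closedStrip d ρ) (hε : ‖ε‖ ≤ r) :
    (Summable fun n => ‖coeffFun c n η * ε ^ n‖) ∧
      ∑' n, ‖coeffFun c n η * ε ^ n‖ ≤ ∑' m, ‖c m‖ * weight ρ r m := by
  have hle : ∀ n, ‖coeffFun c n η * ε ^ n‖ ≤ ∑' k, ‖c (k, n)‖ * weight ρ r (k, n) := fun n => by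
    refine le_trans ?_ (hf.norm_coeffFun_le hr n hη)
    rw [norm_mul, norm_pow, mul_comm]
    gcongr
  have h := hf.hasSum_norm.summable.of_nonneg_of_le (fun n => norm_nonneg _) hle
  exact ⟨h, (h.tsum_le_tsum hle hf.hasSum_norm.summable).trans hf.hasSum_norm.tsum_eq.le⟩

lemma HasCoeff.hasSum_coeffFun (hr : 0 < r) (hf : HasCoeff ρ r f c) {η : Fin d → ℂ}
    (hη : η ∈ closedStrip d ρ) (hε : ‖ε‖ ≤ r) :
    HasSum (fun n => coeffFun c n η * ε ^ n) (f η ε) := by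
  have h := (Equiv.prodComm ℕ (Fin d → ℤ)).hasSum_iff.2 (hf.hasSum η hη ε hε)
  refine h.prod_fiberwise fun n => ?_
  refine ((hasSum_series (hf.summable_coeff hr n) hη).mul_right (ε ^ n)).congr_fun fun k => ?_
  simp only [Function.comp, Equiv.prodComm_apply, Prod.swap, monom]; ring

lemma average_coeffFun (hρ : 0 ≤ ρ) (hr : 0 < r) (hf : HasCoeff ρ r f c) (n : ℕ) :
    average (coeffFun c n) = c (0, n) := by
  have h1 := hf.summable_coeff hr n
  have h := average_hasSum (k := id) (summable_of_summable_exp hρ h1) (f := coeffFun c n)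
    fun σ => hasSum_series h1 (toC_mem_closedStrip hρ σ)
  have h2 := hasSum_single (f := fun k => if id k = 0 then c (k, n) else 0) 0
    fun k hk => by simp [hk]
  rw [h.unique h2]; simp

lemma HasCoeff.hasSum_avg_pow (hρ : 0 ≤ ρ) (hf : HasCoeff ρ r f c) (hε : ‖ε‖ ≤ r) :
    HasSum (fun n => c (0, n) * ε ^ n) (avg f ε) := by
  have h := (Function.Injective.hasSum_iff (Prod.mk_right_injective (0 : Fin d → ℤ)) fun m hm => by
    rw [if_neg]
    rintro h0
    exact hm ⟨m.2, by rw [← h0]⟩).2 (hf.hasSum_avg hρ hε)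
  simpa [Function.comp_def] using h

lemma HasCoeff.average_coeffFun_eq_zero (hρ : 0 ≤ ρ) (hr : 0 < r) (hf : HasCoeff ρ r f c)
    (h0 : ∀ ε : ℂ, ‖ε‖ ≤ r → avg f ε = 0) (n : ℕ) : average (coeffFun c n) = 0 := by
  rw [average_coeffFun hρ hr hf]
  exact eq_zero_of_hasSum_zero hr
    (fun ε hε => by rw [← h0 ε hε]; exact hf.hasSum_avg_pow hρ hε) n

/-- Power series expansion of a function of `ε` alone. -/
lemma Wiener.exists_powerSeries {L : ℂ → ℂ} {K : ℝ} (hρ : 0 ≤ ρ)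
    (hL : Wiener (d := d) ρ r (fun _ ε => L ε) K) :
    ∃ l : ℕ → ℂ, (Summable fun n => r ^ n * ‖l n‖) ∧
      ∀ ε : ℂ, ‖ε‖ ≤ r → HasSum (fun n => l n * ε ^ n) (L ε) := by
  obtain ⟨c, hc, -⟩ := hL
  refine ⟨fun n => c (0, n), ?_, fun ε hε => ?_⟩
  · refine (hc.summable.comp_injective (Prod.mk_right_injective (0 : Fin d → ℤ))).congr fun n => ?_
    simp [weight, absZ_zero, mul_comm]
  · have := hc.hasSum_avg_pow hρ hε
    rwa [avg_const L] at this

lemma coeffFun_eq_of_eq_on_real {C C' : (Fin d → ℤ) × ℕ → ℂ} {ρ ρ' : ℝ} (hρ : 0 ≤ ρ)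
    (hρ' : 0 ≤ ρ') {n : ℕ}
    (hC : Summable fun k => ‖C (k, n)‖ * Real.exp (2 * Real.pi * ρ * absZ k))
    (hC' : Summable fun k => ‖C' (k, n)‖ * Real.exp (2 * Real.pi * ρ' * absZ k))
    (h : ∀ σ : Fin d → ℝ, coeffFun C n (toC σ) = coeffFun C' n (toC σ)) :
    coeffFun C n = coeffFun C' n := by
  ext η
  refine tsum_congr fun k => ?_
  rw [← fourierCoef_of_hasSum (f := coeffFun C n) (summable_of_summable_exp hρ hC)
      (fun σ => hasSum_series hC (toC_mem_closedStrip hρ σ)) k,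
    ← fourierCoef_of_hasSum (f := coeffFun C' n) (summable_of_summable_exp hρ' hC')
      (fun σ => hasSum_series hC' (toC_mem_closedStrip hρ' σ)) k, fourierCoef_congr h]

end Expansion

/-! ### The convergent solution -/

section Convergent

variable {ω ρ₀ ρ κ : ℝ} {α : Fin d → ℝ} {U : (Fin d → ℂ) → ℂ} {N : ℕ}

lemma exists_abs_le (α : Fin d → ℝ) : ∃ A : ℝ, 0 < A ∧ ∀ i, |α i| ≤ A :=
  ⟨1 + ∑ i, |α i|, by positivity, fun i => by
    have := Finset.single_le_sum (f := fun i => |α i|) (fun _ _ => abs_nonneg _) (Finset.mem_univ i)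
    linarith⟩

/-- For small `ε` the interaction `ε U` is small. -/
lemma MemA.exists_small (hρ₀ : 0 < ρ₀) (hU : MemA ρ₀ U) {ρ₁ : ℝ} (hρ₁ : 0 < ρ₁) (h : ρ₁ < ρ₀)
    {e : ℝ} (he : 0 < e) : ∃ r : ℝ, 0 < r ∧ Wiener ρ₁ r (fun η ε => ε * U η) e := by
  obtain ⟨M, hM0, hM⟩ := hU.exists_bound
  set K := M * fourierConst d (Real.pi * (ρ₀ - ρ₁))
  have hK : 0 ≤ K := mul_nonneg hM0 (fourierConst_nonneg _)
  have hr : 0 < e / (K + 1) := by positivity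
  refine ⟨e / (K + 1), hr, ?_⟩
  have h1 := (Wiener.of_monom (ρ := ρ₁) ((0, 1) : (Fin d → ℤ) × ℕ) hr).mul hρ₁.le hr
    (hU.wiener hρ₀ hM hρ₁ h hr)
  refine (h1.mono_right ?_).congr fun η _ ε _ => by simp [monom, character_zero]
  have h2 : weight ρ₁ (e / (K + 1)) ((0, 1) : (Fin d → ℤ) × ℕ) = e / (K + 1) := by
    simp [weight, absZ_zero]
  rw [h2, div_mul_eq_mul_div, div_le_iff₀ (by positivity)]
  nlinarith

/-- Existence and local uniqueness of the convergent solution on a smaller strip. -/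
theorem exists_convergent_solution (hs : SmallDivisors (ω • α) κ N) (hκ : 0 < κ) (hρ₀ : 0 < ρ₀)
    (hU : MemA ρ₀ U) (hρ : 0 < ρ) (hρρ₀ : ρ < ρ₀) :
    ∃ (C : (Fin d → ℤ) × ℕ → ℂ) (l : ℕ → ℂ) (r δ : ℝ) (H : ℂ → (Fin d → ℂ) → ℂ) (L : ℂ → ℂ),
      0 < r ∧ 0 < δ ∧ (∀ n, Summable fun k => ‖C (k, n)‖ * Real.exp (2 * Real.pi * ρ * absZ k)) ∧
      FormalHullSolution ω α U (coeffFun C) l ∧ FormalNormalized (coeffFun C) ∧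
      ConvergesTo ρ r (coeffFun C) l H L ∧
      ∀ ε : ℂ, ‖ε‖ ≤ r →
        NormalizedHullSolution ω α ρ₀ (fun z => ε * U z) ρ (H ε) (L ε) ∧
        ∀ (g : (Fin d → ℂ) → ℂ) (c : ℂ),
          NormalizedHullSolution ω α ρ₀ (fun z => ε * U z) ρ g c →
          (∀ η ∈ closedStrip d ρ, ‖g η - H ε η‖ ≤ δ) →
          c = L ε ∧ ∀ η ∈ closedStrip d ρ, g η = H ε η := by
  obtain ⟨A, hA0, hA⟩ := exists_abs_le α
  set ρ₁ := (ρ + ρ₀) / 2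
  set β := min (ρ / (16 * A)) ((ρ₀ - ρ) / (4 * A))
  have hβ : 0 < β := lt_min (by positivity) (div_pos (by linarith) (by positivity))
  have hAβ : A * β ≤ (ρ₀ - ρ) / 4 := by
    have h1 : β ≤ (ρ₀ - ρ) / (4 * A) := min_le_right _ _
    calc A * β ≤ A * ((ρ₀ - ρ) / (4 * A)) := mul_le_mul_of_nonneg_left h1 hA0.le
      _ = _ := by field_simp
  obtain ⟨e, he, hex⟩ := exists_hull_solution (ρ₁ := ρ₁) hs hκ hA hA0 hρ (by simp only [ρ₁]; linarith) hβ
  obtain ⟨δ, hδ, huniq⟩ := local_uniqueness hs hκ hA hA0 hρ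
  obtain ⟨r, hr, hV⟩ := hU.exists_small hρ₀ (ρ₁ := ρ₁) (by positivity)
    (by simp only [ρ₁]; linarith) (lt_min he one_pos)
  obtain ⟨v, hv, hvs⟩ := id hV
  obtain ⟨H, L, hH, ⟨K, hL⟩, hH0, hE⟩ := hex r _ v hr hv (hvs.trans (min_le_left _ _))
  obtain ⟨C, hC, hCβ⟩ := id hH
  obtain ⟨l, hl, hlL⟩ := hL.exists_powerSeries hρ.le
  have hmem : ∀ n, MemA ρ (coeffFun C n) := hC.memA_coeffFun hρ hr
  have hnorm : FormalNormalized (coeffFun C) := hC.average_coeffFun_eq_zero hρ.le hr hH0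
  set F := fourierConst d (Real.pi * (ρ - ρ / 2))
  have hF : 0 ≤ F := fourierConst_nonneg _
  have hop : ∀ (η : Fin d → ℂ) (ε : ℂ), hullOperator ω α (fun z => ε * U z) (fun η => H η ε) (L ε) η
      = hullErr (ω • α) α (fun η ε => ε * U η) H L η ε := fun η ε => by
    rw [hullOperator, secondDiff_eq, hullErr]
  have hHmem : ∀ ε : ℂ, ‖ε‖ ≤ r → MemA ρ (fun η => H η ε) := fun ε hε => by
    obtain ⟨G, hG, hGH⟩ := hH.memA hρ hε
    exact hG.congr fun η hη => (hGH η hη).symm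
  have hsol : ∀ ε : ℂ, ‖ε‖ ≤ r →
      NormalizedHullSolution ω α ρ₀ (fun z => ε * U z) ρ (fun η => H η ε) (L ε) := fun ε hε =>
    { memA := hHmem ε hε
      normalized := hH0 ε hε
      mapsTo := fun η hη => closedStrip_subset_strip (by linarith)
        (add_smul_mem_closedStrip hA hη (hH.norm_le hη hε))
      equation := fun η hη => by rw [hop]; exact hE η hη ε hε }
  refine ⟨C, l, r, δ / (F + 1), fun ε η => H η ε, L, hr, by positivity, hC.summable_coeff hr, ?_,
    hnorm, ?_, fun ε hε => ⟨hsol ε hε, fun g c hg hgδ => ?_⟩⟩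
  · refine formalHullSolution_of_hasSum (H := H) (L := L) hs hκ hU hA hA0 hβ.le (by linarith) hr
      ⟨ρ, hρ, hmem 0⟩ (hnorm 0)
      (fun σ ε hε => hC.hasSum_coeffFun hr (toC_mem_closedStrip hρ.le σ) hε)
      (fun σ ε hε => ?_) hlL fun σ ε hε => ?_
    · have := hC.summable_coeffFun hr (toC_mem_closedStrip hρ.le σ) hε
      exact ⟨this.1, this.2.trans hCβ⟩
    · exact (hsol ε hε).equation _ (toC_mem_closedStrip hρ.le σ)
  · exact
    { memA := hmem
      summable_h := hC.summable_stripNorm hρ.le hr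
      summable_l := hl
      hasSum_h := fun ε hε η hη =>
        (hC.hasSum_coeffFun hr hη hε).congr_fun fun n => mul_comm _ _
      hasSum_l := fun ε hε => (hlL ε hε).congr_fun fun n => mul_comm _ _ }
  · have hρ2 : closedStrip d (ρ / 2) ⊆ closedStrip d ρ := closedStrip_mono (by linarith)
    obtain ⟨w, hw, hws⟩ := (hV.mono (ρ' := ρ) (by simp only [ρ₁]; linarith) hr.le le_rfl).freeze hε one_pos
    have hdiff : Wiener (ρ / 2) 1 (fun η _ => g η - H η ε) δ := by
      refine ((hg.memA.sub (hHmem ε hε)).wiener hρ hgδ (by positivity) (by linarith)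
        one_pos).mono_right ?_
      rw [div_mul_eq_mul_div, div_le_iff₀ (by positivity)]
      nlinarith
    have hreal : ∀ x : Fin d → ℝ, g (toC x) = H (toC x) ε := fun x =>
      huniq 1 _ w one_pos hw (hws.trans (min_le_right _ _)) (fun η _ => H η ε) (fun η _ => g η)
        (fun _ => L ε) (fun _ => c) ((hH.freeze hε one_pos).mono_right (min_le_left _ _))
        (fun _ _ => hH0 ε hε) (fun η hη _ _ => hE η (hρ2 hη) ε hε) hdiff
        (fun _ _ => hg.normalized) (fun η hη ε' _ => by
          have := hg.equation η (hρ2 hη)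
          rw [hullOperator, secondDiff_eq] at this
          exact this) x 0 (by simp)
    have heq := hg.memA.eq_of_eq_on_real hρ (hHmem ε hε) hreal
    refine ⟨?_, heq⟩
    have h0 := toC_mem_closedStrip (d := d) hρ.le 0
    have e1 := hg.equation _ h0
    have e2 := (hsol ε hε).equation _ h0
    rw [hullOperator, secondDiff_toC] at e1 e2
    simp only [hreal] at e1
    linear_combination e1 - e2

/-- A single formal series converges on every smaller strip. -/
theorem exists_solution (hs : SmallDivisors (ω • α) κ N) (hκ : 0 < κ) (hρ₀ : 0 < ρ₀)
    (hU : MemA ρ₀ U) :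
    ∃ (h : ℕ → (Fin d → ℂ) → ℂ) (l : ℕ → ℂ), FormalHullSolution ω α U h l ∧ FormalNormalized h ∧
      ((∀ σ : Fin d → ℝ, h 0 (toC σ) = 0) → h 0 = 0) ∧
      ∀ ρ : ℝ, 0 < ρ → ρ < ρ₀ →
        ∃ (r δ : ℝ) (H : ℂ → (Fin d → ℂ) → ℂ) (L : ℂ → ℂ), 0 < r ∧ 0 < δ ∧
          ConvergesTo ρ r h l H L ∧
          ∀ ε : ℂ, ‖ε‖ ≤ r →
            NormalizedHullSolution ω α ρ₀ (fun z => ε * U z) ρ (H ε) (L ε) ∧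
            ∀ (g : (Fin d → ℂ) → ℂ) (c : ℂ),
              NormalizedHullSolution ω α ρ₀ (fun z => ε * U z) ρ g c →
              (∀ η ∈ closedStrip d ρ, ‖g η - H ε η‖ ≤ δ) →
              c = L ε ∧ ∀ η ∈ closedStrip d ρ, g η = H ε η := by
  have hρ₁ : 0 < ρ₀ / 2 := by positivity
  obtain ⟨C, l, _, _, _, _, -, -, hC, hsol, hnorm, hconv, -⟩ :=
    exists_convergent_solution hs hκ hρ₀ hU hρ₁ (by linarith)
  refine ⟨coeffFun C, l, hsol, hnorm, fun h0 => ?_, fun ρ hρ hρρ₀ => ?_⟩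
  · have := coeffFun_eq_of_eq_on_real (C' := 0) (n := 0) hρ₁.le hρ₁.le (hC 0)
      (by simp) fun σ => by rw [h0]; simp [coeffFun]
    rw [this]; ext; simp [coeffFun]
  · obtain ⟨C', l', r, δ, H, L, hr, hδ, hC', hsol', hnorm', hconv', hH⟩ :=
      exists_convergent_solution hs hκ hρ₀ hU hρ hρρ₀
    have hu := hsol.unique hs hκ (fun n => ⟨_, hρ₁, hconv.memA n⟩)
      (fun n => ⟨_, hρ, hconv'.memA n⟩) hsol' hnorm hnorm'
    have e1 : l' = l := funext fun n => (hu n).1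
    have e2 : coeffFun C' = coeffFun C := funext fun n =>
      coeffFun_eq_of_eq_on_real hρ.le hρ₁.le (hC' n) (hC n) (hu n).2
    rw [e1, e2] at hconv'
    exact ⟨r, δ, H, L, hr, hδ, hconv', hH⟩

end Convergent

end QPLindstedt

end

theorem mainTheorem5 (d : ℕ) (hd : 2 ≤ d) (α : Fin d → ℝ) (ω ν τ ρ₀ : ℝ)
    (hν : 0 < ν) (hτ : 0 < τ) (hρ₀ : 0 < ρ₀)
    (hdioph : QPLindstedt.IsDiophantine ω α ν τ)
    (U : (Fin d → ℂ) → ℂ) (hU : QPLindstedt.MemA ρ₀ U) (hUreal : QPLindstedt.RealOnReal U) :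
    ∃ (h : ℕ → (Fin d → ℂ) → ℂ) (l : ℕ → ℝ),
      -- the coefficients are real analytic, on every smaller strip
      (∀ n, ∀ ρ : ℝ, 0 < ρ → ρ < ρ₀ → QPLindstedt.MemA ρ (h n)) ∧
      (∀ n, QPLindstedt.RealOnReal (h n)) ∧
      -- the series solve the hull equation and the normalization to all orders
      QPLindstedt.FormalHullSolution ω α U h (fun n => (l n : ℂ)) ∧
      QPLindstedt.FormalNormalized h ∧
      -- they are the only formal series that do
      (∀ (g : ℕ → (Fin d → ℂ) → ℂ) (m : ℕ → ℂ),
        (∀ n, ∃ ρ : ℝ, 0 < ρ ∧ QPLindstedt.MemA ρ (g n)) →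
        QPLindstedt.FormalHullSolution ω α U g m →
        QPLindstedt.FormalNormalized g →
        ∀ n, m n = (l n : ℂ) ∧
          ∀ σ : Fin d → ℝ, g n (QPLindstedt.toC σ) = h n (QPLindstedt.toC σ)) ∧
      -- order zero vanishes
      (∀ η ∈ QPLindstedt.strip d ρ₀, h 0 η = 0) ∧ l 0 = 0 ∧
      -- order `n ≥ 1` is the unique normalized solution of a cohomological equation
      (∀ n, 1 ≤ n →
        QPLindstedt.SolvesCohomological ω α (QPLindstedt.knownTerm α U h n) (h n) (l n) ∧
        (l n : ℂ) = -QPLindstedt.average (QPLindstedt.knownTerm α U h n) ∧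
        ∀ (φ : (Fin d → ℂ) → ℂ) (c : ℂ), (∃ ρ : ℝ, 0 < ρ ∧ QPLindstedt.MemA ρ φ) →
          QPLindstedt.average φ = 0 →
          QPLindstedt.SolvesCohomological ω α (QPLindstedt.knownTerm α U h n) φ c →
          c = (l n : ℂ) ∧
            ∀ σ : Fin d → ℝ, φ (QPLindstedt.toC σ) = h n (QPLindstedt.toC σ)) ∧
      -- the series converge for small complex `ε` to the locally unique solution
      (∀ ρ : ℝ, 0 < ρ → ρ < ρ₀ →
        ∃ (r δ : ℝ) (H : ℂ → (Fin d → ℂ) → ℂ) (L : ℂ → ℂ), 0 < r ∧ 0 < δ ∧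
          QPLindstedt.ConvergesTo ρ r h (fun n => (l n : ℂ)) H L ∧
          ∀ ε : ℂ, ‖ε‖ ≤ r →
            QPLindstedt.NormalizedHullSolution ω α ρ₀ (fun z => ε * U z) ρ (H ε) (L ε) ∧
            ∀ (g : (Fin d → ℂ) → ℂ) (c : ℂ),
              QPLindstedt.NormalizedHullSolution ω α ρ₀ (fun z => ε * U z) ρ g c →
              (∀ η ∈ QPLindstedt.closedStrip d ρ, ‖g η - H ε η‖ ≤ δ) →
              c = L ε ∧ ∀ η ∈ QPLindstedt.closedStrip d ρ, g η = H ε η) := by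
  open QPLindstedt in
  have hs := hdioph.smallDivisors
  have hκ : 0 < 4 * ν := by positivity
  obtain ⟨h, l, hsol, hnorm, hzero, hconv⟩ := QPLindstedt.exists_solution hs hκ hρ₀ hU
  have hmem : ∀ n, ∀ ρ : ℝ, 0 < ρ → ρ < ρ₀ → QPLindstedt.MemA ρ (h n) := fun n ρ hρ hρρ₀ => by
    obtain ⟨r, δ, H, L, -, -, hc, -⟩ := hconv ρ hρ hρρ₀
    exact hc.memA n
  have hρ₁ : 0 < ρ₀ / 2 := by positivity
  have hmem' : ∀ n, ∃ ρ : ℝ, 0 < ρ ∧ QPLindstedt.MemA ρ (h n) := fun n =>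
    ⟨ρ₀ / 2, hρ₁, hmem n _ hρ₁ (by linarith)⟩
  have hreal := hsol.real hs hκ hρ₀ hU hUreal hmem' hnorm
  have hl : (fun n => ((l n).re : ℂ)) = l := funext fun n => (hreal n).2
  obtain ⟨l0, h0⟩ := hsol.zero_order hs hκ (hmem' 0) hnorm
  have hcoh := ((QPLindstedt.formalHullSolution_iff h0).1 hsol).2
  refine ⟨h, fun n => (l n).re, hmem, fun n => (hreal n).1, by rw [hl]; exact hsol, hnorm,
    fun g m hg gsol gnorm n => ?_, fun η _ => by rw [hzero h0]; rfl, by simp [l0],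
    fun n hn => ?_, fun ρ hρ hρρ₀ => by rw [hl]; exact hconv ρ hρ hρρ₀⟩
  · rw [(hreal n).2]
    exact hsol.unique hs hκ hmem' hg gsol hnorm gnorm n
  · rw [(hreal n).2]
    obtain ⟨ρ, hρ, hm⟩ := hmem' n
    refine ⟨hcoh n hn, ?_, fun φ c hφ hφ0 hφs => ?_⟩
    · have e1 : QPLindstedt.average (QPLindstedt.knownTerm α U h n)
          = QPLindstedt.average (fun η => -l n - QPLindstedt.secondDiff ω α (h n) η) := QPLindstedt.average_congr fun σ => by
        linear_combination hcoh n hn σ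
      rw [e1, QPLindstedt.average_const_sub_secondDiff hρ hm, neg_neg]
    · obtain ⟨ρ', hρ', hm'⟩ := hφ
      exact QPLindstedt.solvesCohomological_unique hs hκ hρ' hρ hm' hm hφ0 (hnorm n) (fun _ => rfl) hφs
        (hcoh n hn)
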